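/- Let $p=(p(x))_{x\in\mathbb Z}$ be a probability distribution on $\mathbb Z$ such that, for some $\delta>0$, $\sum_x e^{\theta x}p(x)<\infty$ whenever $|\theta|\le\delta$. Put $v=\sum_x x\,p(x)$ and $\kappa_2=\sum_x x^2p(x)$. For each $n=1,2,\dots$ consider, on some probability space, random variables $\eta_0^n(m)\in\{0,1,2,\dots\}$, $m\in\mathbb Z$ (the number of particles initially at $m$), and processes $X^n_{m,j}=(X^n_{m,j}(t))_{t\ge0}$, $m\in\mathbb Z$, $j\ge1$, where $X^n_{m,j}$ is a continuous-time random walk on $\mathbb Z$ started at $m$ which makes jumps of size $x$ at rate $p(x)$; the processes $X^n_{m,j}(\cdot)-X^n_{m,j}(0)$ are independent of each other, and this family is independent of $\eta^n_0$. Assume that for each $n$ the variables $\eta_0^n(m)$, $m\in\mathbb Z$, are independent, that $\sup_{n,m}E[\eta_0^n(m)^{12}]<\infty$, and that for two given finite numbers $\rho_0,v_0\ge0$ the following holds with $a_n(m)=E[\eta_0^n(m)]$, $a=\rho_0$, and also with $a_n(m)=\operatorname{Var}[\eta^n_0(m)]$, $a=v_0$: there are positive integers $L(n)$ with $n^{-1/4}L(n)\to0$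 such that for every finite constant $A$ $$\lim_{n\to\infty}\ \sup_{|m|\le A\sqrt{n\log n}}\ n^{1/4}\Bigl|\frac1{L(n)}\sum_{j=1}^{L(n)}a_n(m+j)-a\Bigr|=0 .$$ Fix $T,S>0$ and let $Q=[0,T]\times[-S,S]$. With $[\cdot]$ the integer part (floor), define for $(t,r)\in Q$ the net right-to-left current across the characteristic line $$Y_n(t,r)=\sum_{m\in\mathbb Z}\sum_{j=1}^{\eta_0^n(m)}\Bigl[\mathbf 1\{X^n_{m,j}(nt)\le[nvt]+[r\sqrt n]\}\mathbf 1\{m>[r\sqrt n]\}-\mathbf 1\{X^n_{m,j}(nt)>[nvt]+[r\sqrt n]\}\mathbf 1\{m\le[r\sqrt n]\}\Bigr].$$ For $\sigma^2>0$ let $\phi_{\sigma^2}$ and $\Phi_{\sigma^2}$ be the density and the distribution function of the centered normal distribution with variance $\sigma^2$, and for $x\ge0$ let $\Psi_{\sigma^2}(x)=\sigma^2\phi_{\sigma^2}(x)-x(1-\Phi_{\sigma^2}(x))$ and $\Psi_0(x)=0$ (the limit as $\sigma^2\downarrow0$). For $(s,q),(t,r)\in Q$ put $$\Gamma_0((s,q),(t,r))=\Psi_{\kappa_2s}(|q-r|)+\Psi_{\kappa_2t}(|q-r|)-\Psi_{\kappa_2(t+s)}(|q-r|),$$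 $$\Gamma_q((s,q),(t,r))=\Psi_{\kappa_2(t+s)}(|q-r|)-\Psi_{\kappa_2|t-s|}(|q-r|),$$ where the subscript $q$ in $\Gamma_q$ is only a label. Then for every $n$ and every $(t,r)\in Q$ the series defining $Y_n(t,r)$ converges almost surely, there is a centered Gaussian process $Z=(Z(t,r))_{(t,r)\in Q}$ with covariance $$E[Z(s,q)Z(t,r)]=\rho_0\,\Gamma_q((s,q),(t,r))+v_0\,\Gamma_0((s,q),(t,r)),$$ and the finite-dimensional distributions of $n^{-1/4}Y_n$ converge weakly to those of $Z$: for all $N$ and all $(t_1,r_1),\dots,(t_N,r_N)\in Q$, as $n\to\infty$, $$n^{-1/4}\bigl(Y_n(t_1,r_1),\dots,Y_n(t_N,r_N)\bigr)\ \longrightarrow\ \bigl(Z(t_1,r_1),\dots,Z(t_N,r_N)\bigr)\quad\text{in distribution.}$$ -/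

import Mathlib

open MeasureTheory ProbabilityTheory Filter Set
open scoped NNReal ENNReal Topology

noncomputable section

namespace RWCurrent

/-! ### Continuous-time random walks on the integers -/

/-- The distribution of `ξ₁ + ⋯ + ξₖ` for i.i.d. integer variables `ξᵢ` with distribution `p`. -/
def iidSum (p : PMF ℤ) : ℕ → PMF ℤ
  | 0 => PMF.pure 0
  | k + 1 => (iidSum p k).bind fun x => p.map fun y => x + y

/-- The distribution of `ξ₁ + ⋯ + ξ_N`, where `N` is Poisson with mean `lam` and independent of the
i.i.d. variables `ξᵢ` with distribution `p`. -/
def compoundPoisson (p : PMF ℤ) (lam : ℝ≥0) : Measure ℤ :=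
  (poissonMeasure lam).bind fun k => (iidSum p k).toMeasure

/-- `X` is a continuous-time random walk on `ℤ` started at `m` that jumps by `x` at rate `p x`
(total jump rate one): a càdlàg process with independent stationary increments, the increment over
a time interval of length `h` being a sum of a Poisson(`h`) number of i.i.d. jumps with
distribution `p`. -/
structure IsRandomWalk {Ω : Type*} [MeasurableSpace Ω] (P : Measure Ω) (p : PMF ℤ) (m : ℤ)
    (X : ℝ≥0 → Ω → ℤ) : Prop where
  measurable : ∀ t, Measurable (X t)
  start : ∀ᵐ ω ∂P, X 0 ω = m
  cadlag : ∀ᵐ ω ∂P, ∀ t, ContinuousWithinAt (fun s => X s ω) (Ici t) t ∧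
    ∃ l, Tendsto (fun s => X s ω) (𝓝[<] t) (𝓝 l)
  indep_increments : HasIndepIncrements X P
  law_increments : ∀ s t, s ≤ t →
    HasLaw (fun ω => X t ω - X s ω) (compoundPoisson p (t - s)) P

/-- The particle system: `η m` is the number of particles initially at site `m`, and `X m j` is the
walk of the `j`-th particle (`j = 0, 1, …`) that starts at `m`.  The displacements of all the walks
are i.i.d. random walks started at the origin, and they are independent of `η`. -/
structure IsWalkSystem {Ω : Type*} [MeasurableSpace Ω] (P : Measure Ω) (p : PMF ℤ)
    (η : ℤ → Ω → ℕ) (X : ℤ → ℕ → ℝ≥0 → Ω → ℤ) : Prop where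
  measurable_occupation : ∀ m, Measurable (η m)
  walk : ∀ m j, IsRandomWalk P p m (X m j)
  indep_walks : iIndepFun
    (fun (i : ℤ × ℕ) (ω : Ω) (t : ℝ≥0) => X i.1 i.2 t ω - X i.1 i.2 0 ω) P
  indep_occupation : IndepFun (fun (ω : Ω) (m : ℤ) => η m ω)
    (fun (ω : Ω) (i : ℤ × ℕ) (t : ℝ≥0) => X i.1 i.2 t ω - X i.1 i.2 0 ω) P

/-- Finite exponential moments of the jump kernel near zero. -/
def HasExpMoments (p : PMF ℤ) : Prop :=
  ∃ δ : ℝ, 0 < δ ∧ ∀ θ : ℝ, |θ| ≤ δ → Summable fun x : ℤ => Real.exp (θ * x) * (p x).toReal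

/-- The mean `v` of the jump kernel. -/
def drift (p : PMF ℤ) : ℝ := ∑' x : ℤ, (x : ℝ) * (p x).toReal

/-- The second moment `κ₂` of the jump kernel. -/
def kappa2 (p : PMF ℤ) : ℝ := ∑' x : ℤ, (x : ℝ) ^ 2 * (p x).toReal

/-! ### Initial occupation variables -/

/-- Averages of `a n` over blocks of some length `L n = o(n^{1/4})` converge to `a₀` faster than
`n^{-1/4}`, uniformly over blocks with left end in `|m| ≤ A √(n log n)`, for every `A`. -/
def BlockAveragesTendsto (a : ℕ+ → ℤ → ℝ) (a₀ : ℝ) : Prop :=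
  ∃ L : ℕ+ → ℕ, (∀ n, 0 < L n) ∧
    Tendsto (fun n : ℕ+ => (n : ℝ) ^ (-(1 / 4) : ℝ) * (L n : ℝ)) atTop (𝓝 0) ∧
    ∀ A : ℝ, ∀ ε : ℝ, 0 < ε → ∀ᶠ n : ℕ+ in atTop, ∀ m : ℤ,
      |(m : ℝ)| ≤ A * √((n : ℝ) * Real.log (n : ℝ)) →
        (n : ℝ) ^ (1 / 4 : ℝ) *
          |1 / (L n : ℝ) * ∑ j ∈ Finset.Icc 1 (L n), a n (m + (j : ℤ)) - a₀| ≤ ε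

/-- The assumptions on the initial occupation variables `η n`, `n = 1, 2, …`, with asymptotic mean
`ρ₀` and asymptotic variance `v₀`. -/
structure InitialAssumption {Ω : ℕ+ → Type*} [∀ n, MeasurableSpace (Ω n)]
    (P : ∀ n, Measure (Ω n)) (η : ∀ n, ℤ → Ω n → ℕ) (ρ₀ v₀ : ℝ) : Prop where
  indep : ∀ n, iIndepFun (η n) (P n)
  moment : ∃ C : ℝ≥0, ∀ n x, ∫⁻ ω, (η n x ω : ℝ≥0∞) ^ 12 ∂(P n) ≤ C
  mean : BlockAveragesTendsto (fun n x => ∫ ω, (η n x ω : ℝ) ∂(P n)) ρ₀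
  var : BlockAveragesTendsto (fun n x => variance (fun ω => (η n x ω : ℝ)) (P n)) v₀

/-! ### The current -/

/-- The contribution to the current of the particles that start at site `m`, in the system with
scaling parameter `n`, for the characteristic line with speed `v` through `(⌊r √n⌋, 0)` and time
`n t`. -/
def siteCurrent {Ω : Type*} (v : ℝ) (n : ℕ+) (η : ℤ → Ω → ℕ) (X : ℤ → ℕ → ℝ≥0 → Ω → ℤ)
    (t : ℝ≥0) (r : ℝ) (ω : Ω) (m : ℤ) : ℝ :=
  ∑ j ∈ Finset.range (η m ω),
    ((if X m j ((n : ℝ≥0) * t) ω ≤ ⌊(n : ℝ) * v * (t : ℝ)⌋ + ⌊r * √(n : ℝ)⌋ then 1 else 0) *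
        (if m > ⌊r * √(n : ℝ)⌋ then 1 else 0) -
      (if X m j ((n : ℝ≥0) * t) ω > ⌊(n : ℝ) * v * (t : ℝ)⌋ + ⌊r * √(n : ℝ)⌋ then 1 else 0) *
        (if m ≤ ⌊r * √(n : ℝ)⌋ then 1 else 0))

/-- The net right-to-left particle current `Y_n(t, r)`. -/
def current {Ω : Type*} (v : ℝ) (n : ℕ+) (η : ℤ → Ω → ℕ) (X : ℤ → ℕ → ℝ≥0 → Ω → ℤ)
    (t : ℝ≥0) (r : ℝ) (ω : Ω) : ℝ :=
  ∑' m : ℤ, siteCurrent v n η X t r ω m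

/-! ### The limiting covariance -/

/-- The centered Gaussian distribution function with variance `σ2`; for `σ2 = 0` it is the
distribution function of the unit mass at `0`. -/
def gaussCDF (σ2 : ℝ) (x : ℝ) : ℝ := (gaussianReal 0 σ2.toNNReal).real (Iic x)

/-- `Ψ_{σ²}(x) = σ² φ_{σ²}(x) - x (1 - Φ_{σ²}(x))`, with `φ` the centered Gaussian density.  For
`σ2 = 0` the first term is `0`, so that `Ψ_0(x) = 0` for `x ≥ 0`, which is the limit as
`σ² → 0`. -/
def Psi (σ2 : ℝ) (x : ℝ) : ℝ :=
  σ2 * gaussianPDFReal 0 σ2.toNNReal x - x * (1 - gaussCDF σ2 x)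

def Gamma0 (κ₂ : ℝ) (a b : ℝ≥0 × ℝ) : ℝ :=
  Psi (κ₂ * a.1) |a.2 - b.2| + Psi (κ₂ * b.1) |a.2 - b.2| -
    Psi (κ₂ * ((b.1 : ℝ) + a.1)) |a.2 - b.2|

def Gammaq (κ₂ : ℝ) (a b : ℝ≥0 × ℝ) : ℝ :=
  Psi (κ₂ * ((b.1 : ℝ) + a.1)) |a.2 - b.2| - Psi (κ₂ * |(b.1 : ℝ) - a.1|) |a.2 - b.2|

end RWCurrent

end

noncomputable section

namespace RWCurrent

/-! Put `k = ⌊r√n⌋`. A particle that starts at `m` and has displacement `d` at time `nt` contributes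
`1{m ≤ x} - 1{m ≤ k}` to the current, where `x = ⌊nvt⌋ + k - d`. A linear combination of currents is
therefore a sum over sites of independent terms, and the term of a site is a sum of a random number
`η m` of bounded i.i.d. variables. The absolute moments of these terms, summed over all sites, are
of order `√n`. After scaling by `n^{-1/4}` the third moments add up to `O(n^{-3/4} · n^{1/2}) → 0`,
so a comparison of characteristic functions in the spirit of Lyapunov
(`norm_integral_exp_tsum_sub_le`) leaves only the total mean and the total variance to be computed.

Conditioning on `η m` gives the variance of one site as `E[η] Var G + Var[η] (E G)²`
(`RandomSumData.variance_eq`). This is where the two parts `ρ₀ Γ_q` and `v₀ Γ₀` of the covariance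
separate. The coefficients `E[η m]` and `Var[η m]` may be replaced by `ρ₀` and `v₀`: as functions of
`m` the weights have bounded variation, so averaging over blocks of length `L = o(n^{1/4})` costs
`O(L)`, and exponential moments make the sites beyond a multiple of `√(n log n)` negligible
(`abs_tsum_mul_sub_le`, `tail_bound`, `BlockAveragesTendsto.tendsto_tsum_mul`).

What remains are sums over `m` of products of step differences. They are explicit combinations of
absolute values (`hasSum_step_mul`), so the limits follow from the central limit theorem for `E|D +
c| / √n`, together with `E|G + x| = 2Ψ(|x|) + |x|` for a centered Gaussian `G`. Products inside one
walk involve the increment over `|t - s|` and yield `Ψ_{κ₂|t-s|}`. Products of expectations are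
expectations for two independent walks and yield `Ψ_{κ₂(t+s)}`. The total mean reduces to `⌊nvt⌋ -
nvt`, which is bounded, up to an error `o(n^{1/4})`.

The limiting covariance is positive semidefinite because its quadratic forms are limits of variances
(`InitialAssumption.limitCov_nonneg`). The process `Z` is then built as an isonormal process on the
reproducing kernel Hilbert space of the covariance, and Lévy's continuity theorem finishes the
argument. -/

/-! ### Gaussian processes with a given covariance -/

open scoped RealInnerProductSpace in
/-- A positive semidefinite real kernel has a feature map into a real Hilbert space. -/
lemma exists_feature_map {Q : Type} (K : Q → Q → ℝ) (hsymm : ∀ a b, K a b = K b a)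
    (hpos : ∀ c : Q →₀ ℝ, 0 ≤ c.sum fun a x => c.sum fun b y => x * y * K a b) :
    ∃ (H : Type) (_ : NormedAddCommGroup H) (_ : InnerProductSpace ℝ H) (_ : CompleteSpace H)
      (k : Q → H), ∀ a b, ⟪k a, k b⟫ = K a b := by
  -- Reproducing kernel Hilbert spaces are set up for operator-valued kernels, so each scalar `K a
  -- b` acts on `ℝ` by multiplication. The feature vector of `a` is the kernel function at `a`
  -- applied to `1`.
  let M : Matrix Q Q (ℝ →L[ℝ] ℝ) := fun a b => K a b • ContinuousLinearMap.id ℝ ℝ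
  have hM : M.PosSemidef := by
    refine ((RKHS.posSemidef_tfae (K := M)).out 0 2 rfl rfl).2 ⟨?_, fun c => ?_⟩
    · ext a b
      rw [Matrix.conjTranspose_apply]
      have h1 : star (ContinuousLinearMap.id ℝ ℝ) = ContinuousLinearMap.id ℝ ℝ := star_one _
      simp [M, hsymm a b, h1]
    · refine (hpos c).trans_eq ?_
      simp only [M]
      simp only [RCLike.re_to_real]
      refine Finsupp.sum_congr fun a _ => Finsupp.sum_congr fun b _ => ?_
      simp [hsymm b a]
      ring
  have : Fact M.PosSemidef := ⟨hM⟩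
  refine ⟨RKHS.OfKernel M, inferInstance, inferInstance, inferInstance,
    fun a => RKHS.kerFun (RKHS.OfKernel M) a 1, fun a b => ?_⟩
  rw [← RKHS.kernel_inner, RKHS.OfKernel.kernel_ofKernel]
  simp [M, hsymm a b]

lemma norm_exp_I_sub_exp_I_le (x y : ℝ) :
    ‖Complex.exp (x * Complex.I) - Complex.exp (y * Complex.I)‖ ≤ |x - y| := by
  have h : Complex.exp (x * Complex.I) - Complex.exp (y * Complex.I)
      = Complex.exp (y * Complex.I) * (Complex.exp (Complex.I * ((x - y : ℝ) : ℂ)) - 1) := by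
    rw [mul_sub, ← Complex.exp_add]
    push_cast
    ring_nf
  rw [h, norm_mul, Complex.norm_exp_ofReal_mul_I, one_mul]
  exact (Real.norm_exp_I_mul_ofReal_sub_one_le).trans_eq (Real.norm_eq_abs _)

/-- The characteristic function at `1` depends continuously on the variable in `L²`. -/
lemma continuous_integral_exp_Lp {Ω : Type*} [MeasurableSpace Ω] (P : Measure Ω)
    [IsProbabilityMeasure P] :
    Continuous fun f : Lp ℝ 2 P => ∫ ω, Complex.exp ((f ω : ℂ) * Complex.I) ∂P := by
  have hint : ∀ f : Lp ℝ 2 P,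
      Integrable (fun ω => Complex.exp ((f ω : ℂ) * Complex.I)) P := fun f => by
    refine Integrable.of_bound (C := 1) ?_ (ae_of_all _ fun ω => ?_)
    · have := (Lp.aestronglyMeasurable f)
      fun_prop
    · rw [Complex.norm_exp_ofReal_mul_I]
  refine LipschitzWith.continuous (K := 1) (LipschitzWith.of_dist_le_mul fun f g => ?_)
  rw [dist_eq_norm, ← integral_sub (hint f) (hint g), NNReal.coe_one, one_mul, dist_eq_norm]
  have hfg : Integrable (fun ω => |(f - g : Lp ℝ 2 P) ω|) P :=
    ((Lp.memLp (f - g)).integrable (by norm_num)).abs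
  calc _ ≤ ∫ ω, |(f - g : Lp ℝ 2 P) ω| ∂P := by
        refine norm_integral_le_of_norm_le hfg ?_
        filter_upwards [Lp.coeFn_sub f g] with ω hω
        rw [hω]
        exact norm_exp_I_sub_exp_I_le _ _
    _ ≤ _ := by
        rw [Lp.norm_def]
        have h1 : eLpNorm (f - g : Lp ℝ 2 P) 1 P ≤ eLpNorm (f - g : Lp ℝ 2 P) 2 P :=
          eLpNorm_le_eLpNorm_of_exponent_le (by norm_num) (Lp.aestronglyMeasurable _)
        have h2 := integral_norm_eq_lintegral_enorm (μ := P) (f := ((f - g : Lp ℝ 2 P) : Ω → ℝ))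
          (Lp.aestronglyMeasurable _)
        simp only [Real.norm_eq_abs] at h2
        rw [h2, ← eLpNorm_one_eq_lintegral_enorm]
        exact ENNReal.toReal_mono (Lp.eLpNorm_ne_top _) h1

open scoped RealInnerProductSpace in
/-- The isonormal Gaussian process on a Hilbert space. -/
lemma exists_isonormal (H : Type) [NormedAddCommGroup H] [InnerProductSpace ℝ H]
    [CompleteSpace H] :
    ∃ (Ω' : Type) (_ : MeasurableSpace Ω') (P' : Measure Ω') (_ : IsProbabilityMeasure P')
      (U : H →ₗᵢ[ℝ] Lp ℝ 2 P'),
      ∀ h, ∫ ω, Complex.exp ((U h ω : ℂ) * Complex.I) ∂P' = Complex.exp (-(‖h‖ ^ 2 : ℝ) / 2) := by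
  obtain ⟨w, b, -⟩ := exists_hilbertBasis ℝ H
  classical
  have hme : ∀ i : w, Measurable fun ω : w → ℝ => ω i := fun i => measurable_pi_apply i
  -- The basis vectors are sent to independent standard normal coordinates. These are orthonormal in
  -- `L²`, so the assignment extends to an isometry of `H`.
  let P' : Measure (w → ℝ) := Measure.infinitePi fun _ => gaussianReal 0 1
  have hmap : ∀ i, P'.map (fun ω => ω i) = gaussianReal 0 1 := fun i =>
    Measure.infinitePi_map_eval _ i
  have hindep : iIndepFun (fun (i : w) (ω : w → ℝ) => ω i) P' :=
    iIndepFun_infinitePi (X := fun _ x => x) (by fun_prop)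
  have hmem : ∀ i : w, MemLp (fun ω : w → ℝ => ω i) 2 P' := fun i => by
    have : MemLp id 2 (P'.map (fun ω => ω i)) := by
      rw [hmap]; exact memLp_id_gaussianReal 2
    exact (memLp_map_measure_iff (by fun_prop) (hme i).aemeasurable).1 this
  let ξ : w → Lp ℝ 2 P' := fun i => (hmem i).toLp
  have hinner : ∀ i j, ⟪ξ i, ξ j⟫ = ∫ ω, ω i * ω j ∂P' := fun i j => by
    rw [L2.inner_def]
    refine integral_congr_ae ?_
    filter_upwards [(hmem i).coeFn_toLp, (hmem j).coeFn_toLp] with ω h1 h2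
    simp only [ξ, h1, h2]
    simp [mul_comm]
  have hmean : ∀ i : w, ∫ ω, ω i ∂P' = 0 := fun i => by
    have := integral_map (μ := P') (φ := fun ω => ω i) (f := id) (hme i).aemeasurable (by fun_prop)
    simp only [id] at this
    rw [← this, hmap]
    simp
  have hsq : ∀ i : w, ∫ ω, ω i * ω i ∂P' = 1 := fun i => by
    have h1 := variance_fun_id_gaussianReal (μ := 0) (v := 1)
    rw [← hmap i, variance_map (by fun_prop) (hme i).aemeasurable,
      Function.comp_def, variance_of_integral_eq_zero (hme i).aemeasurable (by simpa using hmean i)] at h1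
    simpa [sq] using h1
  have hξ : Orthonormal ℝ ξ := by
    rw [orthonormal_iff_ite]
    intro i j
    rw [hinner]
    split_ifs with hij
    · subst hij; exact hsq i
    · rw [(hindep.indepFun hij).integral_fun_mul_eq_mul_integral
        (hme i).aestronglyMeasurable (hme j).aestronglyMeasurable]
      simp [hmean]
  let V : lp (fun _ : w => ℝ) 2 →ₗᵢ[ℝ] Lp ℝ 2 P' := hξ.orthogonalFamily.linearIsometry
  let U : H →ₗᵢ[ℝ] Lp ℝ 2 P' := V.comp b.repr.toLinearIsometry
  have hU : ∀ i, U (b i) = ξ i := fun i => by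
    classical
    simp only [U, LinearIsometry.coe_comp, Function.comp_apply,
      LinearIsometryEquiv.coe_toLinearIsometry, HilbertBasis.repr_self]
    simp only [V]
    rw [OrthogonalFamily.linearIsometry_apply_single]
    simp
  refine ⟨w → ℝ, inferInstance, P', inferInstance, U, fun h => ?_⟩
  -- For finite combinations of basis vectors the formula is independence of the coordinates. Both
  -- sides are continuous in `h`, and the partial sums of the basis expansion are such combinations.
  have hfin : ∀ (s : Finset w) (c : w → ℝ),
      ∫ ω, Complex.exp ((U (∑ i ∈ s, c i • b i) ω : ℂ) * Complex.I) ∂P'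
        = Complex.exp (-(‖∑ i ∈ s, c i • b i‖ ^ 2 : ℝ) / 2) := fun s c => by
    have hn : ‖∑ i ∈ s, c i • b i‖ ^ 2 = ∑ i ∈ s, c i ^ 2 := by
      rw [← real_inner_self_eq_norm_sq, b.orthonormal.inner_sum]
      simp [sq]
    have hae : ((U (∑ i ∈ s, c i • b i) : Lp ℝ 2 P') : (w → ℝ) → ℝ)
        =ᵐ[P'] fun ω => ∑ i ∈ s, c i * ω i := by
      have e : U (∑ i ∈ s, c i • b i) = ∑ i ∈ s, c i • ξ i := by
        simp [map_sum, hU]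
      rw [e]
      refine (Lp.coeFn_finsetSum s (fun i => c i • ξ i)).trans ?_
      have : ∀ᵐ ω ∂P', ∀ i ∈ s, (c i • ξ i : Lp ℝ 2 P') ω = c i * ω i := by
        rw [eventually_all_finset]
        intro i _
        filter_upwards [Lp.coeFn_smul (c i) (ξ i), (hmem i).coeFn_toLp] with ω h1 h2
        rw [h1, Pi.smul_apply, smul_eq_mul]
        simp only [ξ, h2]
      filter_upwards [this] with ω hω
      simp only [Finset.sum_apply]
      exact Finset.sum_congr rfl hω
    rw [integral_congr_ae (g := fun ω => ∏ i : {x // x ∈ s}, Complex.exp ((c i * ω i : ℝ) * Complex.I))]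
    · have hi : iIndepFun (fun (i : {x // x ∈ s}) (ω : w → ℝ) => ω i) P' :=
        hindep.precomp Subtype.val_injective
      rw [hi.integral_fun_prod_comp (f := fun (i : {x // x ∈ s}) x => Complex.exp ((c i * x : ℝ) * Complex.I))
        (fun i => (hme i).aemeasurable) (fun i => by fun_prop), hn]
      have h1 : ∀ i : w, ∫ ω, Complex.exp ((c i * ω i : ℝ) * Complex.I) ∂P'
          = Complex.exp (-(c i ^ 2 : ℝ) / 2) := fun i => by
        have := integral_map (μ := P') (φ := fun ω => ω i)
          (f := fun x : ℝ => Complex.exp ((c i * x : ℝ) * Complex.I))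
          (hme i).aemeasurable (by fun_prop)
        rw [← this, hmap]
        have h2 := charFun_gaussianReal (μ := 0) (v := 1) (c i)
        rw [charFun_apply_real] at h2
        simp only [Complex.ofReal_mul]
        rw [h2]
        push_cast
        congr 1
        simp
        ring
      simp only [h1]
      rw [Finset.prod_coe_sort s (fun i => Complex.exp (-(c i ^ 2 : ℝ) / 2)), ← Complex.exp_sum]
      congr 1
      push_cast
      rw [neg_div, Finset.sum_div, ← Finset.sum_neg_distrib]
      simp [neg_div]
    · filter_upwards [hae] with ω hω
      rw [hω, Finset.prod_coe_sort s (fun i => Complex.exp ((c i * ω i : ℝ) * Complex.I)),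
        ← Complex.exp_sum]
      congr 1
      push_cast
      rw [Finset.sum_mul]
  have hlim := b.hasSum_repr h
  have hL := ((continuous_integral_exp_Lp P').comp U.continuous).continuousAt.tendsto.comp hlim
  have hR : Tendsto (fun s : Finset w =>
      Complex.exp (-(‖∑ i ∈ s, b.repr h i • b i‖ ^ 2 : ℝ) / 2)) atTop
        (𝓝 (Complex.exp (-(‖h‖ ^ 2 : ℝ) / 2))) := by
    have hc : Continuous fun h : H => Complex.exp (-(‖h‖ ^ 2 : ℝ) / 2) := by fun_prop
    exact hc.continuousAt.tendsto.comp hlim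
  refine tendsto_nhds_unique hL (hR.congr fun s => ?_)
  exact (hfin s _).symm

/-- Existence of a centered Gaussian process with a prescribed positive semidefinite covariance. -/
theorem exists_gaussianProcess {Q : Type} (K : Q → Q → ℝ) (hsymm : ∀ a b, K a b = K b a)
    (hpos : ∀ c : Q →₀ ℝ, 0 ≤ c.sum fun a x => c.sum fun b y => x * y * K a b) :
    ∃ (Ω' : Type) (_ : MeasurableSpace Ω') (P' : Measure Ω') (_ : IsProbabilityMeasure P')
      (Z : Q → Ω' → ℝ), (∀ a, Measurable (Z a)) ∧ IsGaussianProcess Z P' ∧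
      (∀ a, ∫ ω, Z a ω ∂P' = 0) ∧ (∀ a b, ∫ ω, Z a ω * Z b ω ∂P' = K a b) ∧
      ∀ (ι : Type) [Fintype ι] (a : ι → Q) (c : ι → ℝ),
        ∫ ω, Complex.exp (((∑ i, c i * Z (a i) ω : ℝ) : ℂ) * Complex.I) ∂P'
          = Complex.exp (-(∑ i, ∑ j, c i * c j * K (a i) (a j) : ℝ) / 2) := by
  obtain ⟨H, _, _, _, k, hk⟩ := exists_feature_map K hsymm hpos
  obtain ⟨Ω', _, P', _, U, hU⟩ := exists_isonormal H
  let Z : Q → Ω' → ℝ := fun a => (Lp.aestronglyMeasurable (U (k a))).mk _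
  have hZm : ∀ a, Measurable (Z a) := fun a =>
    (Lp.aestronglyMeasurable (U (k a))).stronglyMeasurable_mk.measurable
  have hZ : ∀ a, Z a =ᵐ[P'] U (k a) := fun a =>
    (Lp.aestronglyMeasurable (U (k a))).ae_eq_mk.symm
  have hmem : ∀ a, MemLp (Z a) 2 P' := fun a => (memLp_congr_ae (hZ a)).2 (Lp.memLp _)
  have hcov : ∀ a b, ∫ ω, Z a ω * Z b ω ∂P' = K a b := fun a b => by
    rw [← hk a b, ← U.inner_map_map, L2.inner_def]
    refine integral_congr_ae ?_
    filter_upwards [hZ a, hZ b] with ω h1 h2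
    simp [h1, h2, mul_comm]
  have hchar : ∀ (ι : Type) [Fintype ι] (a : ι → Q) (c : ι → ℝ),
        ∫ ω, Complex.exp (((∑ i, c i * Z (a i) ω : ℝ) : ℂ) * Complex.I) ∂P'
          = Complex.exp (-(∑ i, ∑ j, c i * c j * K (a i) (a j) : ℝ) / 2) := by
    intro ι _ a c
    have hae : ((U (∑ i, c i • k (a i)) : Lp ℝ 2 P') : Ω' → ℝ)
        =ᵐ[P'] fun ω => ∑ i, c i * Z (a i) ω := by
      rw [map_sum]
      refine (Lp.coeFn_finsetSum _ (fun i => U (c i • k (a i)))).trans ?_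
      have : ∀ᵐ ω ∂P', ∀ i, (U (c i • k (a i)) : Lp ℝ 2 P') ω = c i * Z (a i) ω := by
        rw [ae_all_iff]
        intro i
        rw [map_smul]
        filter_upwards [Lp.coeFn_smul (c i) (U (k (a i))), hZ (a i)] with ω h1 h2
        rw [h1, Pi.smul_apply, smul_eq_mul, h2]
      filter_upwards [this] with ω hω
      simp only [Finset.sum_apply, hω]
    have hn : ‖∑ i, c i • k (a i)‖ ^ 2 = ∑ i, ∑ j, c i * c j * K (a i) (a j) := by
      rw [← real_inner_self_eq_norm_sq, sum_inner]
      refine Finset.sum_congr rfl fun i _ => ?_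
      rw [inner_sum]
      refine Finset.sum_congr rfl fun j _ => ?_
      rw [real_inner_smul_left, real_inner_smul_right, hk]
      ring
    rw [← hn, ← hU]
    refine integral_congr_ae ?_
    filter_upwards [hae] with ω hω
    rw [hω]
  have hlaw : ∀ (ι : Type) [Fintype ι] (a : ι → Q) (c : ι → ℝ),
      P'.map (fun ω => ∑ i, c i * Z (a i) ω)
        = gaussianReal 0 (∑ i, ∑ j, c i * c j * K (a i) (a j)).toNNReal := by
    intro ι _ a c
    have hm : Measurable fun ω => ∑ i, c i * Z (a i) ω := by fun_prop
    have := Measure.isProbabilityMeasure_map (μ := P') hm.aemeasurable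
    -- Without the sign, `toNNReal` would change the variance. The form is recognised as a second
    -- moment, which also covers families `a` with repeated points.
    have hnn : 0 ≤ ∑ i, ∑ j, c i * c j * K (a i) (a j) := by
      have : ∫ ω, (∑ i, c i * Z (a i) ω) ^ 2 ∂P' = ∑ i, ∑ j, c i * c j * K (a i) (a j) := by
        have hint : ∀ i j, Integrable (fun ω => c i * c j * (Z (a i) ω * Z (a j) ω)) P' :=
          fun i j => ((hmem _).integrable_mul (hmem _)).const_mul _
        have e : ∀ ω, (∑ i, c i * Z (a i) ω) ^ 2
            = ∑ i, ∑ j, c i * c j * (Z (a i) ω * Z (a j) ω) := fun ω => by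
          rw [sq, Finset.sum_mul_sum]
          refine Finset.sum_congr rfl fun i _ => Finset.sum_congr rfl fun j _ => by ring
        simp only [e]
        rw [integral_finsetSum _ fun i _ => integrable_finsetSum _ fun j _ => hint i j]
        refine Finset.sum_congr rfl fun i _ => ?_
        rw [integral_finsetSum _ fun j _ => hint i j]
        refine Finset.sum_congr rfl fun j _ => ?_
        rw [integral_const_mul, hcov]
      rw [← this]
      exact integral_nonneg fun ω => sq_nonneg _
    refine Measure.ext_of_charFun (funext fun t => ?_)
    rw [charFun_gaussianReal, charFun_apply_real, integral_map hm.aemeasurable (by fun_prop)]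
    have := hchar ι a (fun i => t * c i)
    have e : ∀ ω, ((∑ i, t * c i * Z (a i) ω : ℝ) : ℂ) * Complex.I
        = (t : ℂ) * ((∑ i, c i * Z (a i) ω : ℝ) : ℂ) * Complex.I := fun ω => by
      rw [← Complex.ofReal_mul, Finset.mul_sum]
      simp only [mul_assoc]
    simp only [e] at this
    rw [this]
    congr 1
    have e2 : ∑ i, ∑ j, t * c i * (t * c j) * K (a i) (a j)
        = (∑ i, ∑ j, c i * c j * K (a i) (a j)) * t ^ 2 := by
      rw [Finset.sum_mul]
      refine Finset.sum_congr rfl fun i _ => ?_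
      rw [Finset.sum_mul]
      refine Finset.sum_congr rfl fun j _ => by ring
    rw [e2]
    have e3 : (((∑ i, ∑ j, c i * c j * K (a i) (a j)).toNNReal : ℝ) : ℂ)
        = ((∑ i, ∑ j, c i * c j * K (a i) (a j) : ℝ) : ℂ) := by
      rw [Real.coe_toNNReal _ hnn]
    push_cast at e3 ⊢
    rw [e3]
    ring
  have hgauss : IsGaussianProcess Z P' := by
    classical
    refine ⟨fun I => ⟨isGaussian_of_map_eq_gaussianReal fun L => ?_⟩⟩
    refine ⟨0, (∑ i : I, ∑ j : I, L (Pi.single i 1) * L (Pi.single j 1) * K i j).toNNReal, ?_⟩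
    have hr : Measurable fun ω => I.restrict (Z · ω) := measurable_pi_lambda _ fun i => hZm i
    have hL : Measurable L := L.continuous.measurable
    rw [Measure.map_map hL hr,
      ← hlaw I (fun i => i) (fun i => L (Pi.single i 1))]
    congr 1
    funext ω
    simp only [Function.comp_apply]
    have : I.restrict (Z · ω) = ∑ i : I, Z i ω • (Pi.single i 1 : I → ℝ) := by
      funext j
      simp [Finset.sum_apply, Pi.single_apply]
    rw [this, map_sum]
    refine Finset.sum_congr rfl fun i _ => ?_
    rw [map_smul, smul_eq_mul, mul_comm]
  refine ⟨Ω', inferInstance, P', inferInstance, Z, hZm, hgauss, fun a => ?_, hcov, hchar⟩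
  have := hlaw Unit (fun _ => a) (fun _ => 1)
  simp only [Finset.univ_unique, Finset.sum_const, Finset.card_singleton, one_smul, one_mul] at this
  have h1 := integral_map (μ := P') (φ := Z a) (f := id) (hZm a).aemeasurable (by fun_prop)
  simp only [id] at h1
  rw [← h1]
  have e : (fun ω => Z a ω) = Z a := rfl
  rw [← e, this]
  simp

/-! ### Moments of the compound Poisson distribution -/

lemma iidSum_succ_toMeasure (p : PMF ℤ) (k : ℕ) :
    (iidSum p (k + 1)).toMeasure
      = ((iidSum p k).toMeasure.prod p.toMeasure).map fun z => z.1 + z.2 := by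
  refine Measure.ext fun s hs => ?_
  rw [iidSum, PMF.toMeasure_bind_apply _ _ _ hs, Measure.map_apply (by fun_prop) hs,
    Measure.prod_apply ((by fun_prop : Measurable fun z : ℤ × ℤ => z.1 + z.2) hs), lintegral_countable']
  refine tsum_congr fun x => ?_
  rw [PMF.toMeasure_map_apply _ _ _ (by fun_prop) hs, mul_comm,
    PMF.toMeasure_apply_singleton _ _ (measurableSet_singleton x)]
  rfl

instance (p : PMF ℤ) (lam : ℝ≥0) : IsProbabilityMeasure (compoundPoisson p lam) := by
  unfold compoundPoisson
  exact isProbabilityMeasure_bind (measurable_of_countable _).aemeasurable (ae_of_all _ fun k => inferInstance)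

lemma compoundPoisson_zero (p : PMF ℤ) : compoundPoisson p 0 = Measure.dirac 0 := by
  refine Measure.ext fun s hs => ?_
  rw [compoundPoisson, Measure.bind_apply hs (measurable_of_countable _).aemeasurable, poissonMeasure,
    lintegral_sum_measure, tsum_eq_single 0]
  · simp [iidSum, PMF.toMeasure_pure]
  · intro k hk
    simp [hk]

/-- A complex exponent treats moment generating functions (`z` real) and characteristic functions
(`z` imaginary) at once. -/
lemma integral_exp_iidSum (p : PMF ℤ) {z : ℂ}
    (hz : Integrable (fun x : ℤ => Complex.exp (z * x)) p.toMeasure) (k : ℕ) :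
    Integrable (fun x : ℤ => Complex.exp (z * x)) (iidSum p k).toMeasure ∧
      ∫ x : ℤ, Complex.exp (z * x) ∂(iidSum p k).toMeasure
        = (∫ x : ℤ, Complex.exp (z * x) ∂p.toMeasure) ^ k := by
  induction k with
  | zero =>
    simp only [iidSum, PMF.toMeasure_pure, pow_zero, integral_dirac, Int.cast_zero, mul_zero,
      Complex.exp_zero, and_true]
    exact integrable_dirac (by simp)
  | succ k ih =>
    have e : ∀ y : ℤ × ℤ, Complex.exp (z * ((y.1 + y.2 : ℤ) : ℂ))
        = Complex.exp (z * y.1) * Complex.exp (z * y.2) := fun y => by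
      rw [← Complex.exp_add]
      push_cast
      ring_nf
    rw [iidSum_succ_toMeasure]
    constructor
    · rw [integrable_map_measure .of_discrete (by fun_prop), Function.comp_def]
      simp only [e]
      exact ih.1.mul_prod hz
    · rw [integral_map (by fun_prop) .of_discrete]
      simp only [e]
      rw [integral_prod_mul (fun x : ℤ => Complex.exp (z * x)) fun x : ℤ => Complex.exp (z * x),
        ih.2, pow_succ]

/-- Given `k` jumps the transform is `G ^ k`, and averaging over the Poisson weights sums an
exponential series. Integrability uses the same series for the real exponent `z.re`, since
`|exp(zx)| = exp(z.re x)`. -/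
lemma integral_exp_compoundPoisson (p : PMF ℤ) (lam : ℝ≥0) {z : ℂ}
    (hz : Integrable (fun x : ℤ => Complex.exp (z * x)) p.toMeasure) :
    Integrable (fun x : ℤ => Complex.exp (z * x)) (compoundPoisson p lam) ∧
      ∫ x : ℤ, Complex.exp (z * x) ∂(compoundPoisson p lam)
        = Complex.exp (lam * (∫ x : ℤ, Complex.exp (z * x) ∂p.toMeasure - 1)) := by
  let κ : Kernel ℕ ℤ := ⟨fun k => (iidSum p k).toMeasure, measurable_of_countable _⟩
  have hκ : compoundPoisson p lam = (κ ∘ₖ Kernel.const Unit (poissonMeasure lam)) () := by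
    rw [← Measure.comp_eq_comp_const_apply]
    rfl
  have hre : ∀ x : ℤ, ‖Complex.exp (z * x)‖ = Real.exp (z.re * x) := fun x => by
    rw [Complex.norm_exp]; simp
  have hre' : ∀ x : ℤ, Complex.exp ((z.re : ℂ) * x) = (Real.exp (z.re * x) : ℝ) := fun x => by
    push_cast; rfl
  have hr : Integrable (fun x : ℤ => Complex.exp ((z.re : ℂ) * x)) p.toMeasure := by
    simp only [hre']
    have := hz.norm
    simp only [hre] at this
    exact this.ofReal
  have hint : Integrable (fun x : ℤ => Complex.exp (z * x)) (compoundPoisson p lam) := by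
    rw [hκ, ProbabilityTheory.integrable_comp_iff .of_discrete]
    refine ⟨ae_of_all _ fun k => (integral_exp_iidSum p hz k).1, ?_⟩
    rw [Kernel.const_apply, integrable_poissonMeasure_iff]
    set R : ℝ := ∫ x : ℤ, Real.exp (z.re * x) ∂p.toMeasure
    have hk : ∀ k, ∫ x : ℤ, ‖Complex.exp (z * x)‖ ∂(κ k) = R ^ k := fun k => by
      have := (integral_exp_iidSum p hr k).2
      simp only [hre', integral_complex_ofReal] at this
      simp only [hre]
      exact_mod_cast this
    simp only [hk, norm_pow]
    have := ((NormedSpace.expSeries_div_summable (lam * ‖R‖ : ℝ))).mul_left (Real.exp (-lam))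
    refine this.congr fun k => ?_
    rw [mul_pow]
    ring
  refine ⟨hint, ?_⟩
  rw [hκ] at hint ⊢
  rw [Kernel.integral_comp hint, Kernel.const_apply]
  have hk : ∀ k, ∫ x : ℤ, Complex.exp (z * x) ∂(κ k)
      = (∫ x : ℤ, Complex.exp (z * x) ∂p.toMeasure) ^ k :=
    fun k => (integral_exp_iidSum p hz k).2
  simp only [hk]
  set G := ∫ x : ℤ, Complex.exp (z * x) ∂p.toMeasure
  rw [integral_poissonMeasure]
  have h1 := (NormedSpace.expSeries_div_hasSum_exp ((lam : ℂ) * G)).mul_left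
    (Complex.exp (-lam))
  rw [← Complex.exp_eq_exp_ℂ, ← Complex.exp_add] at h1
  rw [show (lam : ℂ) * (G - 1) = -(lam : ℂ) + lam * G by ring, ← h1.tsum_eq]
  refine tsum_congr fun k => ?_
  rw [Complex.real_smul]
  push_cast
  rw [mul_pow]
  ring

section

variable {p : PMF ℤ}

lemma HasExpMoments.exists_integrable (hp : HasExpMoments p) :
    ∃ δ : ℝ, 0 < δ ∧ ∀ θ : ℝ, |θ| ≤ δ → Integrable (fun x : ℤ => Real.exp (θ * x)) p.toMeasure := by
  obtain ⟨δ, hδ, h⟩ := hp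
  refine ⟨δ, hδ, fun θ hθ => ?_⟩
  have e : p.toMeasure = Measure.sum fun x : ℤ => p x • Measure.dirac x := by
    conv_lhs => rw [← Measure.sum_smul_dirac p.toMeasure]
    congr 1
    funext x
    rw [PMF.toMeasure_apply_singleton _ _ (measurableSet_singleton x)]
  rw [e, integrable_sum_dirac_iff (fun x => p.apply_ne_top x)]
  refine (h θ hθ).congr fun x => ?_
  rw [Real.norm_of_nonneg (Real.exp_pos _).le, mul_comm]

lemma HasExpMoments.mem_interior (hp : HasExpMoments p) :
    (0 : ℝ) ∈ interior (integrableExpSet (fun x : ℤ => (x : ℝ)) p.toMeasure) := by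
  obtain ⟨δ, hδ, h⟩ := hp.exists_integrable
  rw [mem_interior_iff_mem_nhds]
  filter_upwards [Metric.closedBall_mem_nhds (0 : ℝ) hδ] with θ hθ
  exact h θ (by simpa using hθ)

lemma HasExpMoments.drift_eq (hp : HasExpMoments p) :
    drift p = ∫ x : ℤ, (x : ℝ) ∂p.toMeasure := by
  rw [PMF.integral_eq_tsum]
  · simp [drift, mul_comm]
  · exact integrable_of_mem_interior_integrableExpSet hp.mem_interior

lemma HasExpMoments.integrable_abs_pow (hp : HasExpMoments p) (k : ℕ) :
    Integrable (fun x : ℤ => |(x : ℝ)| ^ k) p.toMeasure :=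
  integrable_pow_abs_of_mem_interior_integrableExpSet hp.mem_interior k

lemma HasExpMoments.kappa2_eq (hp : HasExpMoments p) :
    kappa2 p = ∫ x : ℤ, (x : ℝ) ^ 2 ∂p.toMeasure := by
  rw [PMF.integral_eq_tsum]
  · simp [kappa2, mul_comm]
  · simpa using hp.integrable_abs_pow 2

lemma kappa2_nonneg : 0 ≤ kappa2 p := tsum_nonneg fun x => by positivity

/-- Centered exponential moments of the compound Poisson distribution. -/
lemma HasExpMoments.exists_mgf_le (hp : HasExpMoments p) :
    ∃ δ K : ℝ, 0 < δ ∧ 0 ≤ K ∧ ∀ (lam : ℝ≥0) (θ : ℝ), |θ| ≤ δ →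
      Integrable (fun x : ℤ => Real.exp (θ * (x - lam * drift p))) (compoundPoisson p lam) ∧
      ∫ x : ℤ, Real.exp (θ * (x - lam * drift p)) ∂(compoundPoisson p lam)
        ≤ Real.exp (K * lam * θ ^ 2) := by
  obtain ⟨δ, hδ, h⟩ := hp.exists_integrable
  -- Halving `δ` leaves room for the factor `x²`. The value of this integral is the constant `K`,
  -- through `|exp y - 1 - y| ≤ y² exp |y|` with `y = θ x`.
  have hint2 : Integrable (fun x : ℤ => |(x : ℝ)| ^ 2 * Real.exp (δ / 2 * |(x : ℝ)|))
      p.toMeasure := by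
    have h1 := integrable_pow_abs_mul_exp_add_of_integrable_exp_mul (x := δ / 2) (v := 0) (t := δ)
      (X := fun x : ℤ => (x : ℝ)) (μ := p.toMeasure) (by simpa using h δ (abs_of_pos hδ).le)
      (by simpa using h (-δ) (by simp [abs_of_pos hδ])) (by positivity)
      (by rw [abs_of_pos hδ]; linarith) 2
    simpa using h1
  refine ⟨δ / 2, ∫ x : ℤ, |(x : ℝ)| ^ 2 * Real.exp (δ / 2 * |(x : ℝ)|) ∂p.toMeasure,
    by positivity, integral_nonneg fun x => by positivity, fun lam θ hθ => ?_⟩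
  have hθ' : Integrable (fun x : ℤ => Real.exp (θ * x)) p.toMeasure := h θ (by linarith)
  have hc : ∀ x : ℤ, Complex.exp ((θ : ℂ) * x) = (Real.exp (θ * x) : ℝ) := fun x => by
    push_cast; rfl
  have hz : Integrable (fun x : ℤ => Complex.exp ((θ : ℂ) * x)) p.toMeasure := by
    simp only [hc]; exact hθ'.ofReal
  obtain ⟨h1, h2⟩ := integral_exp_compoundPoisson p lam hz
  simp only [hc] at h1 h2
  have e : ∀ x : ℤ, Real.exp (θ * (x - lam * drift p))
      = Real.exp (-(θ * lam * drift p)) * Real.exp (θ * x) := fun x => by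
    rw [← Real.exp_add]; ring_nf
  simp only [e]
  have h1' : Integrable (fun x : ℤ => Real.exp (θ * x)) (compoundPoisson p lam) := by
    have := h1.re
    simpa only [RCLike.re_to_complex, Complex.ofReal_re] using this
  refine ⟨h1'.const_mul _, ?_⟩
  rw [integral_const_mul]
  simp only [integral_complex_ofReal] at h2
  have h3 : ∫ x : ℤ, Real.exp (θ * x) ∂(compoundPoisson p lam)
      = Real.exp (lam * (∫ x : ℤ, Real.exp (θ * x) ∂p.toMeasure - 1)) := by
    exact_mod_cast h2
  rw [h3, ← Real.exp_add, Real.exp_le_exp]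
  have hx : Integrable (fun x : ℤ => (x : ℝ)) p.toMeasure :=
    integrable_of_mem_interior_integrableExpSet hp.mem_interior
  have h4 : ∫ x : ℤ, Real.exp (θ * x) ∂p.toMeasure - 1 - θ * drift p
      ≤ (∫ x : ℤ, |(x : ℝ)| ^ 2 * Real.exp (δ / 2 * |(x : ℝ)|) ∂p.toMeasure) * θ ^ 2 := by
    have h5 : ∫ x : ℤ, Real.exp (θ * x) ∂p.toMeasure - 1 - θ * drift p
        = ∫ x : ℤ, (Real.exp (θ * x) - 1 - θ * x) ∂p.toMeasure := by
      have e1 : ∫ x : ℤ, (Real.exp (θ * x) - 1) ∂p.toMeasure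
          = ∫ x : ℤ, Real.exp (θ * x) ∂p.toMeasure - 1 := by
        rw [integral_sub hθ' (integrable_const _)]; simp
      have e0 : Integrable (fun x : ℤ => Real.exp (θ * x) - 1) p.toMeasure :=
        hθ'.sub (integrable_const _)
      rw [integral_sub e0 (hx.const_mul _), e1,
        integral_const_mul, hp.drift_eq]
    rw [h5, ← integral_mul_const]
    refine integral_mono ((hθ'.sub (integrable_const _)).sub (hx.const_mul _))
      (hint2.mul_const _) fun x => ?_
    have h6 := Complex.norm_exp_sub_sum_le_norm_mul_exp ((θ * x : ℝ) : ℂ) 2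
    have h7 : Complex.exp ((θ * x : ℝ) : ℂ) - ∑ m ∈ Finset.range 2, ((θ * x : ℝ) : ℂ) ^ m
        / (m.factorial : ℂ) = ((Real.exp (θ * x) - 1 - θ * x : ℝ) : ℂ) := by
      simp [Finset.sum_range_succ]
      ring
    rw [h7, Complex.norm_real, Complex.norm_real, Real.norm_eq_abs, Real.norm_eq_abs] at h6
    refine (le_abs_self _).trans (h6.trans ?_)
    rw [abs_mul, mul_pow, sq_abs θ]
    have : Real.exp (|θ| * |(x : ℝ)|) ≤ Real.exp (δ / 2 * |(x : ℝ)|) := by gcongr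
    nlinarith [mul_le_mul_of_nonneg_left this (by positivity : 0 ≤ θ ^ 2 * |(x : ℝ)| ^ 2)]
  have := mul_le_mul_of_nonneg_left h4 lam.coe_nonneg
  nlinarith

lemma HasExpMoments.mem_interior_compoundPoisson (hp : HasExpMoments p) (lam : ℝ≥0) :
    (0 : ℝ) ∈ interior
      (integrableExpSet (fun x : ℤ => (x : ℝ) - lam * drift p) (compoundPoisson p lam)) := by
  obtain ⟨δ, K, hδ, -, h⟩ := hp.exists_mgf_le
  rw [mem_interior_iff_mem_nhds]
  filter_upwards [Metric.closedBall_mem_nhds (0 : ℝ) hδ] with θ hθ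
  exact (h lam θ (by simpa using hθ)).1

lemma HasExpMoments.integrable_id_compoundPoisson (hp : HasExpMoments p) (lam : ℝ≥0) :
    Integrable (fun x : ℤ => (x : ℝ)) (compoundPoisson p lam) := by
  have := (integrable_of_mem_interior_integrableExpSet
    (hp.mem_interior_compoundPoisson lam)).add (integrable_const (lam * drift p))
  refine this.congr (ae_of_all _ fun x => ?_)
  simp

/-- The mean of the compound Poisson distribution. -/
lemma HasExpMoments.integral_compoundPoisson (hp : HasExpMoments p) (lam : ℝ≥0) :
    ∫ x : ℤ, (x : ℝ) ∂(compoundPoisson p lam) = lam * drift p := by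
  obtain ⟨δ, K, hδ, hK, h⟩ := hp.exists_mgf_le
  have hd := hasDerivAt_mgf (hp.mem_interior_compoundPoisson lam)
  have hd2 : HasDerivAt (fun θ : ℝ => Real.exp (K * lam * θ ^ 2)) 0 0 := by
    have := (((hasDerivAt_id (0 : ℝ)).pow 2).const_mul (K * lam)).exp
    simpa using this
  -- The generating function of the centered variable lies below `exp(K lam θ²)` near `0`, with
  -- equality at `0`. Hence the difference has a local maximum there, and its derivative, the mean
  -- of the centered variable, vanishes.
  have hmax : IsLocalMax (fun θ => mgf (fun x : ℤ => (x : ℝ) - lam * drift p)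
      (compoundPoisson p lam) θ - Real.exp (K * lam * θ ^ 2)) 0 := by
    filter_upwards [Metric.closedBall_mem_nhds (0 : ℝ) hδ] with θ hθ
    have := (h lam θ (by simpa using hθ)).2
    simp only [mgf] at *
    simpa using this
  have h0 := hmax.hasDerivAt_eq_zero (hd.sub hd2)
  simp only [zero_mul, Real.exp_zero, mul_one, sub_zero] at h0
  rw [integral_sub (hp.integrable_id_compoundPoisson lam) (integrable_const _)] at h0
  simp at h0
  linarith

/-- A bound for `|exp(ix) - (1 + ix - x²/2)|`. -/
lemma norm_exp_I_sub_taylor_le (x : ℝ) :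
    ‖Complex.exp (x * Complex.I) - (1 + x * Complex.I - x ^ 2 / 2)‖ ≤ 4 * |x| ^ 3 := by
  rcases le_or_gt |x| 1 with hx | hx
  · have h := Complex.norm_exp_sub_sum_le_norm_mul_exp (x * Complex.I) 3
    have e : ∑ m ∈ Finset.range 3, (x * Complex.I) ^ m / (m.factorial : ℂ)
        = 1 + x * Complex.I - x ^ 2 / 2 := by
      simp only [Finset.sum_range_succ, Finset.sum_range_zero, mul_pow, Complex.I_sq]
      simp
      ring
    rw [e] at h
    simp only [norm_mul, Complex.norm_I, mul_one, Complex.norm_real, Real.norm_eq_abs] at h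
    refine h.trans ?_
    have : Real.exp |x| ≤ 4 := (Real.exp_le_exp.2 hx).trans
      (by linarith [Real.exp_one_lt_d9])
    nlinarith [pow_nonneg (abs_nonneg x) 3]
  · have h1 : ‖(1 : ℂ) + x * Complex.I - x ^ 2 / 2‖ ≤ 1 + |x| + |x| ^ 2 / 2 := by
      refine (norm_sub_le _ _).trans ?_
      gcongr
      · refine (norm_add_le _ _).trans ?_
        simp
      · simp
    have h2 := norm_sub_le (Complex.exp (x * Complex.I)) (1 + x * Complex.I - x ^ 2 / 2)
    rw [Complex.norm_exp_ofReal_mul_I] at h2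
    have h3 : |x| ^ 2 ≤ |x| ^ 3 := pow_le_pow_right₀ hx.le (by norm_num)
    have h4 : |x| ≤ |x| ^ 3 := le_self_pow₀ hx.le (by norm_num)
    nlinarith

/-- Taylor expansion of the characteristic function of the jump distribution. -/
lemma HasExpMoments.exists_charFun_taylor (hp : HasExpMoments p) :
    ∃ C : ℝ, ∀ u : ℝ, ‖∫ x : ℤ, Complex.exp ((u * Complex.I) * x) ∂p.toMeasure
      - (1 + u * drift p * Complex.I - u ^ 2 * kappa2 p / 2)‖ ≤ C * |u| ^ 3 := by
  refine ⟨4 * ∫ x : ℤ, |(x : ℝ)| ^ 3 ∂p.toMeasure, fun u => ?_⟩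
  have hx : Integrable (fun x : ℤ => (x : ℝ)) p.toMeasure :=
    integrable_of_mem_interior_integrableExpSet hp.mem_interior
  have hx2 : Integrable (fun x : ℤ => (x : ℝ) ^ 2) p.toMeasure := by
    simpa using hp.integrable_abs_pow 2
  have e : ∀ x : ℤ, Complex.exp ((u * Complex.I) * x)
      = Complex.exp (((u * x : ℝ) : ℂ) * Complex.I) := fun x => by
    push_cast; ring_nf
  simp only [e]
  have h1 : ∫ x : ℤ, ((1 : ℂ) + ((u * x : ℝ) : ℂ) * Complex.I - ((u * x : ℝ) : ℂ) ^ 2 / 2)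
      ∂p.toMeasure = 1 + u * drift p * Complex.I - u ^ 2 * kappa2 p / 2 := by
    have i1 : Integrable (fun x : ℤ => ((u * x : ℝ) : ℂ) * Complex.I) p.toMeasure :=
      (hx.const_mul u).ofReal.mul_const _
    have i2 : Integrable (fun x : ℤ => ((u * x : ℝ) : ℂ) ^ 2 / 2) p.toMeasure := by
      have := ((hx2.const_mul (u ^ 2)).ofReal (𝕜 := ℂ)).div_const 2
      refine this.congr (ae_of_all _ fun x => ?_)
      simp only [Complex.coe_algebraMap]
      push_cast
      ring
    have i12 : Integrable (fun x : ℤ => (1 : ℂ) + ((u * x : ℝ) : ℂ) * Complex.I) p.toMeasure :=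
      (integrable_const _).add i1
    rw [integral_sub i12 i2, integral_add (integrable_const _) i1,
      integral_mul_const, integral_complex_ofReal, integral_const_mul, ← hp.drift_eq,
      integral_div]
    have : ∫ x : ℤ, ((u * x : ℝ) : ℂ) ^ 2 ∂p.toMeasure = u ^ 2 * kappa2 p := by
      rw [hp.kappa2_eq]
      simp only [← Complex.ofReal_pow, mul_pow]
      rw [integral_complex_ofReal, integral_const_mul]
      push_cast
      ring
    rw [this]
    simp
  have i0 : Integrable (fun x : ℤ => Complex.exp (((u * x : ℝ) : ℂ) * Complex.I)) p.toMeasure := by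
    refine Integrable.of_bound (C := 1) .of_discrete (ae_of_all _ fun x => ?_)
    rw [Complex.norm_exp_ofReal_mul_I]
  have i3 : Integrable (fun x : ℤ => (1 : ℂ) + ((u * x : ℝ) : ℂ) * Complex.I
      - ((u * x : ℝ) : ℂ) ^ 2 / 2) p.toMeasure := by
    refine ((integrable_const _).add ((hx.const_mul u).ofReal.mul_const _)).sub ?_
    have := ((hx2.const_mul (u ^ 2)).ofReal (𝕜 := ℂ)).div_const 2
    refine this.congr (ae_of_all _ fun x => ?_)
    simp only [Complex.coe_algebraMap]
    push_cast
    ring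
  rw [← h1, ← integral_sub i0 i3]
  have h3 := (hp.integrable_abs_pow 3).const_mul (4 * |u| ^ 3)
  refine (norm_integral_le_of_norm_le h3 (ae_of_all _ fun x => ?_)).trans_eq ?_
  · refine (norm_exp_I_sub_taylor_le _).trans_eq ?_
    rw [abs_mul]
    ring
  · rw [integral_const_mul]
    ring

end

/-! ### Absolute moments of Gaussian variables and of scaled walks -/

/-- Brings limits along `ℕ+` to sequences indexed by `ℕ`, the form in which Lévy's continuity
theorem is applied. -/
lemma tendsto_pnat_iff {α : Type*} {f : ℕ+ → α} {l : Filter α} :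
    Tendsto f atTop l ↔ Tendsto (fun n : ℕ => f n.succPNat) atTop l := by
  have h : map Nat.succPNat atTop = atTop := OrderIso.pnatIsoNat.symm.map_atTop
  rw [← h, tendsto_map'_iff]
  rfl

lemma tendsto_pnat_cast : Tendsto (fun n : ℕ+ => ((n : ℕ) : ℝ)) atTop atTop := by
  rw [tendsto_pnat_iff]
  exact tendsto_natCast_atTop_atTop.comp (tendsto_add_atTop_nat 1)

lemma tendsto_probabilityMeasure_of_charFun {E : Type*} [NormedAddCommGroup E]
    [InnerProductSpace ℝ E] [FiniteDimensional ℝ E] [MeasurableSpace E] [BorelSpace E]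
    {ν : ℕ+ → ProbabilityMeasure E} {ν₀ : ProbabilityMeasure E}
    (h : ∀ t, Tendsto (fun n => charFun (ν n) t) atTop (𝓝 (charFun (ν₀ : Measure E) t))) :
    Tendsto ν atTop (𝓝 ν₀) := by
  rw [tendsto_pnat_iff]
  exact ProbabilityMeasure.tendsto_of_tendsto_charFun fun t => tendsto_pnat_iff.1 (h t)

/-- Convergence of characteristic functions and bounded second moments imply convergence of
absolute first moments. -/
lemma tendsto_integral_abs_add {ν : ℕ+ → Measure ℝ} [∀ n, IsProbabilityMeasure (ν n)]
    {ν₀ : Measure ℝ} [IsProbabilityMeasure ν₀]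
    (h : ∀ t, Tendsto (fun n => charFun (ν n) t) atTop (𝓝 (charFun ν₀ t))) {C : ℝ}
    (hint : ∀ᶠ n in atTop, Integrable (fun y => y ^ 2) (ν n) ∧ ∫ y, y ^ 2 ∂(ν n) ≤ C)
    (hint₀ : Integrable (fun y => y ^ 2) ν₀) {x : ℕ+ → ℝ} {x₀ : ℝ}
    (hx : Tendsto x atTop (𝓝 x₀)) :
    Tendsto (fun n => ∫ y, |y + x n| ∂(ν n)) atTop (𝓝 (∫ y, |y + x₀| ∂ν₀)) := by
  have hw : Tendsto (β := ProbabilityMeasure ℝ) (fun n => ⟨ν n, inferInstance⟩) atTop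
      (𝓝 ⟨ν₀, inferInstance⟩) := tendsto_probabilityMeasure_of_charFun h
  replace hw := ProbabilityMeasure.tendsto_iff_forall_integral_tendsto.1 hw
  have habs : ∀ (μ : Measure ℝ) [IsProbabilityMeasure μ], Integrable (fun y => y ^ 2) μ →
      ∀ z : ℝ, Integrable (fun y => |y + z|) μ := fun μ _ hμ z => by
    have h1 : MemLp (fun y : ℝ => y) 2 μ :=
      (memLp_two_iff_integrable_sq (by fun_prop)).2 hμ
    exact ((h1.integrable (by norm_num)).add (integrable_const z)).abs
  -- Uniform integrability in quantitative form: where `|y + x₀|` exceeds `R` it is at most `(y +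
  -- x₀)² / R ≤ (2y² + 2x₀²) / R`. The truncated function is bounded and continuous, so weak
  -- convergence applies to it.
  have htrunc : ∀ (μ : Measure ℝ) [IsProbabilityMeasure μ], Integrable (fun y => y ^ 2) μ →
      ∀ C' : ℝ, ∫ y, y ^ 2 ∂μ ≤ C' → ∀ R : ℝ, 0 < R →
      |∫ y, |y + x₀| ∂μ - ∫ y, min |y + x₀| R ∂μ| ≤ (2 * C' + 2 * x₀ ^ 2) / R := by
    intro μ _ hμ C' hC' R hR
    have i1 := habs μ hμ x₀
    have i2 : Integrable (fun y => min |y + x₀| R) μ := i1.inf (integrable_const R)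
    have i3 : Integrable (fun y => (2 * y ^ 2 + 2 * x₀ ^ 2) / R) μ :=
      ((hμ.const_mul 2).add (integrable_const _)).div_const R
    rw [← integral_sub i1 i2, ← Real.norm_eq_abs]
    refine (norm_integral_le_of_norm_le i3 (ae_of_all _ fun y => ?_)).trans ?_
    · rw [Real.norm_eq_abs, le_div_iff₀ hR]
      rcases le_total |y + x₀| R with hle | hle
      · rw [min_eq_left hle]; simp; positivity
      · rw [min_eq_right hle, abs_of_nonneg (by linarith)]
        have := sq_abs (y + x₀)
        nlinarith [sq_nonneg (y - x₀), abs_nonneg (y + x₀), sq_nonneg (|y + x₀| - R)]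
    · rw [integral_div, integral_add (hμ.const_mul 2) (integrable_const _), integral_const_mul]
      simp only [integral_const, probReal_univ, smul_eq_mul, one_mul]
      gcongr
  rw [Metric.tendsto_atTop]
  intro ε hε
  set C₁ : ℝ := max C (∫ y, y ^ 2 ∂ν₀)
  obtain ⟨R, hR0, hR⟩ : ∃ R : ℝ, 0 < R ∧ (2 * C₁ + 2 * x₀ ^ 2) / R < ε / 4 := by
    have h1 : 0 ≤ C₁ := le_max_of_le_right (integral_nonneg fun y => sq_nonneg y)
    refine ⟨(2 * C₁ + 2 * x₀ ^ 2 + 1) / (ε / 4), by positivity, ?_⟩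
    rw [div_div_eq_mul_div, div_lt_iff₀ (by positivity)]
    nlinarith
  let f : BoundedContinuousFunction ℝ ℝ :=
    BoundedContinuousFunction.ofNormedAddCommGroup (fun y => min |y + x₀| R) (by fun_prop) R
      (fun y => by rw [Real.norm_eq_abs, abs_of_nonneg (by positivity)]; exact min_le_right _ _)
  have h1 := hw f
  rw [Metric.tendsto_atTop] at h1 hx
  obtain ⟨N1, hN1⟩ := h1 (ε / 4) (by positivity)
  obtain ⟨N2, hN2⟩ := hx (ε / 4) (by positivity)
  obtain ⟨N3, hN3⟩ := eventually_atTop.1 hint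
  refine ⟨max N1 (max N2 N3), fun n hn => ?_⟩
  have hn1 := hN1 n (le_trans (le_max_left _ _) hn)
  have hn2 := hN2 n (le_trans (le_trans (le_max_left _ _) (le_max_right _ _)) hn)
  have hn3 := hN3 n (le_trans (le_trans (le_max_right _ _) (le_max_right _ _)) hn)
  have e1 := htrunc (ν n) hn3.1 C₁ (hn3.2.trans (le_max_left _ _)) R hR0
  have e2 := htrunc ν₀ hint₀ C₁ (le_max_right _ _) R hR0
  have e3 : |∫ y, |y + x n| ∂(ν n) - ∫ y, |y + x₀| ∂(ν n)| ≤ |x n - x₀| := by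
    rw [← integral_sub (habs _ hn3.1 _) (habs _ hn3.1 _), ← Real.norm_eq_abs]
    refine (norm_integral_le_of_norm_le (integrable_const |x n - x₀|)
      (ae_of_all _ fun y => ?_)).trans_eq (by simp)
    rw [Real.norm_eq_abs]
    refine (abs_abs_sub_abs_le_abs_sub _ _).trans_eq ?_
    ring_nf
  rw [Real.dist_eq] at hn1 hn2 ⊢
  have e4 : |∫ y, min |y + x₀| R ∂(ν n) - ∫ y, min |y + x₀| R ∂ν₀| < ε / 4 := hn1
  replace e3 := e3.trans_lt hn2
  rw [abs_lt] at *
  rw [abs_le] at e1 e2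
  constructor <;> linarith

/-- The Gaussian density satisfies `φ' = -(y / v) φ`, so `-v φ` is a primitive of `y φ(y)` that
vanishes at infinity. -/
lemma integral_Ioi_gaussianReal {v : ℝ≥0} (hv : v ≠ 0) (x : ℝ) :
    ∫ y in Ioi x, y ∂(gaussianReal 0 v) = v * gaussianPDFReal 0 v x := by
  rw [gaussianReal_of_var_ne_zero _ hv,
    restrict_withDensity measurableSet_Ioi, integral_withDensity_eq_integral_toReal_smul
    (measurable_gaussianPDF 0 v) (ae_of_all _ fun y => gaussianPDF_lt_top)]
  simp only [toReal_gaussianPDF, smul_eq_mul]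
  have hd : ∀ y ∈ Ici x, HasDerivAt (fun y => -(v * gaussianPDFReal 0 v y))
      (gaussianPDFReal 0 v y * y) y := fun y _ => by
    simp only [gaussianPDFReal, sub_zero]
    have h1 : HasDerivAt (fun y : ℝ => -y ^ 2 / (2 * (v : ℝ))) (-y / v) y := by
      have := ((hasDerivAt_pow 2 y).neg.div_const (2 * (v : ℝ)))
      refine this.congr_deriv ?_
      have : (v : ℝ) ≠ 0 := by exact_mod_cast hv
      simp only [Nat.cast_ofNat, Nat.add_one_sub_one, pow_one]
      field_simp
    have h2 := ((h1.exp.const_mul (√(2 * Real.pi * v))⁻¹).const_mul (v : ℝ)).neg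
    refine h2.congr_deriv ?_
    have : (v : ℝ) ≠ 0 := by exact_mod_cast hv
    field_simp
  have hint : IntegrableOn (fun y => gaussianPDFReal 0 v y * y) (Ioi x) := by
    have h1 : Integrable (fun y : ℝ => y) (gaussianReal 0 v) :=
      (memLp_id_gaussianReal (μ := 0) (v := v) 1).integrable (by norm_num)
    rw [gaussianReal_of_var_ne_zero _ hv, integrable_withDensity_iff_integrable_smul'
      (measurable_gaussianPDF 0 v) (ae_of_all _ fun y => gaussianPDF_lt_top)] at h1
    simp only [toReal_gaussianPDF, smul_eq_mul] at h1
    exact h1.integrableOn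
  have ht : Tendsto (fun y => -(v * gaussianPDFReal 0 v y)) atTop (𝓝 0) := by
    have h1 : Tendsto (fun y : ℝ => Real.exp (-(y ^ 2 * (2 * (v : ℝ))⁻¹))) atTop (𝓝 0) := by
      refine Real.tendsto_exp_neg_atTop_nhds_zero.comp ?_
      refine Tendsto.atTop_mul_const (by positivity) (tendsto_pow_atTop two_ne_zero)
    have h2 := (((h1.const_mul (√(2 * Real.pi * v))⁻¹).const_mul (v : ℝ))).neg
    simp only [mul_zero, neg_zero] at h2
    refine h2.congr fun y => ?_
    simp only [gaussianPDFReal, sub_zero]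
    ring_nf
  rw [integral_Ioi_of_hasDerivAt_of_tendsto' hd hint ht]
  ring

/-- The absolute first moment of a shifted centered Gaussian variable. -/
lemma integral_abs_add_gaussianReal {σ2 : ℝ} (hσ : 0 ≤ σ2) (x : ℝ) :
    ∫ y, |y + x| ∂(gaussianReal 0 σ2.toNNReal) = 2 * Psi σ2 |x| + |x| := by
  have hid : ∀ v : ℝ≥0, Integrable (fun y : ℝ => y) (gaussianReal 0 v) := fun v =>
    (memLp_id_gaussianReal (μ := 0) (v := v) 1).integrable (by norm_num)
  have key : ∀ x : ℝ, 0 ≤ x →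
      ∫ y, |y - x| ∂(gaussianReal 0 σ2.toNNReal) = 2 * Psi σ2 x + x := by
    intro x hx
    rcases hσ.eq_or_lt with rfl | hpos
    · simp [Psi, gaussCDF, measureReal_def, hx, abs_of_nonneg hx]
    have hv : σ2.toNNReal ≠ 0 := by simpa using hpos
    set v := σ2.toNNReal
    -- Writing `|u| = 2u⁺ - u` produces `Ψ`, because `E(G - x)⁺ = σ² φ(x) - x (1 - Φ(x)) = Ψ(x)`.
    have e : ∀ y, |y - x| = 2 * (Ioi x).indicator (fun y => y - x) y - (y - x) := fun y => by
      by_cases hy : x < y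
      · rw [indicator_of_mem (by exact hy), abs_of_pos (by linarith)]; ring
      · rw [indicator_of_notMem (by simpa using hy), abs_of_nonpos (by linarith)]; ring
    simp only [e]
    have i1 : Integrable (fun y => y - x) (gaussianReal 0 v) :=
      (hid v).sub (integrable_const x)
    rw [integral_sub ((i1.indicator measurableSet_Ioi).const_mul 2) i1, integral_const_mul,
      integral_indicator measurableSet_Ioi, integral_sub (hid v) (integrable_const x),
      integral_sub (hid v).integrableOn (integrable_const x), integral_Ioi_gaussianReal hv]
    have h1 : (gaussianReal 0 v).real (Ioi x) = 1 - gaussCDF σ2 x := by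
      rw [gaussCDF, ← compl_Iic, probReal_compl_eq_one_sub measurableSet_Iic]
    have h2 : (v : ℝ) = σ2 := Real.coe_toNNReal _ hσ
    simp only [integral_const, measureReal_restrict_apply_univ, h1, smul_eq_mul, probReal_univ,
      integral_id_gaussianReal, h2, Psi]
    ring
  rcases le_total 0 x with hx | hx
  · rw [abs_of_nonneg hx, ← key x hx]
    have h1 := gaussianReal_map_neg (μ := 0) (v := σ2.toNNReal)
    rw [neg_zero] at h1
    conv_lhs => rw [← h1]
    rw [integral_map (by fun_prop) (by fun_prop)]
    congr 1
    funext y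
    rw [← abs_neg]
    ring_nf
  · rw [abs_of_nonpos hx, ← key (-x) (by linarith)]
    simp

section

/-- Second moments of the compound Poisson distribution. -/
lemma HasExpMoments.exists_sq_le (hp : HasExpMoments p) :
    ∃ δ K : ℝ, 0 < δ ∧ 0 ≤ K ∧ ∀ (lam : ℝ≥0) (θ : ℝ), 0 < θ → θ ≤ δ →
      Integrable (fun x : ℤ => ((x : ℝ) - lam * drift p) ^ 2) (compoundPoisson p lam) ∧
      ∫ x : ℤ, ((x : ℝ) - lam * drift p) ^ 2 ∂(compoundPoisson p lam)
        ≤ 4 / θ ^ 2 * Real.exp (K * lam * θ ^ 2) := by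
  obtain ⟨δ, K, hδ, hK, h⟩ := hp.exists_mgf_le
  refine ⟨δ, K, hδ, hK, fun lam θ hθ hθδ => ?_⟩
  obtain ⟨i1, b1⟩ := h lam θ (by rwa [abs_of_pos hθ])
  obtain ⟨i2, b2⟩ := h lam (-θ) (by rwa [abs_neg, abs_of_pos hθ])
  -- From `u² / 2 ≤ exp u` with `u = θ|y|`, and `exp(θ|y|) ≤ exp(θy) + exp(-θy)`.
  have hb : ∀ x : ℤ, ‖((x : ℝ) - lam * drift p) ^ 2‖ ≤ 2 / θ ^ 2 *
      (Real.exp (θ * (x - lam * drift p)) + Real.exp (-θ * (x - lam * drift p))) := fun x => by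
    set y := (x : ℝ) - lam * drift p
    rw [Real.norm_of_nonneg (sq_nonneg y), div_mul_eq_mul_div, le_div_iff₀ (by positivity)]
    have h1 := Real.quadratic_le_exp_of_nonneg (x := θ * |y|) (by positivity)
    have h2 : Real.exp (θ * |y|) ≤ Real.exp (θ * y) + Real.exp (-θ * y) := by
      rcases abs_cases y with ⟨hy, _⟩ | ⟨hy, _⟩ <;> rw [hy]
      · linarith [Real.exp_pos (-θ * y)]
      · rw [show θ * -y = -θ * y by ring]; linarith [Real.exp_pos (θ * y)]
    have h3 : (θ * |y|) ^ 2 = y ^ 2 * θ ^ 2 := by rw [mul_pow, sq_abs]; ring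
    have h4 : 0 ≤ θ * |y| := by positivity
    nlinarith
  have i3 := (i1.add i2).const_mul (2 / θ ^ 2)
  have i4 : Integrable (fun x : ℤ => ((x : ℝ) - lam * drift p) ^ 2) (compoundPoisson p lam) :=
    i3.mono' .of_discrete (ae_of_all _ hb)
  refine ⟨i4, (integral_mono i4 i3 fun x => (le_abs_self _).trans (hb x)).trans ?_⟩
  rw [integral_const_mul]
  simp only [Pi.add_apply]
  rw [integral_add i1 i2]
  rw [neg_sq] at b2
  calc _ ≤ 2 / θ ^ 2 * (Real.exp (K * lam * θ ^ 2) + Real.exp (K * lam * θ ^ 2)) := by gcongr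
    _ = _ := by ring

/-- Centering removes the first-order term from the exponent exactly, so only the second-order
Taylor term of the jump transform survives at scale `u / √n`. -/
lemma integral_exp_centered_compoundPoisson (lam : ℝ≥0) (u : ℝ) :
    ∫ x : ℤ, Complex.exp (((u * ((x : ℝ) - lam * drift p) : ℝ) : ℂ) * Complex.I)
        ∂(compoundPoisson p lam)
      = Complex.exp (lam * (∫ x : ℤ, Complex.exp ((u * Complex.I) * x) ∂p.toMeasure - 1
          - u * drift p * Complex.I)) := by
  have hz : Integrable (fun x : ℤ => Complex.exp ((u * Complex.I) * x)) p.toMeasure := by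
    refine Integrable.of_bound (C := 1) .of_discrete (ae_of_all _ fun x => ?_)
    rw [show (u * Complex.I) * (x : ℂ) = ((u * x : ℝ) : ℂ) * Complex.I by push_cast; ring,
      Complex.norm_exp_ofReal_mul_I]
  have e : ∀ x : ℤ, Complex.exp (((u * ((x : ℝ) - lam * drift p) : ℝ) : ℂ) * Complex.I)
      = Complex.exp (-(lam * (u * drift p * Complex.I))) * Complex.exp ((u * Complex.I) * x) :=
    fun x => by
      rw [← Complex.exp_add]
      push_cast
      ring_nf
  simp only [e]
  rw [integral_const_mul, (integral_exp_compoundPoisson p lam hz).2, ← Complex.exp_add]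
  ring_nf

/-- The central limit theorem for the walk, in terms of characteristic functions. -/
lemma HasExpMoments.tendsto_charFun (hp : HasExpMoments p) (α : ℝ≥0) (u : ℝ) :
    Tendsto (fun n : ℕ+ =>
      ∫ x : ℤ, Complex.exp (((u / √(n : ℝ) * ((x : ℝ) - ((n * α : ℝ≥0) : ℝ) * drift p) : ℝ) : ℂ)
        * Complex.I) ∂(compoundPoisson p (n * α))) atTop
      (𝓝 (Complex.exp (-(kappa2 p * α * u ^ 2 / 2 : ℝ)))) := by
  simp only [integral_exp_centered_compoundPoisson]
  refine (Complex.continuous_exp.tendsto _).comp ?_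
  obtain ⟨C, hC⟩ := hp.exists_charFun_taylor
  rw [tendsto_iff_norm_sub_tendsto_zero]
  have hlim : Tendsto (fun n : ℕ+ => α * C * |u| ^ 3 * (√(n : ℝ))⁻¹) atTop (𝓝 0) := by
    rw [← mul_zero (α * C * |u| ^ 3)]
    exact ((tendsto_inv_atTop_zero.comp Real.tendsto_sqrt_atTop).comp
      tendsto_pnat_cast).const_mul _
  refine squeeze_zero (fun n => norm_nonneg _) (fun n => ?_) hlim
  have hn : 0 < ((n : ℕ) : ℝ) := by exact_mod_cast n.pos
  have hs : 0 < √(n : ℝ) := Real.sqrt_pos.2 hn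
  have hss : √(n : ℝ) ^ 2 = n := Real.sq_sqrt hn.le
  have h1 := hC (u / √(n : ℝ))
  set G := ∫ x : ℤ, Complex.exp ((((u / √(n : ℝ) : ℝ) : ℂ) * Complex.I) * x) ∂p.toMeasure
  -- The exponent minus its limit is `nα` times the Taylor remainder of the jump transform at `u /
  -- √n`. That remainder is `O(n^{-3/2})`.
  have e : (((n * α : ℝ≥0) : ℝ) : ℂ) * (G - 1 - ((u / √(n : ℝ) : ℝ) : ℂ) * drift p * Complex.I)
      - ((-(kappa2 p * α * u ^ 2 / 2) : ℝ) : ℂ)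
      = (((n : ℝ) * α : ℝ) : ℂ) * (G - (1 + ((u / √(n : ℝ) : ℝ) : ℂ) * drift p * Complex.I
        - ((u / √(n : ℝ) : ℝ) : ℂ) ^ 2 * kappa2 p / 2)) := by
    have e2 : ((u / √(n : ℝ) : ℝ) : ℂ) ^ 2 = ((u ^ 2 / n : ℝ) : ℂ) := by
      rw [← Complex.ofReal_pow, div_pow, hss]
    rw [e2]
    have hn' : ((n : ℕ) : ℂ) ≠ 0 := by exact_mod_cast hn.ne'
    push_cast
    field_simp
    ring
  simp only [Complex.ofReal_neg] at e ⊢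
  rw [e, norm_mul, Complex.norm_real, Real.norm_of_nonneg (by positivity)]
  calc _ ≤ (n : ℝ) * α * (C * |u / √(n : ℝ)| ^ 3) := by gcongr
    _ = _ := by
      rw [abs_div, abs_of_pos hs, div_pow]
      have : √(n : ℝ) ^ 3 = n * √(n : ℝ) := by rw [pow_succ, hss]
      rw [this]
      field_simp

/-- Limit of the scaled absolute first moment of the difference of two independent walks. -/
lemma HasExpMoments.tendsto_integral_abs (hp : HasExpMoments p) (α β : ℝ≥0) {c : ℕ+ → ℤ} {x : ℝ}
    (hc : Tendsto (fun n : ℕ+ => ((c n : ℝ) + (n * α - n * β) * drift p) / √(n : ℝ)) atTop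
      (𝓝 x)) :
    Tendsto (fun n : ℕ+ => (∫ z : ℤ × ℤ, |(z.1 : ℝ) - z.2 + c n|
        ∂((compoundPoisson p (n * α)).prod (compoundPoisson p (n * β)))) / √(n : ℝ)) atTop
      (𝓝 (2 * Psi (kappa2 p * (α + β)) |x| + |x|)) := by
  have hk : 0 ≤ kappa2 p * (α + β) := mul_nonneg kappa2_nonneg (by positivity)
  let cd : ℕ+ → ℝ≥0 → ℤ → ℝ := fun n γ y => (y : ℝ) - ((n * γ : ℝ≥0) : ℝ) * drift p
  let W : ℕ+ → ℤ × ℤ → ℝ := fun n z => (cd n α z.1 - cd n β z.2) / √(n : ℝ)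
  let μ : ℕ+ → Measure (ℤ × ℤ) := fun n =>
    (compoundPoisson p (n * α)).prod (compoundPoisson p (n * β))
  have hm : ∀ n, Measurable (W n) := fun n => measurable_of_countable _
  have : ∀ n, IsProbabilityMeasure ((μ n).map (W n)) := fun n =>
    Measure.isProbabilityMeasure_map (hm n).aemeasurable
  have hcast : ∀ (n : ℕ+) (γ : ℝ≥0), ((n * γ : ℝ≥0) : ℝ) = n * γ := fun n γ => by
    push_cast; rfl
  have hpos : ∀ n : ℕ+, 0 < √((n : ℕ) : ℝ) := fun n =>
    Real.sqrt_pos.2 (by exact_mod_cast n.pos)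
  have main := tendsto_integral_abs_add (ν := fun n => (μ n).map (W n))
    (ν₀ := gaussianReal 0 (kappa2 p * (α + β)).toNNReal)
    -- Second moments are bounded with `θ = n^{-1/2}`, which gives `4n exp(Kα)` and `4n exp(Kβ)`.
    -- The inequality `(x - y)² ≤ 2x² + 2y²` and the division by `n` turn these into the factor `8`.
    (C := 8 * (Real.exp (hp.exists_sq_le.choose_spec.choose * α)
      + Real.exp (hp.exists_sq_le.choose_spec.choose * β))) ?_ ?_ ?_ hc
  · rw [integral_abs_add_gaussianReal hk] at main
    refine main.congr fun n => ?_
    rw [integral_map (hm n).aemeasurable (by fun_prop), ← integral_div]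
    congr 1
    funext z
    have hs := hpos n
    rw [← abs_of_pos hs, ← abs_div, abs_of_pos hs]
    simp only [W, cd, hcast]
    congr 1
    field_simp
    ring
  · intro u
    have h1 := (hp.tendsto_charFun α u).mul (hp.tendsto_charFun β (-u))
    rw [← Complex.exp_add] at h1
    have e : ((-(kappa2 p * α * u ^ 2 / 2) : ℝ) : ℂ) + ((-(kappa2 p * β * (-u) ^ 2 / 2) : ℝ) : ℂ)
        = u * (0 : ℝ) * Complex.I
          - (((kappa2 p * (α + β)).toNNReal : ℝ) : ℂ) * u ^ 2 / 2 := by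
      rw [Real.coe_toNNReal _ hk]
      push_cast
      ring
    simp only [Complex.ofReal_neg] at e h1
    rw [charFun_gaussianReal, ← e]
    refine h1.congr fun n => ?_
    rw [charFun_apply_real, integral_map (hm n).aemeasurable (by fun_prop)]
    rw [← integral_prod_mul]
    congr 1
    funext z
    rw [← Complex.exp_add]
    simp only [W, cd]
    push_cast
    ring_nf
  · obtain ⟨hδ, hK, h⟩ := hp.exists_sq_le.choose_spec.choose_spec
    set δ := hp.exists_sq_le.choose
    set K := hp.exists_sq_le.choose_spec.choose
    have hev : ∀ᶠ n : ℕ+ in atTop, (√(n : ℝ))⁻¹ < δ :=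
      (((tendsto_inv_atTop_zero.comp Real.tendsto_sqrt_atTop).comp
        tendsto_pnat_cast).eventually (gt_mem_nhds hδ))
    filter_upwards [hev] with n hn
    have hs := hpos n
    have hn0 : (0 : ℝ) < n := by exact_mod_cast n.pos
    have hss : √(n : ℝ) ^ 2 = n := Real.sq_sqrt hn0.le
    have hb : ∀ γ : ℝ≥0, Integrable (fun y => cd n γ y ^ 2) (compoundPoisson p (n * γ)) ∧
        ∫ y, cd n γ y ^ 2 ∂(compoundPoisson p (n * γ)) ≤ 4 * n * Real.exp (K * γ) := fun γ => by
      obtain ⟨h1, h2⟩ := h (n * γ) (√(n : ℝ))⁻¹ (by positivity) hn.le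
      refine ⟨h1, h2.trans_eq ?_⟩
      rw [inv_pow, hss, hcast]
      field_simp
    have i1 : Integrable (fun z : ℤ × ℤ => cd n α z.1 ^ 2) (μ n) := (hb α).1.comp_fst _
    have i2 : Integrable (fun z : ℤ × ℤ => cd n β z.2 ^ 2) (μ n) := (hb β).1.comp_snd _
    have i3 : Integrable (fun z => 2 / n * (cd n α z.1 ^ 2 + cd n β z.2 ^ 2)) (μ n) :=
      (i1.add i2).const_mul _
    have hle : ∀ z, W n z ^ 2 ≤ 2 / n * (cd n α z.1 ^ 2 + cd n β z.2 ^ 2) := fun z => by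
      simp only [W, div_pow, hss]
      rw [div_le_iff₀ hn0, mul_right_comm, div_mul_cancel₀ _ hn0.ne']
      nlinarith [sq_nonneg (cd n α z.1 + cd n β z.2)]
    have i4 : Integrable (fun z => W n z ^ 2) (μ n) :=
      i3.mono' (by fun_prop) (ae_of_all _ fun z => by
        rw [Real.norm_of_nonneg (sq_nonneg _)]; exact hle z)
    constructor
    · rw [integrable_map_measure (by fun_prop) (hm n).aemeasurable]
      exact i4
    · rw [integral_map (hm n).aemeasurable (by fun_prop)]
      refine (integral_mono i4 i3 hle).trans ?_
      rw [integral_const_mul, integral_add i1 i2]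
      have j1 : ∫ z : ℤ × ℤ, cd n α z.1 ^ 2 ∂(μ n)
          = ∫ y, cd n α y ^ 2 ∂(compoundPoisson p (n * α)) := by
        simp only [μ]
        rw [integral_fun_fst (fun y => cd n α y ^ 2)]
        simp
      have j2 : ∫ z : ℤ × ℤ, cd n β z.2 ^ 2 ∂(μ n)
          = ∫ y, cd n β y ^ 2 ∂(compoundPoisson p (n * β)) := by
        simp only [μ]
        rw [integral_fun_snd (fun y => cd n β y ^ 2)]
        simp
      rw [j1, j2]
      calc _ ≤ 2 / n * (4 * n * Real.exp (K * α) + 4 * n * Real.exp (K * β)) := by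
            have := (hb α).2
            have := (hb β).2
            gcongr
        _ = _ := by field_simp; ring
  · have := (memLp_id_gaussianReal (μ := 0) (v := (kappa2 p * (α + β)).toNNReal) 2)
    simpa using this.integrable_sq

end

/-! ### Sums of a random number of random variables -/

section RandomSum

variable {Ω : Type*} [MeasurableSpace Ω] {P : Measure Ω} [IsProbabilityMeasure P]

/-- Fubini for the joint law, which is a product by independence. It serves to freeze the numbers of
particles while integrating over the walks. -/
lemma integral_comp_prod_of_indepFun {α β E : Type*} [MeasurableSpace α] [MeasurableSpace β]
    [NormedAddCommGroup E] [NormedSpace ℝ E] {A : Ω → α} {B : Ω → β}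
    (hA : Measurable A) (hB : Measurable B) (h : IndepFun A B P) {F : α × β → E}
    (hF : StronglyMeasurable F) (hint : Integrable (fun ω => F (A ω, B ω)) P) :
    ∫ ω, F (A ω, B ω) ∂P = ∫ ω, ∫ ω', F (A ω, B ω') ∂P ∂P := by
  have hm := (indepFun_iff_map_prod_eq_prod_map_map hA.aemeasurable hB.aemeasurable).1 h
  have : IsProbabilityMeasure (P.map A) := Measure.isProbabilityMeasure_map hA.aemeasurable
  have : IsProbabilityMeasure (P.map B) := Measure.isProbabilityMeasure_map hB.aemeasurable
  have hint' : Integrable F ((P.map A).prod (P.map B)) := by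
    rw [← hm, integrable_map_measure hF.aestronglyMeasurable (hA.prodMk hB).aemeasurable]
    exact hint
  have h1 := integral_map (μ := P) (hA.prodMk hB).aemeasurable
    (f := F) hF.aestronglyMeasurable
  rw [← h1, hm, integral_prod _ hint', integral_map hA.aemeasurable]
  · refine integral_congr_ae (ae_of_all _ fun ω => ?_)
    exact integral_map hB.aemeasurable (hF.comp_measurable measurable_prodMk_left).aestronglyMeasurable
  · exact hF.integral_prod_right'.aestronglyMeasurable

/-- The sum of the first `N` terms of a sequence. -/
def randomSum (N : Ω → ℕ) (G : ℕ → Ω → ℝ) (ω : Ω) : ℝ := ∑ j ∈ Finset.range (N ω), G j ω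

lemma measurable_sum_range : Measurable fun x : ℕ × (ℕ → ℝ) => ∑ j ∈ Finset.range x.1, x.2 j :=
  measurable_from_prod_countable_right fun k => by
    simp only
    fun_prop

lemma measurable_randomSum {N : Ω → ℕ} {G : ℕ → Ω → ℝ} (hN : Measurable N)
    (hG : ∀ j, Measurable (G j)) : Measurable (randomSum N G) :=
  measurable_sum_range.comp (hN.prodMk (measurable_pi_lambda _ hG))

lemma abs_randomSum_le {N : Ω → ℕ} {G : ℕ → Ω → ℝ} {C : ℝ} (hC : ∀ j ω, |G j ω| ≤ C) (ω : Ω) :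
    |randomSum N G ω| ≤ C * N ω := by
  refine (Finset.abs_sum_le_sum_abs _ _).trans ((Finset.sum_le_sum fun j _ => hC j ω).trans_eq ?_)
  simp [mul_comm]

lemma integrable_pow_of_moment {N : Ω → ℕ} (hN : Measurable N) {B : ℝ≥0}
    (hB : ∫⁻ ω, (N ω : ℝ≥0∞) ^ 12 ∂P ≤ B) {k : ℕ} (hk : k ≠ 0) (hk' : k ≤ 12) :
    Integrable (fun ω => (N ω : ℝ) ^ k) P ∧ ∫ ω, (N ω : ℝ) ^ k ∂P ≤ B := by
  have h1 : ∫⁻ ω, ENNReal.ofReal ((N ω : ℝ) ^ k) ∂P ≤ B := by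
    refine (lintegral_mono fun ω => ?_).trans hB
    rw [ENNReal.ofReal_pow (by positivity), ENNReal.ofReal_natCast]
    -- `N` takes values in the natural numbers, so larger positive powers dominate smaller ones and
    -- one constant bounds all the moments that occur.
    have : N ω ^ k ≤ N ω ^ 12 := by
      rcases Nat.eq_zero_or_pos (N ω) with h | h
      · simp [h, hk]
      · exact Nat.pow_le_pow_right h hk'
    rw [← Nat.cast_pow, ← Nat.cast_pow]
    exact Nat.cast_le.2 this
  have hm : AEStronglyMeasurable (fun ω => (N ω : ℝ) ^ k) P := by
    have : Measurable fun ω => (N ω : ℝ) := (measurable_of_countable _).comp hN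
    fun_prop
  refine ⟨(lintegral_ofReal_ne_top_iff_integrable hm (ae_of_all _ fun ω => by positivity)).1
    (h1.trans_lt ENNReal.coe_lt_top).ne, ?_⟩
  rw [integral_eq_lintegral_of_nonneg_ae (ae_of_all _ fun ω => by positivity) hm]
  exact ENNReal.toReal_le_coe_of_le_coe h1

/-- Data of a random sum: the number of terms is independent of the terms, which are bounded,
pairwise independent and have the same first two moments. -/
structure RandomSumData (P : Measure Ω) (N : Ω → ℕ) (G : ℕ → Ω → ℝ) (B : ℝ≥0) (C μ q e : ℝ) :
    Prop where
  meas_num : Measurable N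
  meas_term : ∀ j, Measurable (G j)
  indep : IndepFun N (fun ω j => G j ω) P
  pairwise : ∀ i j, i ≠ j → IndepFun (G i) (G j) P
  bound : ∀ j ω, |G j ω| ≤ C
  moment : ∫⁻ ω, (N ω : ℝ≥0∞) ^ 12 ∂P ≤ B
  mean : ∀ j, ∫ ω, G j ω ∂P = μ
  sq : ∀ j, ∫ ω, G j ω ^ 2 ∂P = q
  abs : ∀ j, ∫ ω, |G j ω| ∂P ≤ e

namespace RandomSumData

variable {N : Ω → ℕ} {G : ℕ → Ω → ℝ} {B : ℝ≥0} {C μ q e : ℝ}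

lemma nonneg_bound (h : RandomSumData P N G B C μ q e) : 0 ≤ C := by
  obtain ⟨ω⟩ : Nonempty Ω := nonempty_of_isProbabilityMeasure P
  exact (abs_nonneg _).trans (h.bound 0 ω)

lemma nonneg_abs (h : RandomSumData P N G B C μ q e) : 0 ≤ e :=
  (integral_nonneg fun _ => abs_nonneg _).trans (h.abs 0)

lemma measurable (h : RandomSumData P N G B C μ q e) : Measurable (randomSum N G) :=
  measurable_randomSum h.meas_num h.meas_term

lemma integrable_term (h : RandomSumData P N G B C μ q e) (j : ℕ) : Integrable (G j) P :=
  Integrable.of_bound (h.meas_term j).aestronglyMeasurable C (ae_of_all _ fun ω => h.bound j ω)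

lemma integrable_term_mul (h : RandomSumData P N G B C μ q e) (i j : ℕ) :
    Integrable (fun ω => G i ω * G j ω) P :=
  (h.integrable_term j).bdd_mul (h.meas_term i).aestronglyMeasurable
    (ae_of_all _ fun ω => h.bound i ω)

lemma integrable_num (h : RandomSumData P N G B C μ q e) : Integrable (fun ω => (N ω : ℝ)) P := by
  simpa using (integrable_pow_of_moment h.meas_num h.moment one_ne_zero (by norm_num)).1

lemma integrable_num_sq (h : RandomSumData P N G B C μ q e) :
    Integrable (fun ω => (N ω : ℝ) ^ 2) P :=
  (integrable_pow_of_moment h.meas_num h.moment two_ne_zero (by norm_num)).1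

lemma integrable_pow (h : RandomSumData P N G B C μ q e) {k : ℕ} (hk : k ≠ 0) (hk' : k ≤ 12) :
    Integrable (fun ω => |randomSum N G ω| ^ k) P := by
  have h1 := (integrable_pow_of_moment h.meas_num h.moment hk hk').1.const_mul (C ^ k)
  refine h1.mono' (by have := h.measurable; fun_prop) (ae_of_all _ fun ω => ?_)
  rw [norm_pow, Real.norm_eq_abs, abs_abs, ← mul_pow]
  exact pow_le_pow_left₀ (abs_nonneg _) (abs_randomSum_le h.bound ω) k

lemma integrable (h : RandomSumData P N G B C μ q e) : Integrable (randomSum N G) P := by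
  have := h.integrable_pow one_ne_zero (by norm_num)
  simp only [pow_one] at this
  exact (integrable_norm_iff h.measurable.aestronglyMeasurable).1 this

lemma fubini (h : RandomSumData P N G B C μ q e) {F : ℕ × (ℕ → ℝ) → ℝ} (hF : Measurable F)
    (hint : Integrable (fun ω => F (N ω, fun j => G j ω)) P) :
    ∫ ω, F (N ω, fun j => G j ω) ∂P = ∫ ω, ∫ ω', F (N ω, fun j => G j ω') ∂P ∂P :=
  integral_comp_prod_of_indepFun h.meas_num (measurable_pi_lambda _ h.meas_term) h.indep
    hF.stronglyMeasurable hint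

lemma integral_eq (h : RandomSumData P N G B C μ q e) :
    ∫ ω, randomSum N G ω ∂P = (∫ ω, (N ω : ℝ) ∂P) * μ := by
  have := h.fubini measurable_sum_range h.integrable
  simp only at this
  unfold randomSum
  rw [this, ← integral_mul_const]
  refine integral_congr_ae (ae_of_all _ fun ω => ?_)
  simp only
  rw [integral_finsetSum _ fun j _ => h.integrable_term j]
  simp [h.mean]

/-- With `N` frozen, the `N` diagonal terms each give `q` and the off-diagonal ones give `μ²` by
pairwise independence. -/
lemma integral_sq (h : RandomSumData P N G B C μ q e) :
    ∫ ω, randomSum N G ω ^ 2 ∂P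
      = (∫ ω, (N ω : ℝ) ∂P) * (q - μ ^ 2) + (∫ ω, (N ω : ℝ) ^ 2 ∂P) * μ ^ 2 := by
  have hi := h.integrable_pow two_ne_zero (by norm_num)
  simp only [sq_abs] at hi
  have := h.fubini (F := fun x => (∑ j ∈ Finset.range x.1, x.2 j) ^ 2)
    (measurable_sum_range.pow_const 2) hi
  simp only at this
  unfold randomSum
  rw [this, ← integral_mul_const, ← integral_mul_const,
    ← integral_add (h.integrable_num.mul_const _) (h.integrable_num_sq.mul_const _)]
  refine integral_congr_ae (ae_of_all _ fun ω => ?_)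
  simp only
  have e1 : ∀ ω', (∑ j ∈ Finset.range (N ω), G j ω') ^ 2
      = ∑ i ∈ Finset.range (N ω), ∑ j ∈ Finset.range (N ω), G i ω' * G j ω' := fun ω' => by
    rw [pow_two, Finset.sum_mul_sum]
  have e2 : ∀ i j, ∫ ω', G i ω' * G j ω' ∂P = μ ^ 2 + if i = j then q - μ ^ 2 else 0 := by
    intro i j
    split_ifs with hij
    · subst hij
      simp only [← pow_two, h.sq]
      ring
    · rw [(h.pairwise i j hij).integral_fun_mul_eq_mul_integral
        (h.meas_term i).aestronglyMeasurable (h.meas_term j).aestronglyMeasurable, h.mean, h.mean]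
      ring
  simp only [e1]
  rw [integral_finsetSum _ fun i _ => integrable_finsetSum _ fun j _ => h.integrable_term_mul i j]
  simp only [integral_finsetSum _ fun j _ => h.integrable_term_mul _ j, e2, Finset.sum_add_distrib,
    Finset.sum_const, Finset.card_range, nsmul_eq_mul, Finset.sum_ite_eq, Finset.mem_range]
  rw [Finset.sum_ite_of_true (by simp)]
  simp
  ring

lemma memLp_two (h : RandomSumData P N G B C μ q e) : MemLp (randomSum N G) 2 P := by
  rw [memLp_two_iff_integrable_sq h.measurable.aestronglyMeasurable]
  have := h.integrable_pow two_ne_zero (by norm_num)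
  simpa only [sq_abs] using this

/-- The law of total variance. Randomness of the walks enters with weight `E[N]`, and randomness of
the initial configuration with weight `Var[N]`. -/
lemma variance_eq (h : RandomSumData P N G B C μ q e) :
    variance (randomSum N G) P
      = (∫ ω, (N ω : ℝ) ∂P) * (q - μ ^ 2) + variance (fun ω => (N ω : ℝ)) P * μ ^ 2 := by
  have hN : MemLp (fun ω => (N ω : ℝ)) 2 P := by
    rw [memLp_two_iff_integrable_sq h.integrable_num.aestronglyMeasurable]
    exact h.integrable_num_sq
  rw [variance_eq_sub h.memLp_two, variance_eq_sub hN]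
  simp only [Pi.pow_apply]
  rw [h.integral_sq, h.integral_eq]
  ring

/-- Moments of a random sum are bounded by the first absolute moment of a single term. -/
lemma integral_abs_pow_succ_le (h : RandomSumData P N G B C μ q e) {k : ℕ} (hk : k + 1 ≤ 12) :
    ∫ ω, |randomSum N G ω| ^ (k + 1) ∂P ≤ C ^ k * B * e := by
  have hC := h.nonneg_bound
  have habs : Measurable fun x : ℕ × (ℕ → ℝ) => ∑ j ∈ Finset.range x.1, |x.2 j| :=
    measurable_from_prod_countable_right fun k => by simp only; fun_prop
  -- Only one of the `k + 1` factors is estimated by `∑ |G j|`; the others use the uniform bound `C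
  -- N`. Hence the estimate is linear in `e`, which is what can be summed over the sites.
  let F : ℕ × (ℕ → ℝ) → ℝ := fun x => (C * x.1) ^ k * ∑ j ∈ Finset.range x.1, |x.2 j|
  have hF : Measurable F := by
    have : Measurable fun x : ℕ × (ℕ → ℝ) => (x.1 : ℝ) :=
      (measurable_of_countable _).comp measurable_fst
    fun_prop
  have hle : ∀ ω, |randomSum N G ω| ^ (k + 1) ≤ F (N ω, fun j => G j ω) := fun ω => by
    rw [pow_succ]
    exact mul_le_mul (pow_le_pow_left₀ (abs_nonneg _) (abs_randomSum_le h.bound ω) k)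
      (Finset.abs_sum_le_sum_abs _ _) (abs_nonneg _) (by positivity)
  obtain ⟨hm1, hm2⟩ := integrable_pow_of_moment h.meas_num h.moment (Nat.succ_ne_zero k) hk
  have hFint : Integrable (fun ω => F (N ω, fun j => G j ω)) P := by
    refine (hm1.const_mul (C ^ k * C)).mono' (hF.comp (h.meas_num.prodMk
      (measurable_pi_lambda _ h.meas_term))).aestronglyMeasurable (ae_of_all _ fun ω => ?_)
    have h1 : ∑ j ∈ Finset.range (N ω), |G j ω| ≤ C * N ω :=
      (Finset.sum_le_sum fun j _ => h.bound j ω).trans_eq (by simp [mul_comm])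
    rw [Real.norm_of_nonneg (by positivity)]
    calc (C * N ω) ^ k * ∑ j ∈ Finset.range (N ω), |G j ω| ≤ (C * N ω) ^ k * (C * N ω) := by gcongr
      _ = _ := by rw [mul_pow, Nat.succ_eq_add_one, pow_succ]; ring
  refine (integral_mono (h.integrable_pow (Nat.succ_ne_zero k) hk) hFint hle).trans ?_
  rw [h.fubini hF hFint]
  have hin : ∀ ω, ∫ ω', F (N ω, fun j => G j ω') ∂P ≤ C ^ k * e * (N ω : ℝ) ^ (k + 1) := by
    intro ω
    simp only [F]
    rw [integral_const_mul, integral_finsetSum _ fun j _ => (h.integrable_term j).abs]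
    calc _ ≤ (C * N ω) ^ k * ∑ j ∈ Finset.range (N ω), e := by
          gcongr with j; exact h.abs j
      _ = _ := by simp [mul_pow, pow_succ]; ring
  calc _ ≤ ∫ ω, C ^ k * e * (N ω : ℝ) ^ (k + 1) ∂P := by
        refine integral_mono_of_nonneg (ae_of_all _ fun ω => ?_) (hm1.const_mul _)
          (ae_of_all _ hin)
        exact integral_nonneg fun ω' => by positivity
    _ = C ^ k * e * ∫ ω, (N ω : ℝ) ^ (k + 1) ∂P := integral_const_mul _ _
    _ ≤ C ^ k * e * B := by
        have := h.nonneg_abs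
        gcongr
    _ = _ := by ring

lemma variance_le (h : RandomSumData P N G B C μ q e) :
    variance (randomSum N G) P ≤ C * B * e := by
  have h1 := h.integral_abs_pow_succ_le (k := 1) (by norm_num)
  simp only [Nat.reduceAdd, sq_abs, pow_one] at h1
  refine le_trans ?_ h1
  exact variance_le_expectation_sq h.measurable.aestronglyMeasurable

end RandomSumData

end RandomSum

/-! ### A quantitative central limit theorem -/

section CLT

variable {Ω : Type*} [MeasurableSpace Ω] {P : Measure Ω} [IsProbabilityMeasure P]

/-- Replacing the factors one at a time, as in Lindeberg's argument, costs one difference per factor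
because all the others have norm at most one. -/
lemma norm_prod_sub_prod_le_sum {ι : Type*} (s : Finset ι) (f g : ι → ℂ)
    (hf : ∀ i ∈ s, ‖f i‖ ≤ 1) (hg : ∀ i ∈ s, ‖g i‖ ≤ 1) :
    ‖∏ i ∈ s, f i - ∏ i ∈ s, g i‖ ≤ ∑ i ∈ s, ‖f i - g i‖ := by
  classical
  induction s using Finset.induction_on with
  | empty => simp
  | insert i s hi ih =>
    rw [Finset.prod_insert hi, Finset.prod_insert hi, Finset.sum_insert hi]
    have e : f i * ∏ i ∈ s, f i - g i * ∏ i ∈ s, g i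
        = (f i - g i) * ∏ i ∈ s, f i + g i * (∏ i ∈ s, f i - ∏ i ∈ s, g i) := by ring
    rw [e]
    refine (norm_add_le _ _).trans ?_
    rw [norm_mul, norm_mul]
    have h1 : ‖∏ i ∈ s, f i‖ ≤ 1 := by
      rw [norm_prod]
      exact Finset.prod_le_one (fun _ _ => norm_nonneg _)
        fun j hj => hf j (Finset.mem_insert_of_mem hj)
    have h2 := ih (fun j hj => hf j (Finset.mem_insert_of_mem hj))
      fun j hj => hg j (Finset.mem_insert_of_mem hj)
    have h3 := hg i (Finset.mem_insert_self i s)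
    gcongr
    · exact mul_le_of_le_one_right (norm_nonneg _) h1
    · exact (mul_le_of_le_one_left (norm_nonneg _) h3).trans h2

/-- Comparison of the characteristic function of a variable with that of a Gaussian variable with
the same mean and variance. -/
lemma norm_integral_exp_sub_gaussian_le {S : Ω → ℝ} (hS : Measurable S) (h2 : MemLp S 2 P)
    (h3 : Integrable (fun ω => |S ω| ^ 3) P) :
    ‖∫ ω, Complex.exp ((S ω : ℂ) * Complex.I) ∂P
      - Complex.exp (((∫ ω, S ω ∂P : ℝ) : ℂ) * Complex.I - ((variance S P / 2 : ℝ) : ℂ))‖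
      ≤ 32 * ∫ ω, |S ω| ^ 3 ∂P + variance S P ^ 2 := by
  set m := ∫ ω, S ω ∂P
  set V := variance S P
  have hV : 0 ≤ V := variance_nonneg _ _
  have h1 : Integrable S P := h2.integrable (by norm_num)
  have hc : MemLp (fun ω => S ω - m) 2 P := h2.sub (memLp_const m)
  have hc1 : Integrable (fun ω => S ω - m) P := hc.integrable (by norm_num)
  have hc2 : Integrable (fun ω => (S ω - m) ^ 2) P := hc.integrable_sq
  have hle : ∀ ω, |S ω - m| ^ 3 ≤ 4 * |S ω| ^ 3 + 4 * |m| ^ 3 := fun ω => by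
    have a := abs_nonneg (S ω)
    have b := abs_nonneg m
    calc |S ω - m| ^ 3 ≤ (|S ω| + |m|) ^ 3 := by gcongr; exact abs_sub _ _
      _ ≤ _ := by nlinarith [mul_nonneg (add_nonneg a b) (sq_nonneg (|S ω| - |m|))]
  have hc3 : Integrable (fun ω => |S ω - m| ^ 3) P := by
    refine ((h3.const_mul 4).add (integrable_const (4 * |m| ^ 3))).mono'
      (by fun_prop) (ae_of_all _ fun ω => ?_)
    rw [Real.norm_of_nonneg (by positivity)]
    exact hle ω
  -- Jensen's inequality for the cube. With `(a + b)³ ≤ 4a³ + 4b³` it bounds the centered third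
  -- moment by `8 E|S|³`, and the Taylor constant `4` then gives `32`.
  have hm3 : |m| ^ 3 ≤ ∫ ω, |S ω| ^ 3 ∂P := by
    have hj : (∫ ω, |S ω| ∂P) ^ 3 ≤ ∫ ω, |S ω| ^ 3 ∂P :=
      (convexOn_pow 3).map_integral_le (by fun_prop) isClosed_Ici
        (ae_of_all _ fun ω => abs_nonneg (S ω)) h1.abs h3
    have : |m| ≤ ∫ ω, |S ω| ∂P := abs_integral_le_integral_abs
    exact (pow_le_pow_left₀ (abs_nonneg _) this 3).trans hj
  have h3' : ∫ ω, |S ω - m| ^ 3 ∂P ≤ 8 * ∫ ω, |S ω| ^ 3 ∂P := by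
    refine (integral_mono hc3 ((h3.const_mul 4).add (integrable_const _)) hle).trans ?_
    simp only [Pi.add_apply]
    rw [integral_add (h3.const_mul 4) (integrable_const _), integral_const_mul]
    simp only [integral_const, probReal_univ, smul_eq_mul, one_mul]
    linarith
  have e1 : ∫ ω, Complex.exp ((S ω : ℂ) * Complex.I) ∂P = Complex.exp ((m : ℂ) * Complex.I) *
      ∫ ω, Complex.exp (((S ω - m : ℝ) : ℂ) * Complex.I) ∂P := by
    rw [← integral_const_mul]
    congr 1
    funext ω
    rw [← Complex.exp_add]
    push_cast
    ring_nf
  rw [e1, sub_eq_add_neg ((m : ℂ) * Complex.I), Complex.exp_add, ← mul_sub, norm_mul,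
    Complex.norm_exp_ofReal_mul_I, one_mul]
  have e2 : ∫ ω, ((1 : ℂ) + ((S ω - m : ℝ) : ℂ) * Complex.I - ((S ω - m : ℝ) : ℂ) ^ 2 / 2) ∂P
      = ((1 - V / 2 : ℝ) : ℂ) := by
    have i1 : Integrable (fun ω => (1 : ℂ) + ((S ω - m : ℝ) : ℂ) * Complex.I) P :=
      (integrable_const _).add (hc1.ofReal.mul_const _)
    have i2 : Integrable (fun ω => ((S ω - m : ℝ) : ℂ) ^ 2 / 2) P := by
      simp only [← Complex.ofReal_pow]
      exact hc2.ofReal.div_const 2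
    rw [integral_sub i1 i2, integral_add (integrable_const _) (hc1.ofReal.mul_const _),
      integral_mul_const, integral_complex_ofReal, integral_div]
    simp only [← Complex.ofReal_pow]
    rw [integral_complex_ofReal, integral_sub h1 (integrable_const m),
      ← variance_eq_integral hS.aemeasurable]
    simp [m, V]
  have i0 : Integrable (fun ω => Complex.exp (((S ω - m : ℝ) : ℂ) * Complex.I)) P := by
    refine Integrable.of_bound (C := 1) (by fun_prop) (ae_of_all _ fun ω => ?_)
    rw [Complex.norm_exp_ofReal_mul_I]
  have i3 : Integrable (fun ω => (1 : ℂ) + ((S ω - m : ℝ) : ℂ) * Complex.I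
      - ((S ω - m : ℝ) : ℂ) ^ 2 / 2) P := by
    refine ((integrable_const _).add (hc1.ofReal.mul_const _)).sub ?_
    simp only [← Complex.ofReal_pow]
    exact hc2.ofReal.div_const 2
  have b1 : ‖∫ ω, Complex.exp (((S ω - m : ℝ) : ℂ) * Complex.I) ∂P - ((1 - V / 2 : ℝ) : ℂ)‖
      ≤ 32 * ∫ ω, |S ω| ^ 3 ∂P := by
    rw [← e2, ← integral_sub i0 i3]
    refine (norm_integral_le_of_norm_le (hc3.const_mul 4) (ae_of_all _ fun ω =>
      norm_exp_I_sub_taylor_le _)).trans ?_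
    rw [integral_const_mul]
    linarith
  have b2 : ‖((1 - V / 2 : ℝ) : ℂ) - Complex.exp (-((V / 2 : ℝ) : ℂ))‖ ≤ V ^ 2 := by
    rw [← Complex.ofReal_neg, ← Complex.ofReal_exp, ← Complex.ofReal_sub, Complex.norm_real,
      Real.norm_eq_abs, abs_le]
    have l1 := Real.add_one_le_exp (-(V / 2))
    have l2 : Real.exp (-(V / 2)) ≤ 1 - V / 2 + V ^ 2 := by
      have l3 := Real.quadratic_le_exp_of_nonneg (x := V / 2) (by positivity)
      rw [Real.exp_neg]
      refine inv_le_of_inv_le₀ (by nlinarith [sq_nonneg (V - 1)]) (le_trans ?_ l3)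
      rw [inv_le_iff_one_le_mul₀ (by nlinarith [sq_nonneg (V - 1)])]
      nlinarith [mul_nonneg hV (sq_nonneg V), sq_nonneg V, mul_nonneg (sq_nonneg V) (sq_nonneg V)]
    constructor <;> nlinarith
  calc _ ≤ _ := norm_sub_le_norm_sub_add_norm_sub _ ((1 - V / 2 : ℝ) : ℂ) _
    _ ≤ _ := add_le_add b1 b2

/-- Quantitative central limit theorem for an infinite sum of variables with multiplicative
characteristic functions. -/
lemma norm_integral_exp_tsum_sub_le {ι : Type*} [Countable ι] {S : ι → Ω → ℝ} {ε : ι → ℝ}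
    (hS : ∀ m, Measurable (S m)) (h2 : ∀ m, MemLp (S m) 2 P)
    (h3 : ∀ m, Integrable (fun ω => |S m ω| ^ 3) P)
    (hprod : ∀ s : Finset ι, ∫ ω, ∏ m ∈ s, Complex.exp ((S m ω : ℂ) * Complex.I) ∂P
      = ∏ m ∈ s, ∫ ω, Complex.exp ((S m ω : ℂ) * Complex.I) ∂P)
    (hsum : ∀ᵐ ω ∂P, Summable fun m => S m ω)
    (hmean : Summable fun m => ∫ ω, S m ω ∂P) (hvar : Summable fun m => variance (S m) P)
    (hε : ∀ m, 32 * ∫ ω, |S m ω| ^ 3 ∂P + variance (S m) P ^ 2 ≤ ε m) (hεs : Summable ε) :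
    ‖∫ ω, Complex.exp (((∑' m, S m ω : ℝ) : ℂ) * Complex.I) ∂P
      - Complex.exp (((∑' m, ∫ ω, S m ω ∂P : ℝ) : ℂ) * Complex.I
        - (((∑' m, variance (S m) P) / 2 : ℝ) : ℂ))‖ ≤ ∑' m, ε m := by
  have hε0 : ∀ m, 0 ≤ ε m := fun m => le_trans (by
    have : 0 ≤ ∫ ω, |S m ω| ^ 3 ∂P := integral_nonneg fun ω => by positivity
    positivity) (hε m)
  -- The comparison is made for finite sets of sites with a bound independent of the set. Dominated
  -- convergence, with all integrands of norm at most one, passes to the whole series.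
  have hlim1 : Tendsto (fun s : Finset ι => ∫ ω, ∏ m ∈ s, Complex.exp ((S m ω : ℂ) * Complex.I) ∂P)
      atTop (𝓝 (∫ ω, Complex.exp (((∑' m, S m ω : ℝ) : ℂ) * Complex.I) ∂P)) := by
    refine tendsto_integral_filter_of_dominated_convergence (fun _ => 1) ?_ ?_
      (integrable_const _) ?_
    · exact Eventually.of_forall fun s => Measurable.aestronglyMeasurable (by fun_prop)
    · refine Eventually.of_forall fun s => ae_of_all _ fun ω => ?_
      rw [norm_prod]
      exact Finset.prod_le_one (fun _ _ => norm_nonneg _)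
        fun m _ => (Complex.norm_exp_ofReal_mul_I _).le
    · filter_upwards [hsum] with ω hω
      have h1 : Continuous fun x : ℝ => Complex.exp ((x : ℂ) * Complex.I) := by fun_prop
      refine ((h1.tendsto _).comp hω.hasSum).congr fun s => ?_
      simp only [Function.comp_apply]
      rw [← Complex.exp_sum, Complex.ofReal_sum, Finset.sum_mul]
  have hlim2 : Tendsto (fun s : Finset ι => ∏ m ∈ s, Complex.exp (((∫ ω, S m ω ∂P : ℝ) : ℂ)
      * Complex.I - ((variance (S m) P / 2 : ℝ) : ℂ))) atTop
      (𝓝 (Complex.exp (((∑' m, ∫ ω, S m ω ∂P : ℝ) : ℂ) * Complex.I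
        - (((∑' m, variance (S m) P) / 2 : ℝ) : ℂ)))) := by
    have h1 : Continuous fun x : ℝ × ℝ =>
        Complex.exp ((x.1 : ℂ) * Complex.I - ((x.2 / 2 : ℝ) : ℂ)) := by fun_prop
    refine ((h1.tendsto _).comp (hmean.hasSum.prodMk_nhds hvar.hasSum)).congr fun s => ?_
    simp only [Function.comp_apply]
    rw [← Complex.exp_sum]
    congr 1
    push_cast
    rw [Finset.sum_sub_distrib, Finset.sum_mul, Finset.sum_div]
  refine le_of_tendsto (hlim1.sub hlim2).norm (Eventually.of_forall fun s => ?_)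
  rw [hprod s]
  refine (norm_prod_sub_prod_le_sum s _ _ (fun m _ => ?_) fun m _ => ?_).trans ?_
  · refine (norm_integral_le_of_norm_le (integrable_const 1) (ae_of_all _ fun ω =>
      (Complex.norm_exp_ofReal_mul_I _).le)).trans_eq (by simp)
  · rw [Complex.norm_exp]
    have hv : 0 ≤ variance (S m) P / 2 := div_nonneg (variance_nonneg _ _) zero_le_two
    rw [Complex.sub_re, Complex.re_ofReal_mul, Complex.I_re, Complex.ofReal_re, mul_zero, zero_sub,
      Real.exp_le_one_iff]
    linarith
  · exact (Finset.sum_le_sum fun m _ => (norm_integral_exp_sub_gaussian_le (hS m) (h2 m)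
      (h3 m)).trans (hε m)).trans (hεs.sum_le_tsum s fun m _ => hε0 m)

/-- Characteristic functions of random sums over different sites multiply. -/
lemma integral_prod_exp_randomSum {ι : Type*} {N : ι → Ω → ℕ} {G : ι → ℕ → Ω → ℝ}
    (hN : ∀ m, Measurable (N m)) (hG : ∀ m j, Measurable (G m j))
    (hNi : iIndepFun N P) (hGi : iIndepFun (fun i : ι × ℕ => G i.1 i.2) P)
    (hNG : IndepFun (fun ω m => N m ω) (fun ω (i : ι × ℕ) => G i.1 i.2 ω) P) (s : Finset ι) :
    ∫ ω, ∏ m ∈ s, Complex.exp ((randomSum (N m) (G m) ω : ℂ) * Complex.I) ∂P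
      = ∏ m ∈ s, ∫ ω, Complex.exp ((randomSum (N m) (G m) ω : ℂ) * Complex.I) ∂P := by
  classical
  -- The conditional characteristic function of the sum at site `m`, given that it has `k` terms.
  -- Independence of the terms evaluates the inner integral by these functions, and independence of
  -- the counts separates the sites.
  let ψ : ι → ℕ → ℂ := fun m k =>
    ∏ j ∈ Finset.range k, ∫ ω, Complex.exp ((G m j ω : ℂ) * Complex.I) ∂P
  have key : ∀ s : Finset ι,
      ∫ ω, ∏ m ∈ s, Complex.exp ((randomSum (N m) (G m) ω : ℂ) * Complex.I) ∂P
        = ∏ m ∈ s, ∫ ω, ψ m (N m ω) ∂P := by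
    intro s
    let F : (ι → ℕ) × (ι × ℕ → ℝ) → ℂ := fun x =>
      ∏ m ∈ s, Complex.exp (((∑ j ∈ Finset.range (x.1 m), x.2 (m, j) : ℝ) : ℂ) * Complex.I)
    have hF : Measurable F := by
      refine Finset.measurable_fun_prod s fun m _ => ?_
      have h1 : Measurable fun x : (ι → ℕ) × (ι × ℕ → ℝ) =>
          ∑ j ∈ Finset.range (x.1 m), x.2 (m, j) :=
        measurable_sum_range.comp (f := fun x : (ι → ℕ) × (ι × ℕ → ℝ) =>
          (x.1 m, fun j => x.2 (m, j))) (by fun_prop)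
      fun_prop
    have hb : ∀ x, ‖F x‖ ≤ 1 := fun x => by
      simp only [F]
      rw [norm_prod]
      exact Finset.prod_le_one (fun _ _ => norm_nonneg _)
        fun m _ => (Complex.norm_exp_ofReal_mul_I _).le
    have hA : Measurable fun ω m => N m ω := measurable_pi_lambda _ hN
    have hB : Measurable fun ω (i : ι × ℕ) => G i.1 i.2 ω :=
      measurable_pi_lambda _ fun i => hG i.1 i.2
    have h1 := integral_comp_prod_of_indepFun hA hB hNG hF.stronglyMeasurable
      (Integrable.of_bound (hF.comp (hA.prodMk hB)).aestronglyMeasurable 1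
        (ae_of_all _ fun ω => hb _))
    have h2 : ∀ ω, ∫ ω', F (fun m => N m ω, fun i => G i.1 i.2 ω') ∂P
        = ∏ m ∈ s, ψ m (N m ω) := by
      intro ω
      let t : Finset (Σ _ : ι, ℕ) := s.sigma fun m => Finset.range (N m ω)
      have e : ∀ ω', F (fun m => N m ω, fun i => G i.1 i.2 ω')
          = ∏ x : {x // x ∈ t}, Complex.exp ((G x.1.1 x.1.2 ω' : ℂ) * Complex.I) := fun ω' => by
        rw [Finset.prod_coe_sort t fun x => Complex.exp ((G x.1 x.2 ω' : ℂ) * Complex.I),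
          Finset.prod_sigma]
        refine Finset.prod_congr rfl fun m _ => ?_
        rw [← Complex.exp_sum, Complex.ofReal_sum, Finset.sum_mul]
      simp only [e]
      have hinj : Function.Injective fun x : {x // x ∈ t} => (x.1.1, x.1.2) := by
        rintro ⟨⟨a, b⟩, hx⟩ ⟨⟨c, d⟩, hy⟩ h
        simp only [Prod.mk.injEq] at h
        obtain ⟨rfl, rfl⟩ := h
        rfl
      have hi : iIndepFun (fun (x : {x // x ∈ t}) ω => G x.1.1 x.1.2 ω) P := hGi.precomp hinj
      rw [hi.integral_fun_prod_comp (f := fun _ (y : ℝ) => Complex.exp ((y : ℂ) * Complex.I))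
        (fun x => (hG _ _).aemeasurable) (fun x => by fun_prop),
        Finset.prod_coe_sort t fun x => ∫ ω, Complex.exp ((G x.1 x.2 ω : ℂ) * Complex.I) ∂P,
        Finset.prod_sigma]
    simp only [h2] at h1
    refine h1.trans ?_
    have hi : iIndepFun (fun (m : {x // x ∈ s}) ω => N m ω) P :=
      hNi.precomp Subtype.val_injective
    have h3 := hi.integral_fun_prod_comp (f := fun (m : {x // x ∈ s}) k => ψ m k)
      (fun x => (hN _).aemeasurable) (fun x => (measurable_of_countable _).aestronglyMeasurable)
    rw [Finset.prod_coe_sort s fun m => ∫ ω, ψ m (N m ω) ∂P] at h3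
    rw [← h3]
    congr 1
    funext ω
    rw [Finset.prod_coe_sort s fun m => ψ m (N m ω)]
  -- The individual factors are identified by applying `key` to singletons.
  rw [key]
  refine Finset.prod_congr rfl fun m _ => ?_
  have := key {m}
  simpa using this.symm

end CLT

/-! ### Step functions on the integers -/

/-- The indicator of `m ≤ x`. -/
def step (x m : ℤ) : ℝ := if m ≤ x then 1 else 0

lemma step_mul_step (x y m : ℤ) : step x m * step y m = step (min x y) m := by
  simp only [step, le_min_iff]
  split_ifs <;> simp_all

lemma hasSum_step_sub (x y : ℤ) : HasSum (fun m => step x m - step y m) ((x : ℝ) - y) := by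
  have key : ∀ x y : ℤ, y ≤ x → HasSum (fun m => step x m - step y m) ((x : ℝ) - y) := by
    intro x y hxy
    have h1 : (x : ℝ) - y = ∑ m ∈ Finset.Ioc y x, (step x m - step y m) := by
      rw [Finset.sum_congr rfl (g := fun _ => (1 : ℝ))]
      · have h2 : (((x - y).toNat : ℤ) : ℝ) = ((x - y : ℤ) : ℝ) := by
          rw [Int.toNat_of_nonneg (by omega)]
        simp only [Finset.sum_const, Int.card_Ioc, nsmul_eq_mul, mul_one]
        push_cast at h2
        linarith
      · intro m hm
        rw [Finset.mem_Ioc] at hm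
        simp [step, hm.1, hm.2]
    rw [h1]
    refine hasSum_sum_of_ne_finset_zero fun m hm => ?_
    rw [Finset.mem_Ioc, not_and_or, not_lt, not_le] at hm
    simp only [step]
    rcases hm with hm | hm
    · simp [hm, hm.trans hxy]
    · simp [not_le.2 hm, not_le.2 (hxy.trans_lt hm)]
  rcases le_total y x with h | h
  · exact key x y h
  · have := (key y x h).neg
    simpa using this

lemma abs_step_sub (x y m : ℤ) : |step x m - step y m| = step (max x y) m - step (min x y) m := by
  rcases le_total x y with h | h
  · rw [max_eq_right h, min_eq_left h]
    simp only [step]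
    split_ifs <;> first | omega | simp
  · rw [max_eq_left h, min_eq_right h]
    simp only [step]
    split_ifs <;> first | omega | simp

lemma hasSum_abs_step_sub (x y : ℤ) : HasSum (fun m => |step x m - step y m|) |(x : ℝ) - y| := by
  simp only [abs_step_sub]
  have h := hasSum_step_sub (max x y) (min x y)
  convert h using 1
  push_cast
  rw [max_sub_min_eq_abs, abs_sub_comm]

lemma step_mul_eq (x y z w m : ℤ) : (step x m - step y m) * (step z m - step w m)
    = (step (min x z) m - step (min x w) m) - (step (min y z) m - step (min y w) m) := by
  simp only [← step_mul_step]
  ring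

lemma min_eq_half_add_sub_abs (a b : ℝ) : min a b = (a + b - |a - b|) / 2 := by
  rcases le_total a b with h | h
  · rw [min_eq_left h, abs_of_nonpos (sub_nonpos.2 h)]
    ring
  · rw [min_eq_right h, abs_of_nonneg (sub_nonneg.2 h)]
    ring

/-- A product of steps is the step at the minimum, a difference of steps sums to the difference of
the endpoints, and `min a b = (a + b - |a - b|) / 2`. The linear parts cancel, so covariances reduce
to first absolute moments. -/
lemma hasSum_step_mul (x y z w : ℤ) :
    HasSum (fun m => (step x m - step y m) * (step z m - step w m))
      ((|(x : ℝ) - w| + |(z : ℝ) - y| - |(x : ℝ) - z| - |(y : ℝ) - w|) / 2) := by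
  simp only [step_mul_eq]
  have h := (hasSum_step_sub (min x z) (min x w)).sub (hasSum_step_sub (min y z) (min y w))
  have e : (|(x : ℝ) - w| + |(z : ℝ) - y| - |(x : ℝ) - z| - |(y : ℝ) - w|) / 2
      = (((min x z : ℤ) : ℝ) - (min x w : ℤ)) - ((min y z : ℤ) - (min y w : ℤ)) := by
    push_cast
    simp only [min_eq_half_add_sub_abs]
    rw [abs_sub_comm (z : ℝ) y]
    ring
  rw [e]
  exact h

/-- A step has a single jump, between `x` and `x + 1`. -/
lemma sum_abs_step_succ_sub_le (x : ℤ) (s : Finset ℤ) :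
    ∑ m ∈ s, |step x (m + 1) - step x m| ≤ 1 := by
  have e : ∀ m, |step x (m + 1) - step x m| = if m = x then 1 else 0 := fun m => by
    simp only [step]
    split_ifs <;> first | omega | simp
  simp only [e, Finset.sum_ite_eq']
  split_ifs <;> norm_num

/-- Both endpoints are smaller than `m` in absolute value, so `m` lies on the same side of the two.
-/
lemma step_sub_eq_zero {x y m : ℤ} {M : ℝ} (hm : M < |(m : ℝ)|)
    (h : |(x : ℝ) - y| + |(y : ℝ)| ≤ M) : step x m - step y m = 0 := by
  have h1 := abs_lt.1 (show |(x : ℝ)| < |(m : ℝ)| by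
    have := abs_add_le ((x : ℝ) - y) y
    rw [sub_add_cancel] at this
    linarith)
  have h2 := abs_lt.1 (show |(y : ℝ)| < |(m : ℝ)| by linarith [abs_nonneg ((x : ℝ) - y)])
  simp only [step]
  rcases abs_cases (m : ℝ) with ⟨hc, -⟩ | ⟨hc, -⟩ <;> rw [hc] at h1 h2
  · have a1 : x < m := by exact_mod_cast h1.2
    have a2 : y < m := by exact_mod_cast h2.2
    simp [not_le.2 a1, not_le.2 a2]
  · have a1 : m ≤ x := by have := h1.1; rw [neg_neg] at this; exact_mod_cast this.le
    have a2 : m ≤ y := by have := h2.1; rw [neg_neg] at this; exact_mod_cast this.le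
    simp [a1, a2]

lemma abs_step_sub_le_one (x y m : ℤ) : |step x m - step y m| ≤ 1 := by
  simp only [step]
  split_ifs <;> simp

/-! ### Averaged step functions -/

section Weights

variable {α : Type*} [MeasurableSpace α] {μ : Measure α} [IsProbabilityMeasure μ]
  {X : α → ℤ} {k : ℤ}

lemma measurable_step_comp (hX : Measurable X) (m : ℤ) : Measurable fun a => step (X a) m :=
  (measurable_of_countable fun x => step x m).comp hX

lemma integrable_abs_step_sub (hX : Measurable X) (k m : ℤ) :
    Integrable (fun a => |step (X a) m - step k m|) μ := by
  have := measurable_step_comp hX m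
  refine Integrable.of_bound (C := 1) (by fun_prop) (ae_of_all _ fun a => ?_)
  rw [Real.norm_eq_abs, abs_abs]
  exact abs_step_sub_le_one _ _ _

lemma sum_integral_abs_step_sub_le (hX : Measurable X)
    (hi : Integrable (fun a => |(X a : ℝ) - k|) μ) (s : Finset ℤ) :
    ∑ m ∈ s, ∫ a, |step (X a) m - step k m| ∂μ ≤ ∫ a, |(X a : ℝ) - k| ∂μ := by
  rw [← integral_finsetSum _ fun m _ => integrable_abs_step_sub hX k m]
  exact integral_mono (integrable_finsetSum _ fun m _ => integrable_abs_step_sub hX k m) hi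
    fun a => sum_le_hasSum s (fun _ _ => abs_nonneg _) (hasSum_abs_step_sub (X a) k)

lemma summable_integral_abs_step_sub (hX : Measurable X)
    (hi : Integrable (fun a => |(X a : ℝ) - k|) μ) :
    Summable fun m => ∫ a, |step (X a) m - step k m| ∂μ :=
  summable_of_sum_le (fun _ => integral_nonneg fun _ => abs_nonneg _)
    (sum_integral_abs_step_sub_le hX hi)

lemma tsum_integral_abs_step_sub_le (hX : Measurable X)
    (hi : Integrable (fun a => |(X a : ℝ) - k|) μ) :
    ∑' m, ∫ a, |step (X a) m - step k m| ∂μ ≤ ∫ a, |(X a : ℝ) - k| ∂μ :=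
  (summable_integral_abs_step_sub hX hi).tsum_le_of_sum_le
    (sum_integral_abs_step_sub_le hX hi)

/-- Tail bound for the averaged step functions in terms of exponential moments. -/
lemma sum_tail_integral_abs_step_sub_le (hX : Measurable X) {θ M : ℝ} (hθ : 0 < θ)
    (hi : Integrable (fun a => Real.exp (2 * θ * |(X a : ℝ) - k|)) μ) {s : Finset ℤ}
    (hs : ∀ m ∈ s, M < |(m : ℝ)|) :
    ∑ m ∈ s, ∫ a, |step (X a) m - step k m| ∂μ
      ≤ Real.exp (θ * (|(k : ℝ)| - M)) / θ * ∫ a, Real.exp (2 * θ * |(X a : ℝ) - k|) ∂μ := by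
  rw [← integral_finsetSum _ fun m _ => integrable_abs_step_sub hX k m, ← integral_const_mul]
  refine integral_mono (integrable_finsetSum _ fun m _ => integrable_abs_step_sub hX k m)
    (hi.const_mul _) fun a => ?_
  simp only
  -- Either no site beyond `M` is affected, or `|X - k| + |k| - M > 0`. In the second case `exp(θ(|X
  -- - k| + |k| - M))` exceeds one and may be multiplied onto `|X - k| ≤ exp(θ|X - k|) / θ`.
  rcases le_or_gt (|(X a : ℝ) - k| + |(k : ℝ)|) M with h | h
  · rw [Finset.sum_eq_zero fun m hm => by rw [step_sub_eq_zero (hs m hm) h, abs_zero]]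
    positivity
  · refine (sum_le_hasSum s (fun _ _ => abs_nonneg _) (hasSum_abs_step_sub (X a) k)).trans ?_
    set y := |(X a : ℝ) - k|
    have hy : 0 ≤ y := abs_nonneg _
    have h1 : θ * y ≤ Real.exp (θ * y) := by linarith [Real.add_one_le_exp (θ * y)]
    rw [div_mul_eq_mul_div, le_div_iff₀ hθ, ← Real.exp_add]
    calc y * θ = θ * y := mul_comm _ _
      _ ≤ _ := h1
      _ ≤ _ := Real.exp_le_exp.2 (by nlinarith)

variable {F : ℤ → α → ℝ}

lemma integrable_of_abs_le_step (hX : Measurable X) (hF : ∀ m, Measurable (F m))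
    (hle : ∀ m a, |F m a| ≤ |step (X a) m - step k m|) (m : ℤ) : Integrable (F m) μ :=
  (integrable_abs_step_sub hX k m).mono' (hF m).aestronglyMeasurable (ae_of_all _ fun a => hle m a)

lemma abs_integral_le_of_abs_le_step (hX : Measurable X)
    (hle : ∀ m a, |F m a| ≤ |step (X a) m - step k m|) (m : ℤ) :
    |∫ a, F m a ∂μ| ≤ ∫ a, |step (X a) m - step k m| ∂μ := by
  rw [← Real.norm_eq_abs]
  exact norm_integral_le_of_norm_le (integrable_abs_step_sub hX k m)
    (ae_of_all _ fun a => (Real.norm_eq_abs _).trans_le (hle m a))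

lemma hasSum_integral_of_abs_le_step (hX : Measurable X)
    (hi : Integrable (fun a => |(X a : ℝ) - k|) μ) (hF : ∀ m, Measurable (F m))
    (hle : ∀ m a, |F m a| ≤ |step (X a) m - step k m|) {g : α → ℝ}
    (hg : ∀ a, HasSum (fun m => F m a) (g a)) :
    HasSum (fun m => ∫ a, F m a ∂μ) (∫ a, g a ∂μ) := by
  have h := hasSum_integral_of_summable_integral_norm (μ := μ) (F := F)
    (fun m => integrable_of_abs_le_step hX hF hle m)
    (Summable.of_nonneg_of_le (fun m => integral_nonneg fun a => norm_nonneg _)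
      (fun m => integral_mono (integrable_of_abs_le_step hX hF hle m).norm
        (integrable_abs_step_sub hX k m) fun a => hle m a)
      (summable_integral_abs_step_sub hX hi))
  simpa only [fun a => (hg a).tsum_eq] using h

/-- A pathwise bound on the variation in `m` survives averaging. Smoothing over blocks uses exactly
this, and it needs no local limit theorem. -/
lemma sum_abs_integral_succ_sub_le (hX : Measurable X) (hF : ∀ m, Measurable (F m))
    (hle : ∀ m a, |F m a| ≤ |step (X a) m - step k m|) {V : ℝ}
    (hV : ∀ a (s : Finset ℤ), ∑ m ∈ s, |F (m + 1) a - F m a| ≤ V) (s : Finset ℤ) :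
    ∑ m ∈ s, |∫ a, F (m + 1) a ∂μ - ∫ a, F m a ∂μ| ≤ V := by
  have hF' := fun m => integrable_of_abs_le_step (μ := μ) hX hF hle m
  have hd : ∀ m, Integrable (fun a => |F (m + 1) a - F m a|) μ := fun m =>
    ((hF' (m + 1)).sub (hF' m)).abs
  calc _ ≤ ∑ m ∈ s, ∫ a, |F (m + 1) a - F m a| ∂μ := by
        refine Finset.sum_le_sum fun m _ => ?_
        rw [← integral_sub (hF' _) (hF' _)]
        exact abs_integral_le_integral_abs
    _ = ∫ a, ∑ m ∈ s, |F (m + 1) a - F m a| ∂μ := (integral_finsetSum _ fun m _ => hd m).symm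
    _ ≤ ∫ a, V ∂μ := integral_mono (integrable_finsetSum _ fun m _ => hd m)
        (integrable_const V) fun a => hV a s
    _ = V := by simp

end Weights

/-! ### Block averages -/

/-- Replacing a bounded sequence by its limiting block average in a weighted sum. -/
lemma abs_tsum_mul_sub_le {w u a : ℤ → ℝ} {a₀ B V M τ ε : ℝ} {L : ℕ} (hL : 0 < L)
    (hwu : ∀ m, |w m| ≤ u m) (hu : Summable u) (ha : ∀ m, |a m| ≤ B)
    (hV : ∀ s : Finset ℤ, ∑ m ∈ s, |w (m + 1) - w m| ≤ V)
    (hτ : ∀ s : Finset ℤ, (∀ m ∈ s, M < |(m : ℝ)|) → ∑ m ∈ s, u m ≤ τ) (hε : 0 ≤ ε)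
    (hav : ∀ m : ℤ, |(m : ℝ)| ≤ M →
      |1 / (L : ℝ) * ∑ j ∈ Finset.Icc 1 L, a (m + (j : ℤ)) - a₀| ≤ ε) :
    |∑' m, a m * w m - a₀ * ∑' m, w m| ≤ ε * ∑' m, u m + (B + |a₀|) * τ + B * L * V := by
  have hB : 0 ≤ B := (abs_nonneg _).trans (ha 0)
  have hV0 : 0 ≤ V := by simpa using hV ∅
  have hL0 : (0 : ℝ) < L := by exact_mod_cast hL
  have hu0 : ∀ m, 0 ≤ u m := fun m => (abs_nonneg _).trans (hwu m)
  have hw : Summable w := Summable.of_norm_bounded hu hwu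
  have hbw : ∀ b : ℤ → ℝ, (∀ m, |b m| ≤ B) → Summable fun m => b m * w m := fun b hb =>
    Summable.of_norm_bounded (hu.mul_left B) fun m => by
      rw [Real.norm_eq_abs, abs_mul]
      exact mul_le_mul (hb m) (hwu m) (abs_nonneg _) hB
  -- A shift by `j` is a chain of `j` unit shifts, each costing at most the total variation `V`.
  have hVj : ∀ (j : ℕ) (s : Finset ℤ), ∑ m ∈ s, |w (m + j) - w m| ≤ j * V := by
    intro j s
    induction j with
    | zero => simp
    | succ j ih =>
      have h1 : ∑ m ∈ s, |w (m + j + 1) - w (m + j)| ≤ V := by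
        have := hV (s.map (addRightEmbedding (j : ℤ)))
        simpa using this
      calc ∑ m ∈ s, |w (m + ((j + 1 : ℕ) : ℤ)) - w m|
          ≤ ∑ m ∈ s, (|w (m + j + 1) - w (m + j)| + |w (m + j) - w m|) := by
            refine Finset.sum_le_sum fun m _ => ?_
            push_cast
            rw [← add_assoc]
            exact abs_sub_le _ _ _
        _ ≤ V + j * V := by rw [Finset.sum_add_distrib]; exact add_le_add h1 ih
        _ = _ := by push_cast; ring
  have hshift : ∀ j ∈ Finset.Icc 1 L,
      |∑' m, a m * w m - ∑' m : ℤ, a (m + (j : ℤ)) * w m| ≤ B * L * V := by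
    intro j hj
    have hjL : (j : ℝ) ≤ L := by exact_mod_cast (Finset.mem_Icc.1 hj).2
    have e1 : ∑' m, a m * w m = ∑' m : ℤ, a (m + (j : ℤ)) * w (m + (j : ℤ)) :=
      ((Equiv.addRight (j : ℤ)).tsum_eq fun m => a m * w m).symm
    have s1 : Summable fun m : ℤ => a (m + (j : ℤ)) * w (m + (j : ℤ)) :=
      (Equiv.addRight (j : ℤ)).summable_iff.2 (hbw a ha)
    have s2 := hbw (fun m => a (m + (j : ℤ))) fun m => ha _
    have hd : Summable fun m : ℤ => |w (m + (j : ℤ)) - w m| :=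
      summable_of_sum_le (fun _ => abs_nonneg _) (hVj j)
    rw [e1, ← s1.tsum_sub s2]
    have hle : ∀ m : ℤ, ‖a (m + (j : ℤ)) * w (m + (j : ℤ)) - a (m + (j : ℤ)) * w m‖
        ≤ B * |w (m + (j : ℤ)) - w m| := fun m => by
      rw [← mul_sub, norm_mul]
      exact mul_le_mul_of_nonneg_right (ha _) (abs_nonneg _)
    refine (tsum_of_norm_bounded (hd.mul_left B).hasSum hle).trans ?_
    rw [tsum_mul_left]
    have : ∑' m : ℤ, |w (m + (j : ℤ)) - w m| ≤ j * V := hd.tsum_le_of_sum_le (hVj j)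
    calc _ ≤ B * (j * V) := by gcongr
      _ ≤ B * (L * V) := by gcongr
      _ = _ := by ring
  -- By translation invariance of the sum over `ℤ`, shifting `a` amounts to shifting `w`. Averaging
  -- over `1 ≤ j ≤ L` then replaces `a` by its block averages at cost `B L V`.
  let A : ℤ → ℝ := fun m => 1 / (L : ℝ) * ∑ j ∈ Finset.Icc 1 L, a (m + (j : ℤ))
  have hA : ∀ m, |A m| ≤ B := fun m => by
    simp only [A]
    rw [abs_mul, abs_of_pos (by positivity : 0 < 1 / (L : ℝ)), one_div, inv_mul_le_iff₀ hL0]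
    refine (Finset.abs_sum_le_sum_abs _ _).trans ((Finset.sum_le_sum fun j _ => ha _).trans_eq ?_)
    simp
  have hAw : ∑' m, A m * w m
      = 1 / (L : ℝ) * ∑ j ∈ Finset.Icc 1 L, ∑' m : ℤ, a (m + (j : ℤ)) * w m := by
    have h := Summable.tsum_finsetSum (s := Finset.Icc 1 L)
      (f := fun (j : ℕ) (m : ℤ) => a (m + (j : ℤ)) * w m)
      fun j _ => hbw (fun m => a (m + (j : ℤ))) fun m => ha _
    rw [← h, ← tsum_mul_left]
    refine tsum_congr fun m => ?_
    simp only [A]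
    rw [mul_assoc, Finset.sum_mul]
  have b1 : |∑' m, a m * w m - ∑' m, A m * w m| ≤ B * L * V := by
    have e : ∑' m, a m * w m - ∑' m, A m * w m = 1 / (L : ℝ) * ∑ j ∈ Finset.Icc 1 L,
        (∑' m, a m * w m - ∑' m : ℤ, a (m + (j : ℤ)) * w m) := by
      rw [hAw, Finset.sum_sub_distrib]
      simp only [Finset.sum_const, Nat.card_Icc, add_tsub_cancel_right, nsmul_eq_mul]
      field_simp
    rw [e, abs_mul, abs_of_pos (by positivity : 0 < 1 / (L : ℝ)), one_div, inv_mul_le_iff₀ hL0]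
    refine (Finset.abs_sum_le_sum_abs _ _).trans ((Finset.sum_le_sum hshift).trans_eq ?_)
    simp
  have b2 : |∑' m, A m * w m - a₀ * ∑' m, w m| ≤ ε * ∑' m, u m + (B + |a₀|) * τ := by
    rw [← tsum_mul_left, ← (hbw A hA).tsum_sub (hw.mul_left a₀)]
    -- For `|m| ≤ M` the block average is within `ε` of `a₀`. Beyond `M` only the crude bound `B +
    -- |a₀|` is available, and the tail `τ` of the weights makes up for it.
    have hfin : ∀ s : Finset ℤ, ∑ m ∈ s, |A m * w m - a₀ * w m|
        ≤ ε * ∑' m, u m + (B + |a₀|) * τ := by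
      intro s
      classical
      rw [← Finset.sum_filter_add_sum_filter_not s fun m : ℤ => |(m : ℝ)| ≤ M]
      refine add_le_add ?_ ?_
      · calc _ ≤ ∑ m ∈ s.filter fun m : ℤ => |(m : ℝ)| ≤ M, ε * u m := by
              refine Finset.sum_le_sum fun m hm => ?_
              rw [← sub_mul, abs_mul]
              exact mul_le_mul (hav m (Finset.mem_filter.1 hm).2) (hwu m) (abs_nonneg _) hε
          _ ≤ _ := by
              rw [← Finset.mul_sum]
              gcongr
              exact hu.sum_le_tsum _ fun m _ => hu0 m
      · calc _ ≤ ∑ m ∈ s.filter fun m : ℤ => ¬ |(m : ℝ)| ≤ M, (B + |a₀|) * u m := by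
              refine Finset.sum_le_sum fun m _ => ?_
              rw [← sub_mul, abs_mul]
              exact mul_le_mul ((abs_sub _ _).trans (add_le_add_left (hA m) _)) (hwu m)
                (abs_nonneg _) (by positivity)
          _ ≤ _ := by
              rw [← Finset.mul_sum]
              refine mul_le_mul_of_nonneg_left (hτ _ fun m hm => ?_) (by positivity)
              exact not_le.1 (Finset.mem_filter.1 hm).2
    have hs : Summable fun m => |A m * w m - a₀ * w m| :=
      summable_of_sum_le (fun _ => abs_nonneg _) hfin
    exact (tsum_of_norm_bounded hs.hasSum fun m => (Real.norm_eq_abs _).le).trans (hs.tsum_le_of_sum_le hfin)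
  calc _ ≤ |∑' m, a m * w m - ∑' m, A m * w m| + |∑' m, A m * w m - a₀ * ∑' m, w m| :=
        abs_sub_le _ _ _
    _ ≤ _ := by linarith

/-! ### Concentration -/

section Concentration

variable {α : Type*} [MeasurableSpace α] {μ : Measure α} {Y : α → ℝ} {δ K : ℝ}

/-- A sub-Gaussian bound for the moment generating function on `[-δ, δ]`, up to a bounded shift. -/
def MgfBound (μ : Measure α) (Y : α → ℝ) (δ K : ℝ) : Prop :=
  ∀ θ, |θ| ≤ δ → Integrable (fun a => Real.exp (θ * Y a)) μ ∧
    ∫ a, Real.exp (θ * Y a) ∂μ ≤ Real.exp (K * θ ^ 2 + |θ|)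

lemma MgfBound.exp_abs (h : MgfBound μ Y δ K) (hY : Measurable Y) {θ : ℝ} (h0 : 0 ≤ θ)
    (hθ : θ ≤ δ) : Integrable (fun a => Real.exp (θ * |Y a|)) μ ∧
      ∫ a, Real.exp (θ * |Y a|) ∂μ ≤ 2 * Real.exp (K * θ ^ 2 + θ) := by
  obtain ⟨i1, b1⟩ := h θ (by rwa [abs_of_nonneg h0])
  obtain ⟨i2, b2⟩ := h (-θ) (by rwa [abs_neg, abs_of_nonneg h0])
  rw [abs_of_nonneg h0] at b1
  rw [abs_neg, abs_of_nonneg h0, neg_sq] at b2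
  have hle : ∀ a, Real.exp (θ * |Y a|) ≤ Real.exp (θ * Y a) + Real.exp (-θ * Y a) := fun a => by
    rcases abs_cases (Y a) with ⟨e, -⟩ | ⟨e, -⟩ <;> rw [e]
    · linarith [Real.exp_pos (-θ * Y a)]
    · rw [mul_neg, ← neg_mul]
      linarith [Real.exp_pos (θ * Y a)]
  have i3 : Integrable (fun a => Real.exp (θ * |Y a|)) μ := by
    refine (i1.add i2).mono' (by fun_prop) (ae_of_all _ fun a => ?_)
    rw [Real.norm_eq_abs, abs_of_pos (Real.exp_pos _)]
    exact hle a
  refine ⟨i3, ?_⟩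
  calc _ ≤ ∫ a, (Real.exp (θ * Y a) + Real.exp (-θ * Y a)) ∂μ := integral_mono i3 (i1.add i2) hle
    _ = _ := integral_add i1 i2
    _ ≤ _ := by linarith

lemma MgfBound.abs (h : MgfBound μ Y δ K) (hY : Measurable Y) {θ : ℝ} (h0 : 0 < θ)
    (hθ : θ ≤ δ) : Integrable (fun a => |Y a|) μ ∧
      ∫ a, |Y a| ∂μ ≤ 1 / θ * (2 * Real.exp (K * θ ^ 2 + θ)) := by
  obtain ⟨i1, b1⟩ := h.exp_abs hY h0.le hθ
  have hle : ∀ a, |Y a| ≤ 1 / θ * Real.exp (θ * |Y a|) := fun a => by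
    rw [one_div, ← div_eq_inv_mul, le_div_iff₀ h0]
    linarith [Real.add_one_le_exp (θ * |Y a|)]
  have i2 : Integrable (fun a => |Y a|) μ := by
    refine (i1.const_mul (1 / θ)).mono' (by fun_prop) (ae_of_all _ fun a => ?_)
    rw [Real.norm_eq_abs, abs_abs]
    exact hle a
  refine ⟨i2, ?_⟩
  calc _ ≤ ∫ a, 1 / θ * Real.exp (θ * |Y a|) ∂μ := integral_mono i2 (i1.const_mul _) hle
    _ = _ := integral_const_mul _ _
    _ ≤ _ := by gcongr

end Concentration

/-! ### Weights of sites -/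

section SiteWeight

variable {α : Type*} [MeasurableSpace α] {μ : Measure α} [IsProbabilityMeasure μ]
  {X : α → ℤ} {k : ℤ} {F : ℤ → α → ℝ} {V δ K : ℝ}

/-- A family `F m`, `m ∈ ℤ`, of random variables of bounded variation in `m` that vanishes unless
`m` separates `k` from `X`, which is concentrated around `k`. -/
structure SiteWeight (μ : Measure α) (X : α → ℤ) (k : ℤ) (F : ℤ → α → ℝ) (V δ K : ℝ) : Prop where
  meas_endpoint : Measurable X
  meas : ∀ m, Measurable (F m)
  abs_le : ∀ m a, |F m a| ≤ |step (X a) m - step k m|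
  variation : ∀ a (s : Finset ℤ), ∑ m ∈ s, |F (m + 1) a - F m a| ≤ V
  mgf : MgfBound μ (fun a => (X a : ℝ) - k) δ K

namespace SiteWeight

lemma measurable_sub (h : SiteWeight μ X k F V δ K) : Measurable fun a => (X a : ℝ) - k :=
  (measurable_of_countable fun x : ℤ => (x : ℝ) - k).comp h.meas_endpoint

lemma integrable_abs (h : SiteWeight μ X k F V δ K) (hδ : 0 < δ) :
    Integrable (fun a => |(X a : ℝ) - k|) μ :=
  (h.mgf.abs h.measurable_sub hδ le_rfl).1

lemma abs_le_one (h : SiteWeight μ X k F V δ K) (m : ℤ) (a : α) : |F m a| ≤ 1 :=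
  (h.abs_le m a).trans (abs_step_sub_le_one _ _ _)

lemma integrable (h : SiteWeight μ X k F V δ K) (m : ℤ) : Integrable (F m) μ :=
  integrable_of_abs_le_step h.meas_endpoint h.meas h.abs_le m

lemma hasSum_integral (h : SiteWeight μ X k F V δ K) (hδ : 0 < δ) {g : α → ℝ}
    (hg : ∀ a, HasSum (fun m => F m a) (g a)) :
    HasSum (fun m => ∫ a, F m a ∂μ) (∫ a, g a ∂μ) :=
  hasSum_integral_of_abs_le_step h.meas_endpoint (h.integrable_abs hδ) h.meas h.abs_le hg

lemma summable_abs (h : SiteWeight μ X k F V δ K) (hδ : 0 < δ) :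
    Summable fun m => ∫ a, |F m a| ∂μ :=
  Summable.of_nonneg_of_le (fun m => integral_nonneg fun _ => abs_nonneg _)
    (fun m => integral_mono (h.integrable m).abs
      (integrable_abs_step_sub h.meas_endpoint k m) (h.abs_le m))
    (summable_integral_abs_step_sub h.meas_endpoint (h.integrable_abs hδ))

lemma tsum_abs_le (h : SiteWeight μ X k F V δ K) (hδ : 0 < δ) :
    ∑' m, ∫ a, |F m a| ∂μ ≤ ∫ a, |(X a : ℝ) - k| ∂μ := by
  refine le_trans ((h.summable_abs hδ).tsum_le_tsum (fun m => ?_)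
    (summable_integral_abs_step_sub h.meas_endpoint (h.integrable_abs hδ)))
    (tsum_integral_abs_step_sub_le h.meas_endpoint (h.integrable_abs hδ))
  exact integral_mono (h.integrable m).abs
      (integrable_abs_step_sub h.meas_endpoint k m) (h.abs_le m)

lemma of_step (hX : Measurable X) (h : MgfBound μ (fun a => (X a : ℝ) - k) δ K) :
    SiteWeight μ X k (fun m a => step (X a) m - step k m) 2 δ K where
  meas_endpoint := hX
  meas m := (measurable_step_comp hX m).sub_const _
  abs_le _ _ := le_rfl
  variation a s := by
    have h1 := sum_abs_step_succ_sub_le (X a) s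
    have h2 := sum_abs_step_succ_sub_le k s
    calc _ ≤ ∑ m ∈ s, (|step (X a) (m + 1) - step (X a) m| + |step k (m + 1) - step k m|) := by
          refine Finset.sum_le_sum fun m _ => ?_
          rw [sub_sub_sub_comm]
          exact abs_sub _ _
      _ ≤ 2 := by rw [Finset.sum_add_distrib]; linarith
  mgf := h

/-- Both factors are at most one in absolute value, so the variations add by the discrete product
rule, while the first factor alone controls support and concentration. Covariances use these
products. -/
lemma mul {X' : α → ℤ} {k' : ℤ} {F' : ℤ → α → ℝ} {V' δ' K' : ℝ} (h : SiteWeight μ X k F V δ K)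
    (h' : SiteWeight μ X' k' F' V' δ' K') :
    SiteWeight μ X k (fun m a => F m a * F' m a) (V + V') δ K where
  meas_endpoint := h.meas_endpoint
  meas m := (h.meas m).mul (h'.meas m)
  abs_le m a := by
    rw [abs_mul]
    exact (mul_le_of_le_one_right (abs_nonneg _) (h'.abs_le_one m a)).trans (h.abs_le m a)
  variation a s := by
    refine le_trans ?_ (add_le_add (h.variation a s) (h'.variation a s))
    rw [← Finset.sum_add_distrib]
    refine Finset.sum_le_sum fun m _ => ?_
    have e : F (m + 1) a * F' (m + 1) a - F m a * F' m a
      = (F (m + 1) a - F m a) * F' (m + 1) a + F m a * (F' (m + 1) a - F' m a) := by ring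
    rw [e]
    refine (abs_add_le _ _).trans (add_le_add ?_ ?_)
    · rw [abs_mul]
      exact mul_le_of_le_one_right (abs_nonneg _) (h'.abs_le_one _ a)
    · rw [abs_mul]
      exact mul_le_of_le_one_left (abs_nonneg _) (h.abs_le_one _ a)
  mgf := h.mgf

end SiteWeight

end SiteWeight

/-! ### Choice of scales and replacement of block averages by their limits -/

/-- Makes two exponents admissible in `MgfBound`: `2√(log n / n)` for the tails and `1 / √n` for
first moments. -/
lemma eventually_log_pnat {δ : ℝ} (hδ : 0 < δ) : ∀ᶠ n : ℕ+ in atTop,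
    1 ≤ Real.log (n : ℝ) ∧ 2 * √(Real.log (n : ℝ) / (n : ℝ)) ≤ δ ∧ 1 / √(n : ℝ) ≤ δ := by
  have h1 : ∀ᶠ x : ℝ in atTop, 1 ≤ Real.log x := Real.tendsto_log_atTop.eventually_ge_atTop 1
  have h2 : Tendsto (fun x : ℝ => 2 * √(Real.log x / x)) atTop (𝓝 (2 * √0)) := by
    refine (Real.continuous_sqrt.tendsto _).comp ?_ |>.const_mul 2
    exact Real.isLittleO_log_id_atTop.tendsto_div_nhds_zero
  have h3 : Tendsto (fun x : ℝ => 1 / √x) atTop (𝓝 0) := by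
    simp only [one_div]
    exact tendsto_inv_atTop_zero.comp Real.tendsto_sqrt_atTop
  rw [Real.sqrt_zero, mul_zero] at h2
  have := h1.and ((h2.eventually_le_const hδ).and (h3.eventually_le_const hδ))
  exact tendsto_pnat_cast.eventually this

/-- The exponent is `θ = √(log n / n)` and the cutoff is `M = (S + 4K + 4) √(n log n)`, so that `θ M
= (S + 4K + 4) log n`. The shares `S` and `4K` absorb the position of the line and the sub-Gaussian
factor at `2θ`. The remaining `4 log n` covers the term `3θ ≤ 3 log n` and leaves `exp(-log n)`,
which offsets the prefactor `1 / θ ≤ n`. -/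
lemma tail_bound {n S K κ : ℝ} (hn : 0 < n) (hS : 0 ≤ S)
    (hlog : 1 ≤ Real.log n) (hκ : κ ≤ S * √n + 1) :
    Real.exp (√(Real.log n / n) * (κ - (S + 4 * K + 4) * √(n * Real.log n))) / √(Real.log n / n)
      * (2 * Real.exp (K * n * (2 * √(Real.log n / n)) ^ 2 + 2 * √(Real.log n / n))) ≤ 2 := by
  set l := Real.log n
  set θ := √(l / n)
  have hl : 0 < l := by linarith
  have hθ : 0 < θ := Real.sqrt_pos.2 (by positivity)
  have e1 : θ * √(n * l) = l := by
    rw [← Real.sqrt_mul (by positivity), show l / n * (n * l) = l ^ 2 by field_simp,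
      Real.sqrt_sq hl.le]
  have e2 : θ * √n ≤ l := by
    rw [← Real.sqrt_mul (by positivity), show l / n * n = l by field_simp,
      Real.sqrt_le_left (by linarith)]
    nlinarith
  have e3 : θ ^ 2 = l / n := Real.sq_sqrt (by positivity)
  have hln : l ≤ n := by linarith [Real.log_le_sub_one_of_pos hn]
  have e4 : θ ≤ 1 := by
    rw [← Real.sqrt_one]
    exact Real.sqrt_le_sqrt ((div_le_one hn).2 hln)
  have e5 : 1 / θ ≤ Real.exp l := by
    rw [Real.exp_log hn, div_le_iff₀ hθ]
    have : 1 ≤ n := by linarith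
    have h1 : 1 ≤ n * θ ^ 2 := by rw [e3]; field_simp; exact hlog
    nlinarith
  have e6 : θ * (κ - (S + 4 * K + 4) * √(n * l)) + (K * n * (2 * θ) ^ 2 + 2 * θ) ≤ -l := by
    have h1 : θ * κ ≤ S * l + θ := by
      calc θ * κ ≤ θ * (S * √n + 1) := by gcongr
        _ = S * (θ * √n) + θ := by ring
        _ ≤ _ := by gcongr
    have h2 : K * n * (2 * θ) ^ 2 = 4 * K * l := by
      rw [mul_pow, e3]
      field_simp
      ring
    rw [h2, mul_sub, show θ * ((S + 4 * K + 4) * √(n * l)) = (S + 4 * K + 4) * (θ * √(n * l)) by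
      ring, e1]
    linarith
  calc _ = 2 * (1 / θ) * Real.exp (θ * (κ - (S + 4 * K + 4) * √(n * l))
        + (K * n * (2 * θ) ^ 2 + 2 * θ)) := by
        rw [Real.exp_add (θ * _)]
        ring
    _ ≤ 2 * Real.exp l * Real.exp (-l) := by gcongr
    _ = 2 := by rw [mul_assoc, ← Real.exp_add, add_neg_cancel, Real.exp_zero, mul_one]

lemma SiteWeight.integral_abs_sub_le {α : Type*} [MeasurableSpace α] {μ : Measure α}
    [IsProbabilityMeasure μ] {X : α → ℤ} {k : ℤ} {F : ℤ → α → ℝ} {V δ K : ℝ} {n : ℝ} (hn : 1 ≤ n)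
    (hδ : 1 / √n ≤ δ) (h : SiteWeight μ X k F V δ (K * n)) :
    ∫ a, |(X a : ℝ) - k| ∂μ ≤ 2 * Real.exp (K + 1) * √n := by
  have hn0 : 0 < √n := Real.sqrt_pos.2 (by linarith)
  have hn1 : 1 / √n ≤ 1 := by
    rw [div_le_one hn0]
    exact Real.one_le_sqrt.2 hn
  refine (h.mgf.abs h.measurable_sub (by positivity) hδ).2.trans ?_
  -- At the diffusive exponent `1 / √n` the sub-Gaussian bound no longer depends on `n`.
  have e : K * n * (1 / √n) ^ 2 = K := by
    rw [div_pow, Real.sq_sqrt (by linarith)]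
    field_simp
  rw [e, one_div_one_div, mul_comm]
  gcongr

/-- Weighted sums of a sequence with converging block averages. -/
lemma BlockAveragesTendsto.tendsto_tsum_mul {a : ℕ+ → ℤ → ℝ} {a₀ : ℝ}
    (ha : BlockAveragesTendsto a a₀) {B : ℝ} (hB : ∀ n m, |a n m| ≤ B)
    {α : ℕ+ → Type*} [∀ n, MeasurableSpace (α n)] {μ : ∀ n, Measure (α n)}
    [∀ n, IsProbabilityMeasure (μ n)] {X : ∀ n, α n → ℤ} {k : ℕ+ → ℤ} {F : ∀ n, ℤ → α n → ℝ}
    {V δ K S : ℝ} (hδ : 0 < δ) (hS : 0 ≤ S)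
    (hk : ∀ n : ℕ+, |(k n : ℝ)| ≤ S * √(n : ℝ) + 1)
    (hF : ∀ n : ℕ+, SiteWeight (μ n) (X n) (k n) (F n) V δ (K * (n : ℝ))) :
    Tendsto (fun n : ℕ+ => (n : ℝ) ^ (-(1 / 4) : ℝ) *
      (∑' m, a n m * ∫ x, F n m x ∂(μ n) - a₀ * ∑' m, ∫ x, F n m x ∂(μ n))) atTop (𝓝 0) := by
  obtain ⟨L, hL, hL0, hav⟩ := ha
  set C := 2 * Real.exp (K + 1)
  have hC : 0 < C := by positivity
  have hV : 0 ≤ V := by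
    obtain ⟨x⟩ : Nonempty (α 1) := nonempty_of_isProbabilityMeasure (μ 1)
    simpa using (hF 1).variation x ∅
  have hlim : Tendsto (fun n : ℕ+ => (n : ℝ) ^ (-(1 / 4) : ℝ) * ((B + |a₀|) * 2)
      + B * V * ((n : ℝ) ^ (-(1 / 4) : ℝ) * (L n : ℝ))) atTop (𝓝 0) := by
    have h1 : Tendsto (fun n : ℕ+ => (n : ℝ) ^ (-(1 / 4) : ℝ)) atTop (𝓝 0) :=
      (tendsto_rpow_neg_atTop (by norm_num)).comp tendsto_pnat_cast
    simpa using (h1.mul_const ((B + |a₀|) * 2)).add (hL0.const_mul (B * V))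
  rw [Metric.tendsto_nhds]
  intro ε hε
  -- The total weight is at most `C √n` and the block error is `ε / (2C) · n^{-1/4}`, so their
  -- product times `n^{-1/4}` is `ε / 2`. The tail and smoothing errors form the sequence in `hlim`.
  filter_upwards [hav (S + 4 * K + 4) (ε / (2 * C)) (by positivity), eventually_log_pnat hδ,
    hlim.eventually_lt_const (show (0 : ℝ) < ε / 2 by positivity)] with n h1 h2 h3
  obtain ⟨hlog, hδ1, hδ2⟩ := h2
  have hn : (1 : ℝ) ≤ (n : ℝ) := by exact_mod_cast one_le (a := n)
  have hn0 : (0 : ℝ) < (n : ℝ) := by linarith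
  have hx : 0 < (n : ℝ) ^ (1 / 4 : ℝ) := Real.rpow_pos_of_pos hn0 _
  have hxn : (n : ℝ) ^ (-(1 / 4) : ℝ) = ((n : ℝ) ^ (1 / 4 : ℝ))⁻¹ := Real.rpow_neg hn0.le _
  have hxs : √(n : ℝ) = ((n : ℝ) ^ (1 / 4 : ℝ)) ^ 2 := by
    rw [Real.sqrt_eq_rpow, ← Real.rpow_natCast, ← Real.rpow_mul hn0.le]
    norm_num
  rw [hxn] at h3 ⊢
  have hθ : 0 < √(Real.log (n : ℝ) / (n : ℝ)) := Real.sqrt_pos.2 (by positivity)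
  have hexp := (hF n).mgf.exp_abs (hF n).measurable_sub (by positivity) hδ1
  have key := abs_tsum_mul_sub_le (w := fun m => ∫ x, F n m x ∂(μ n))
    (u := fun m => ∫ x, |step (X n x) m - step (k n) m| ∂(μ n)) (a := a n) (a₀ := a₀) (B := B)
    (V := V) (M := (S + 4 * K + 4) * √((n : ℝ) * Real.log (n : ℝ))) (τ := 2)
    (ε := ε / (2 * C) / (n : ℝ) ^ (1 / 4 : ℝ)) (hL n)
    (abs_integral_le_of_abs_le_step (hF n).meas_endpoint (hF n).abs_le)
    (summable_integral_abs_step_sub (hF n).meas_endpoint ((hF n).integrable_abs hδ)) (hB n)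
    (sum_abs_integral_succ_sub_le (hF n).meas_endpoint (hF n).meas (hF n).abs_le (hF n).variation)
    (fun s hs => by
      refine (sum_tail_integral_abs_step_sub_le (hF n).meas_endpoint hθ hexp.1 hs).trans ?_
      refine le_trans ?_ (tail_bound (K := K) hn0 hS hlog (hk n))
      exact mul_le_mul_of_nonneg_left hexp.2 (by positivity))
    (by positivity)
    (fun m hm => by
      rw [le_div_iff₀' hx]
      exact h1 m hm)
  have hu : ∑' m, ∫ x, |step (X n x) m - step (k n) m| ∂(μ n)
      ≤ C * ((n : ℝ) ^ (1 / 4 : ℝ)) ^ 2 := by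
    rw [← hxs]
    exact (tsum_integral_abs_step_sub_le (hF n).meas_endpoint ((hF n).integrable_abs hδ)).trans
      ((hF n).integral_abs_sub_le hn hδ2)
  rw [Real.dist_eq, sub_zero, abs_mul, abs_of_pos (inv_pos.2 hx)]
  set x := (n : ℝ) ^ (1 / 4 : ℝ)
  calc _ ≤ x⁻¹ * (ε / (2 * C) / x * (C * x ^ 2) + (B + |a₀|) * 2 + B * L n * V) := by
        refine mul_le_mul_of_nonneg_left (key.trans ?_) (by positivity)
        gcongr
    _ = ε / 2 + (x⁻¹ * ((B + |a₀|) * 2) + B * V * (x⁻¹ * L n)) := by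
        field_simp
        ring
    _ < ε := by linarith

/-! ### Displacements of random walks -/

section Displacement

variable {Ω : Type*} [MeasurableSpace Ω] {P : Measure Ω} {m : ℤ} {X : ℝ≥0 → Ω → ℤ}

/-- The displacement of a walk at time `t`. -/
def displacement (X : ℝ≥0 → Ω → ℤ) (t : ℝ≥0) (ω : Ω) : ℤ := X t ω - X 0 ω

namespace IsRandomWalk

lemma measurable_displacement (h : IsRandomWalk P p m X) (t : ℝ≥0) :
    Measurable (displacement X t) :=
  (h.measurable t).sub (h.measurable 0)

lemma hasLaw_displacement (h : IsRandomWalk P p m X) (t : ℝ≥0) :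
    HasLaw (displacement X t) (compoundPoisson p t) P := by
  have := h.law_increments 0 t zero_le
  rwa [tsub_zero] at this

lemma hasLaw_displacement_sub (h : IsRandomWalk P p m X) {s t : ℝ≥0} (hst : s ≤ t) :
    HasLaw (fun ω => displacement X t ω - displacement X s ω) (compoundPoisson p (t - s)) P := by
  have := h.law_increments s t hst
  simpa only [displacement, sub_sub_sub_cancel_right] using this

lemma hasLaw_displacement_prod [IsProbabilityMeasure P] (h : IsRandomWalk P p m X) {s t : ℝ≥0}
    (hst : s ≤ t) : HasLaw (fun ω => (displacement X s ω, displacement X t ω))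
      (((compoundPoisson p s).prod (compoundPoisson p (t - s))).map fun z => (z.1, z.1 + z.2))
      P := by
  -- The joint law at two times is determined by the independent increments over `[0, s]` and `[s,
  -- t]`. This is what makes two-time expectations the same for all walks.
  have hi : IndepFun (displacement X s) (fun ω => X t ω - X s ω) P :=
    h.indep_increments.indepFun_sub_sub zero_le hst
  have h1 : HasLaw (fun ω => (displacement X s ω, X t ω - X s ω))
      ((compoundPoisson p s).prod (compoundPoisson p (t - s))) P := by
    refine ⟨((h.measurable_displacement s).prodMk
      ((h.measurable t).sub (h.measurable s))).aemeasurable, ?_⟩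
    refine ((indepFun_iff_map_prod_eq_prod_map_map (h.measurable_displacement s).aemeasurable
      ((h.measurable t).sub (h.measurable s)).aemeasurable).1 hi).trans ?_
    rw [show (X t - X s) = fun ω => X t ω - X s ω from rfl, (h.hasLaw_displacement s).map_eq, (h.law_increments s t hst).map_eq]
  have h2 : (fun ω => (displacement X s ω, displacement X t ω))
      = (fun z : ℤ × ℤ => (z.1, z.1 + z.2)) ∘ fun ω => (displacement X s ω, X t ω - X s ω) := by
    ext ω <;> simp [displacement]
  rw [h2]
  refine ⟨(measurable_of_countable _).comp_aemeasurable h1.aemeasurable, ?_⟩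
  rw [← h1.map_eq, AEMeasurable.map_map_of_aemeasurable (measurable_of_countable _).aemeasurable
    h1.aemeasurable]

/-- Expectations of functions of the displacements at two times are the same for all walks. -/
lemma integral_displacement_eq [IsProbabilityMeasure P] (h : IsRandomWalk P p m X)
    {Ω' : Type*} [MeasurableSpace Ω'] {P' : Measure Ω'} [IsProbabilityMeasure P'] {m' : ℤ}
    {X' : ℝ≥0 → Ω' → ℤ} (h' : IsRandomWalk P' p m' X') (s t : ℝ≥0) (f : ℤ → ℤ → ℝ) :
    ∫ ω, f (displacement X s ω) (displacement X t ω) ∂P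
      = ∫ ω, f (displacement X' s ω) (displacement X' t ω) ∂P' := by
  have key : ∀ {s t : ℝ≥0}, s ≤ t → ∀ f : ℤ → ℤ → ℝ,
      ∫ ω, f (displacement X s ω) (displacement X t ω) ∂P
        = ∫ ω, f (displacement X' s ω) (displacement X' t ω) ∂P' := fun hst f => by
    have e1 := (h.hasLaw_displacement_prod hst).integral_comp (f := fun z : ℤ × ℤ => f z.1 z.2)
      .of_discrete
    have e2 := (h'.hasLaw_displacement_prod hst).integral_comp (f := fun z : ℤ × ℤ => f z.1 z.2)
      .of_discrete
    exact e1.trans e2.symm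
  rcases le_total s t with hst | hst
  · exact key hst f
  · exact key hst fun x y => f y x

end IsRandomWalk

end Displacement

/-! ### Crossings of the characteristic line -/

/-- The contribution to the current at `a = (t, r)` of a particle that starts at `m` and whose
displacement at time `n t` is `d`. -/
def crossing (v : ℝ) (n : ℕ+) (a : ℝ≥0 × ℝ) (d m : ℤ) : ℝ :=
  step (⌊(n : ℝ) * v * (a.1 : ℝ)⌋ + ⌊a.2 * √(n : ℝ)⌋ - d) m - step ⌊a.2 * √(n : ℝ)⌋ m

lemma abs_crossing_le_one (v : ℝ) (n : ℕ+) (a : ℝ≥0 × ℝ) (d m : ℤ) : |crossing v n a d m| ≤ 1 :=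
  abs_step_sub_le_one _ _ _

/-- The moment generating functions of the centered compound Poisson distributions are
sub-Gaussian near zero. -/
def CompoundPoissonMgf (p : PMF ℤ) (δ K : ℝ) : Prop :=
  ∀ (lam : ℝ≥0) (θ : ℝ), |θ| ≤ δ →
    Integrable (fun x : ℤ => Real.exp (θ * (x - lam * drift p))) (compoundPoisson p lam) ∧
    ∫ x : ℤ, Real.exp (θ * (x - lam * drift p)) ∂(compoundPoisson p lam)
      ≤ Real.exp (K * lam * θ ^ 2)

/-- The endpoint minus `⌊r√n⌋` is minus the centered displacement, plus the rounding error of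
`⌊nvt⌋`. Hence the exponent changes sign, and the rounding error, at most one, produces the term
`|θ|` in `MgfBound`. -/
lemma CompoundPoissonMgf.siteWeight_crossing {δ K : ℝ} (h : CompoundPoissonMgf p δ K) (hK : 0 ≤ K)
    {n : ℕ+} {a : ℝ≥0 × ℝ} {T : ℝ≥0} (hT : a.1 ≤ T) {α : Type*} [MeasurableSpace α]
    {μ : Measure α} [IsProbabilityMeasure μ] {D : α → ℤ} (hD : Measurable D)
    (hlaw : HasLaw D (compoundPoisson p (n * a.1)) μ) :
    SiteWeight μ (fun x => ⌊(n : ℝ) * drift p * (a.1 : ℝ)⌋ + ⌊a.2 * √(n : ℝ)⌋ - D x)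
      ⌊a.2 * √(n : ℝ)⌋ (fun m x => crossing (drift p) n a (D x) m) 2 δ (K * T * (n : ℝ)) := by
  refine SiteWeight.of_step (hD.const_sub _) fun θ hθ => ?_
  obtain ⟨h1, h2⟩ := h (n * a.1) (-θ) (by rwa [abs_neg])
  set b := ⌊(n : ℝ) * drift p * (a.1 : ℝ)⌋
  have hb1 : (b : ℝ) ≤ (n : ℝ) * drift p * (a.1 : ℝ) := Int.floor_le _
  have hb2 : (n : ℝ) * drift p * (a.1 : ℝ) < b + 1 := Int.lt_floor_add_one _
  have e : ∀ x, Real.exp (θ * (((b + ⌊a.2 * √(n : ℝ)⌋ - D x : ℤ) : ℝ) - ⌊a.2 * √(n : ℝ)⌋))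
      = Real.exp (θ * (b - (n : ℝ) * drift p * (a.1 : ℝ)))
        * Real.exp (-θ * (D x - ((n * a.1 : ℝ≥0) : ℝ) * drift p)) := fun x => by
    rw [← Real.exp_add]
    push_cast
    congr 1
    ring
  simp only [e]
  have i1 := (hlaw.measurePreserving hD).integrable_comp_of_integrable h1
  have i2 := hlaw.integral_comp
    (f := fun x : ℤ => Real.exp (-θ * (x - ((n * a.1 : ℝ≥0) : ℝ) * drift p))) .of_discrete
  refine ⟨i1.const_mul _, ?_⟩
  rw [integral_const_mul, add_comm, Real.exp_add]
  refine mul_le_mul (Real.exp_le_exp.2 ?_) ((i2.trans_le h2).trans (Real.exp_le_exp.2 ?_))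
    (integral_nonneg fun _ => (Real.exp_pos _).le) (Real.exp_pos _).le
  · have : |θ * (b - (n : ℝ) * drift p * (a.1 : ℝ))| ≤ |θ| := by
      rw [abs_mul]
      exact mul_le_of_le_one_right (abs_nonneg _) (abs_le.2 ⟨by linarith, by linarith⟩)
    exact (le_abs_self _).trans this
  · rw [neg_sq]
    push_cast
    have : (a.1 : ℝ) ≤ T := by exact_mod_cast hT
    have : K * ((n : ℝ) * a.1) ≤ K * T * (n : ℝ) := by
      rw [mul_assoc, mul_comm (T : ℝ)]
      gcongr
    gcongr

/-! ### Asymptotics of expected crossings -/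

lemma tendsto_div_sqrt_of_abs_sub_le {c : ℕ+ → ℝ} {x C : ℝ} (h : ∀ n : ℕ+, |c n - x * √(n : ℝ)| ≤ C) :
    Tendsto (fun n : ℕ+ => c n / √(n : ℝ)) atTop (𝓝 x) := by
  have hs : Tendsto (fun n : ℕ+ => √(n : ℝ)) atTop atTop :=
    Real.tendsto_sqrt_atTop.comp tendsto_pnat_cast
  rw [tendsto_iff_norm_sub_tendsto_zero]
  refine squeeze_zero (fun _ => norm_nonneg _) (fun n => ?_) (hs.const_div_atTop C)
  have hn : 0 < √(n : ℝ) := Real.sqrt_pos.2 (by exact_mod_cast n.pos)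
  rw [Real.norm_eq_abs, div_sub' hn.ne', abs_div, abs_of_pos hn, mul_comm]
  gcongr
  exact h n

/-- The case in which the second of two independent walks has run for time zero. -/
lemma HasExpMoments.tendsto_integral_abs_of_hasLaw (hp : HasExpMoments p) {t : ℝ≥0}
    {Ω : ℕ+ → Type*} [∀ n, MeasurableSpace (Ω n)] {P : ∀ n, Measure (Ω n)}
    {D : ∀ n, Ω n → ℤ} (hD : ∀ n : ℕ+, HasLaw (D n) (compoundPoisson p (n * t)) (P n))
    {c : ℕ+ → ℤ} {x C : ℝ}
    (hc : ∀ n : ℕ+, |(c n : ℝ) + n * t * drift p - x * √(n : ℝ)| ≤ C) :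
    Tendsto (fun n : ℕ+ => (∫ ω, |(D n ω : ℝ) + c n| ∂(P n)) / √(n : ℝ)) atTop
      (𝓝 (2 * Psi (kappa2 p * t) |x| + |x|)) := by
  have h := hp.tendsto_integral_abs t 0 (c := c) (x := x)
    (tendsto_div_sqrt_of_abs_sub_le (C := C) fun n => by simpa using hc n)
  rw [NNReal.coe_zero, add_zero] at h
  refine h.congr fun n => ?_
  have e := (hD n).integral_comp (f := fun x : ℤ => |(x : ℝ) + c n|) .of_discrete
  simp only [Function.comp_def] at e
  rw [e, mul_zero, compoundPoisson_zero, Measure.prod_dirac,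
    integral_map (by fun_prop) .of_discrete]
  simp

lemma integral_add_sub_sub_const {α : Type*} [MeasurableSpace α] {μ : Measure α}
    [IsProbabilityMeasure μ] {f g h : α → ℝ} (hf : Integrable f μ) (hg : Integrable g μ)
    (hh : Integrable h μ) (c : ℝ) :
    ∫ x, f x ∂μ + ∫ x, g x ∂μ - ∫ x, h x ∂μ - c = ∫ x, (f x + g x - h x - c) ∂μ := by
  have h1 : Integrable (fun x => f x + g x) μ := hf.add hg
  have h2 : Integrable (fun x => f x + g x - h x) μ := h1.sub hh
  rw [integral_sub h2 (integrable_const c), integral_sub h1 hh, integral_add hf hg]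
  simp

section Asymptotics

variable {Ω : ℕ+ → Type*} [∀ n, MeasurableSpace (Ω n)] {P : ∀ n, Measure (Ω n)}
  [∀ n, IsProbabilityMeasure (P n)] {D E : ∀ n, Ω n → ℤ} {a : ℕ+ → ℤ → ℝ} {a₀ B : ℝ}
  {s t : ℝ≥0 × ℝ}

lemma abs_floor_mul_sqrt_le (r : ℝ) (n : ℕ+) : |(⌊r * √(n : ℝ)⌋ : ℝ)| ≤ |r| * √(n : ℝ) + 1 := by
  have h1 := Int.floor_le (r * √(n : ℝ))
  have h2 := Int.lt_floor_add_one (r * √(n : ℝ))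
  have h3 : |r * √(n : ℝ)| = |r| * √(n : ℝ) := by rw [abs_mul, abs_of_nonneg (Real.sqrt_nonneg _)]
  have h4 := le_abs_self (r * √(n : ℝ))
  have h5 := neg_abs_le (r * √(n : ℝ))
  rw [abs_le]
  constructor <;> linarith

/-- The expected current has smaller order than `n ^ (1 / 4)`. -/
lemma HasExpMoments.tendsto_tsum_mul_integral_crossing (hp : HasExpMoments p)
    (ha : BlockAveragesTendsto a a₀) (hB : ∀ n m, |a n m| ≤ B) (hD : ∀ n, Measurable (D n))
    (hDl : ∀ n : ℕ+, HasLaw (D n) (compoundPoisson p (n * s.1)) (P n)) :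
    Tendsto (fun n : ℕ+ => (n : ℝ) ^ (-(1 / 4) : ℝ) *
      ∑' m, a n m * ∫ ω, crossing (drift p) n s (D n ω) m ∂(P n)) atTop (𝓝 0) := by
  obtain ⟨δ, K, hδ, hK, h⟩ := hp.exists_mgf_le
  have hw := fun n => CompoundPoissonMgf.siteWeight_crossing h hK (le_refl s.1) (hD n) (hDl n)
  have h1 := ha.tendsto_tsum_mul hB (S := |s.2|) hδ (abs_nonneg _)
    (abs_floor_mul_sqrt_le s.2) hw
  -- Summed over all sites, the crossings give the difference of the endpoints. Its mean is `⌊nvt⌋ -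
  -- nvt`, since the line moves at the speed of the walks.
  have h2 : ∀ n : ℕ+, |∑' m, ∫ ω, crossing (drift p) n s (D n ω) m ∂(P n)| ≤ 1 := fun n => by
    rw [((hw n).hasSum_integral hδ fun ω => hasSum_step_sub _ _).tsum_eq]
    have hi : Integrable (fun ω => (D n ω : ℝ)) (P n) :=
      ((hDl n).measurePreserving (hD n)).integrable_comp_of_integrable
        (hp.integrable_id_compoundPoisson (n * s.1))
    have e : ∫ ω, (D n ω : ℝ) ∂(P n) = ((n * s.1 : ℝ≥0) : ℝ) * drift p := by
      rw [← hp.integral_compoundPoisson]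
      exact (hDl n).integral_comp (f := fun x : ℤ => (x : ℝ)) .of_discrete
    have e2 : ∀ ω, (((⌊(n : ℝ) * drift p * (s.1 : ℝ)⌋ + ⌊s.2 * √(n : ℝ)⌋ - D n ω : ℤ) : ℝ)
        - ⌊s.2 * √(n : ℝ)⌋) = ⌊(n : ℝ) * drift p * (s.1 : ℝ)⌋ - D n ω := fun ω => by
      push_cast
      ring
    simp only [e2]
    rw [integral_sub (integrable_const _) hi, e]
    have f1 := Int.floor_le ((n : ℝ) * drift p * (s.1 : ℝ))
    have f2 := Int.lt_floor_add_one ((n : ℝ) * drift p * (s.1 : ℝ))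
    simp only [integral_const, probReal_univ, one_smul]
    push_cast
    rw [abs_le]
    constructor <;> linarith
  have h3 : Tendsto (fun n : ℕ+ => (n : ℝ) ^ (-(1 / 4) : ℝ)) atTop (𝓝 0) :=
    (tendsto_rpow_neg_atTop (by norm_num)).comp tendsto_pnat_cast
  have h4 : Tendsto (fun n : ℕ+ => (n : ℝ) ^ (-(1 / 4) : ℝ) *
      (a₀ * ∑' m, ∫ ω, crossing (drift p) n s (D n ω) m ∂(P n))) atTop (𝓝 0) := by
    refine h3.zero_mul_isBoundedUnder_le (isBoundedUnder_of ⟨|a₀|, fun n => ?_⟩)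
    simp only [Function.comp_apply, Real.norm_eq_abs, abs_mul]
    exact mul_le_of_le_one_right (abs_nonneg _) (h2 n)
  have h5 := h1.add h4
  rw [add_zero] at h5
  refine h5.congr fun n => ?_
  ring

/-- After the coefficients are replaced by `a₀`, `hasSum_step_mul` leaves four absolute values: two
involve one displacement each, one the difference of the displacements, and one is deterministic.
The contributions `|q - r|` cancel and three values of `Ψ` remain. The joint law of `D` and `E`
matters only for the difference term, so it enters through `hdiff` alone. -/
lemma HasExpMoments.tendsto_tsum_mul_integral_crossing_mul (hp : HasExpMoments p)
    (ha : BlockAveragesTendsto a a₀) (hB : ∀ n m, |a n m| ≤ B)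
    (hD : ∀ n, Measurable (D n)) (hE : ∀ n, Measurable (E n))
    (hDl : ∀ n : ℕ+, HasLaw (D n) (compoundPoisson p (n * s.1)) (P n))
    (hEl : ∀ n : ℕ+, HasLaw (E n) (compoundPoisson p (n * t.1)) (P n)) {ψ : ℝ}
    (hdiff : Tendsto (fun n : ℕ+ => (∫ ω, |(E n ω : ℝ) - D n ω
      + (⌊(n : ℝ) * drift p * (s.1 : ℝ)⌋ + ⌊s.2 * √(n : ℝ)⌋ - ⌊(n : ℝ) * drift p * (t.1 : ℝ)⌋
        - ⌊t.2 * √(n : ℝ)⌋ : ℤ)| ∂(P n)) / √(n : ℝ)) atTop (𝓝 (2 * ψ + |s.2 - t.2|))) :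
    Tendsto (fun n : ℕ+ => (n : ℝ) ^ (-(1 / 2) : ℝ) * ∑' m, a n m *
      ∫ ω, crossing (drift p) n s (D n ω) m * crossing (drift p) n t (E n ω) m ∂(P n)) atTop
      (𝓝 (a₀ * (Psi (kappa2 p * s.1) |s.2 - t.2| + Psi (kappa2 p * t.1) |s.2 - t.2| - ψ))) := by
  obtain ⟨δ, K, hδ, hK, h⟩ := hp.exists_mgf_le
  have hw1 := fun n => CompoundPoissonMgf.siteWeight_crossing h hK (le_refl s.1) (hD n) (hDl n)
  have hw2 := fun n => CompoundPoissonMgf.siteWeight_crossing h hK (le_refl t.1) (hE n) (hEl n)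
  have hw := fun n => (hw1 n).mul (hw2 n)
  have h1 := ha.tendsto_tsum_mul hB (S := |s.2|) hδ (abs_nonneg _)
    (abs_floor_mul_sqrt_le s.2) hw
  have hfl := fun (x : ℝ) => And.intro (Int.floor_le x) (Int.lt_floor_add_one x)
  have l1 := hp.tendsto_integral_abs_of_hasLaw (t := s.1) hDl (x := t.2 - s.2) (C := 4)
    (c := fun n => ⌊t.2 * √(n : ℝ)⌋ - ⌊s.2 * √(n : ℝ)⌋ - ⌊(n : ℝ) * drift p * (s.1 : ℝ)⌋)
    fun n => by
      obtain ⟨a1, a2⟩ := hfl (t.2 * √(n : ℝ))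
      obtain ⟨b1, b2⟩ := hfl (s.2 * √(n : ℝ))
      obtain ⟨c1, c2⟩ := hfl ((n : ℝ) * drift p * (s.1 : ℝ))
      push_cast
      rw [abs_le]
      constructor <;> linarith
  have l2 := hp.tendsto_integral_abs_of_hasLaw (t := t.1) hEl (x := s.2 - t.2) (C := 4)
    (c := fun n => ⌊s.2 * √(n : ℝ)⌋ - ⌊t.2 * √(n : ℝ)⌋ - ⌊(n : ℝ) * drift p * (t.1 : ℝ)⌋)
    fun n => by
      obtain ⟨a1, a2⟩ := hfl (t.2 * √(n : ℝ))
      obtain ⟨b1, b2⟩ := hfl (s.2 * √(n : ℝ))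
      obtain ⟨c1, c2⟩ := hfl ((n : ℝ) * drift p * (t.1 : ℝ))
      push_cast
      rw [abs_le]
      constructor <;> linarith
  rw [abs_sub_comm t.2] at l1
  have l3 : Tendsto (fun n : ℕ+ => |(⌊s.2 * √(n : ℝ)⌋ : ℝ) - ⌊t.2 * √(n : ℝ)⌋| / √(n : ℝ)) atTop
      (𝓝 |s.2 - t.2|) := by
    have := (tendsto_div_sqrt_of_abs_sub_le (C := 4) (x := s.2 - t.2)
      (c := fun n : ℕ+ => (⌊s.2 * √(n : ℝ)⌋ : ℝ) - ⌊t.2 * √(n : ℝ)⌋) fun n => by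
        obtain ⟨a1, a2⟩ := hfl (t.2 * √(n : ℝ))
        obtain ⟨b1, b2⟩ := hfl (s.2 * √(n : ℝ))
        rw [abs_le]
        constructor <;> linarith).abs
    refine this.congr fun n => ?_
    rw [abs_div, abs_of_nonneg (Real.sqrt_nonneg _)]
  have hlim : Tendsto (fun n : ℕ+ => (∑' m, ∫ ω, crossing (drift p) n s (D n ω) m
      * crossing (drift p) n t (E n ω) m ∂(P n)) / √(n : ℝ)) atTop
      (𝓝 (Psi (kappa2 p * s.1) |s.2 - t.2| + Psi (kappa2 p * t.1) |s.2 - t.2| - ψ)) := by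
    have hl := (((l1.add l2).sub hdiff).sub l3).div_const 2
    have e : (2 * Psi (kappa2 p * s.1) |s.2 - t.2| + |s.2 - t.2| + (2 * Psi (kappa2 p * t.1)
        |s.2 - t.2| + |s.2 - t.2|) - (2 * ψ + |s.2 - t.2|) - |s.2 - t.2|) / 2
        = Psi (kappa2 p * s.1) |s.2 - t.2| + Psi (kappa2 p * t.1) |s.2 - t.2| - ψ := by ring
    rw [e] at hl
    refine hl.congr fun n => ?_
    have hi : ∀ {D : Ω n → ℤ} {lam : ℝ≥0}, Measurable D →
        HasLaw D (compoundPoisson p lam) (P n) → Integrable (fun ω => (D ω : ℝ)) (P n) :=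
      fun hD hl => (hl.measurePreserving hD).integrable_comp_of_integrable
        (hp.integrable_id_compoundPoisson _)
    have iD := hi (hD n) (hDl n)
    have iE := hi (hE n) (hEl n)
    rw [((hw n).hasSum_integral hδ fun ω => hasSum_step_mul _ _ _ _).tsum_eq, ← add_div,
      ← sub_div, ← sub_div, div_right_comm]
    congr 1
    rw [integral_div]
    congr 1
    have j1 := (iD.add (integrable_const ((⌊t.2 * √(n : ℝ)⌋ - ⌊s.2 * √(n : ℝ)⌋
      - ⌊(n : ℝ) * drift p * (s.1 : ℝ)⌋ : ℤ) : ℝ))).abs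
    have j2 := (iE.add (integrable_const ((⌊s.2 * √(n : ℝ)⌋ - ⌊t.2 * √(n : ℝ)⌋
      - ⌊(n : ℝ) * drift p * (t.1 : ℝ)⌋ : ℤ) : ℝ))).abs
    have j3 := ((iE.sub iD).add (integrable_const ((⌊(n : ℝ) * drift p * (s.1 : ℝ)⌋
      + ⌊s.2 * √(n : ℝ)⌋ - ⌊(n : ℝ) * drift p * (t.1 : ℝ)⌋ - ⌊t.2 * √(n : ℝ)⌋ : ℤ) : ℝ))).abs
    simp only [Pi.add_apply, Pi.sub_apply] at j1 j2 j3
    rw [integral_add_sub_sub_const j1 j2 j3]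
    refine integral_congr_ae (ae_of_all _ fun ω => ?_)
    simp only
    congr 1
    congr 1
    · congr 1
      · rw [← abs_neg]
        push_cast
        congr 1
        ring
      · rw [← abs_neg]
        push_cast
        congr 1
        ring
    · push_cast
      congr 1
      ring
  have h3 : Tendsto (fun n : ℕ+ => (n : ℝ) ^ (-(1 / 4) : ℝ)) atTop (𝓝 0) :=
    (tendsto_rpow_neg_atTop (by norm_num)).comp tendsto_pnat_cast
  have h4 := (h3.mul h1).add (hlim.const_mul a₀)
  rw [zero_mul, zero_add] at h4
  refine h4.congr fun n => ?_
  have hn : (0 : ℝ) < (n : ℝ) := by exact_mod_cast n.pos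
  have e1 : (n : ℝ) ^ (-(1 / 2) : ℝ) = (n : ℝ) ^ (-(1 / 4) : ℝ) * (n : ℝ) ^ (-(1 / 4) : ℝ) := by
    rw [← Real.rpow_add hn]
    norm_num
  have e2 : (√(n : ℝ))⁻¹ = (n : ℝ) ^ (-(1 / 4) : ℝ) * (n : ℝ) ^ (-(1 / 4) : ℝ) := by
    rw [← e1, Real.sqrt_eq_rpow, Real.rpow_neg hn.le]
  have e3 : ∀ y : ℝ, y / √(n : ℝ) = y * ((n : ℝ) ^ (-(1 / 4) : ℝ) * (n : ℝ) ^ (-(1 / 4) : ℝ)) :=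
    fun y => by rw [div_eq_mul_inv, e2]
  rw [e1, e3]
  ring

/-- Second moments of crossings of one particle at two times. -/
lemma HasExpMoments.tendsto_tsum_mul_integral_crossing_walk (hp : HasExpMoments p)
    (ha : BlockAveragesTendsto a a₀) (hB : ∀ n m, |a n m| ≤ B) {x : ℕ+ → ℤ}
    {W : ∀ n, ℝ≥0 → Ω n → ℤ} (hW : ∀ n, IsRandomWalk (P n) p (x n) (W n)) (s t : ℝ≥0 × ℝ) :
    Tendsto (fun n : ℕ+ => (n : ℝ) ^ (-(1 / 2) : ℝ) * ∑' m, a n m *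
      ∫ ω, crossing (drift p) n s (displacement (W n) (n * s.1) ω) m
        * crossing (drift p) n t (displacement (W n) (n * t.1) ω) m ∂(P n)) atTop
      (𝓝 (a₀ * (Psi (kappa2 p * s.1) |s.2 - t.2| + Psi (kappa2 p * t.1) |s.2 - t.2|
        - Psi (kappa2 p * |(t.1 : ℝ) - s.1|) |s.2 - t.2|))) := by
  have key : ∀ s t : ℝ≥0 × ℝ, s.1 ≤ t.1 →
      Tendsto (fun n : ℕ+ => (n : ℝ) ^ (-(1 / 2) : ℝ) * ∑' m, a n m *
      ∫ ω, crossing (drift p) n s (displacement (W n) (n * s.1) ω) m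
        * crossing (drift p) n t (displacement (W n) (n * t.1) ω) m ∂(P n)) atTop
      (𝓝 (a₀ * (Psi (kappa2 p * s.1) |s.2 - t.2| + Psi (kappa2 p * t.1) |s.2 - t.2|
        - Psi (kappa2 p * |(t.1 : ℝ) - s.1|) |s.2 - t.2|))) := by
    intro s t hst
    refine hp.tendsto_tsum_mul_integral_crossing_mul ha hB
      (fun n => (hW n).measurable_displacement _) (fun n => (hW n).measurable_displacement _)
      (fun n => (hW n).hasLaw_displacement _) (fun n => (hW n).hasLaw_displacement _) ?_
    -- For one walk the difference of displacements is an increment over time `n(t - s)`, whence the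
    -- variance `κ₂|t - s|`.
    have hl : ∀ n : ℕ+, HasLaw (fun ω => displacement (W n) (n * t.1) ω
        - displacement (W n) (n * s.1) ω) (compoundPoisson p (n * (t.1 - s.1))) (P n) := fun n => by
      rw [mul_tsub]
      exact (hW n).hasLaw_displacement_sub (by gcongr)
    have h := hp.tendsto_integral_abs_of_hasLaw hl (x := s.2 - t.2) (C := 4)
      (c := fun n => ⌊(n : ℝ) * drift p * (s.1 : ℝ)⌋ + ⌊s.2 * √(n : ℝ)⌋
        - ⌊(n : ℝ) * drift p * (t.1 : ℝ)⌋ - ⌊t.2 * √(n : ℝ)⌋) fun n => by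
      have a1 := Int.floor_le (t.2 * √(n : ℝ))
      have a2 := Int.lt_floor_add_one (t.2 * √(n : ℝ))
      have b1 := Int.floor_le (s.2 * √(n : ℝ))
      have b2 := Int.lt_floor_add_one (s.2 * √(n : ℝ))
      have c1 := Int.floor_le ((n : ℝ) * drift p * (s.1 : ℝ))
      have c2 := Int.lt_floor_add_one ((n : ℝ) * drift p * (s.1 : ℝ))
      have d1 := Int.floor_le ((n : ℝ) * drift p * (t.1 : ℝ))
      have d2 := Int.lt_floor_add_one ((n : ℝ) * drift p * (t.1 : ℝ))
      rw [NNReal.coe_sub hst]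
      push_cast
      rw [abs_le]
      constructor <;> linarith
    have hst' : (s.1 : ℝ) ≤ t.1 := by exact_mod_cast hst
    rw [NNReal.coe_sub hst] at h
    rw [abs_of_nonneg (sub_nonneg.2 hst')]
    refine h.congr fun n => ?_
    push_cast
    rfl
  rcases le_total s.1 t.1 with hst | hst
  · exact key s t hst
  · have h := key t s hst
    rw [abs_sub_comm t.2, abs_sub_comm (s.1 : ℝ), add_comm (Psi (kappa2 p * t.1) _)] at h
    refine h.congr fun n => ?_
    simp only [mul_comm (crossing (drift p) n t _ _)]

/-- Products of expected crossings at two times. -/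
lemma HasExpMoments.tendsto_tsum_mul_integral_crossing_mul_integral (hp : HasExpMoments p)
    (ha : BlockAveragesTendsto a a₀) (hB : ∀ n m, |a n m| ≤ B)
    (hD : ∀ n, Measurable (D n)) (hE : ∀ n, Measurable (E n))
    (hDl : ∀ n : ℕ+, HasLaw (D n) (compoundPoisson p (n * s.1)) (P n))
    (hEl : ∀ n : ℕ+, HasLaw (E n) (compoundPoisson p (n * t.1)) (P n)) :
    Tendsto (fun n : ℕ+ => (n : ℝ) ^ (-(1 / 2) : ℝ) * ∑' m, a n m *
      ((∫ ω, crossing (drift p) n s (D n ω) m ∂(P n))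
        * ∫ ω, crossing (drift p) n t (E n ω) m ∂(P n))) atTop
      (𝓝 (a₀ * (Psi (kappa2 p * s.1) |s.2 - t.2| + Psi (kappa2 p * t.1) |s.2 - t.2|
        - Psi (kappa2 p * ((t.1 : ℝ) + s.1)) |s.2 - t.2|))) := by
  -- A product of expectations is one expectation over two independent copies. Their displacements
  -- then differ with asymptotic variance `κ₂(t + s)`.
  have hDl' : ∀ n : ℕ+, HasLaw (fun ω : Ω n × Ω n => D n ω.1) (compoundPoisson p (n * s.1))
      ((P n).prod (P n)) := fun n => (hDl n).comp measurePreserving_fst.hasLaw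
  have hEl' : ∀ n : ℕ+, HasLaw (fun ω : Ω n × Ω n => E n ω.2) (compoundPoisson p (n * t.1))
      ((P n).prod (P n)) := fun n => (hEl n).comp measurePreserving_snd.hasLaw
  have h := hp.tendsto_tsum_mul_integral_crossing_mul ha hB (s := s) (t := t)
    (fun n => (hD n).comp measurable_fst) (fun n => (hE n).comp measurable_snd) hDl' hEl'
    (ψ := Psi (kappa2 p * ((t.1 : ℝ) + s.1)) |s.2 - t.2|) ?_
  · refine h.congr fun n => ?_
    congr 1
    refine tsum_congr fun m => ?_
    congr 1
    exact integral_prod_mul (fun ω => crossing (drift p) n s (D n ω) m)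
      (fun ω => crossing (drift p) n t (E n ω) m)
  · have h := hp.tendsto_integral_abs t.1 s.1 (x := s.2 - t.2)
      (c := fun n => ⌊(n : ℝ) * drift p * (s.1 : ℝ)⌋ + ⌊s.2 * √(n : ℝ)⌋
        - ⌊(n : ℝ) * drift p * (t.1 : ℝ)⌋ - ⌊t.2 * √(n : ℝ)⌋)
      (tendsto_div_sqrt_of_abs_sub_le (C := 4) fun n => by
        have a1 := Int.floor_le (t.2 * √(n : ℝ))
        have a2 := Int.lt_floor_add_one (t.2 * √(n : ℝ))
        have b1 := Int.floor_le (s.2 * √(n : ℝ))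
        have b2 := Int.lt_floor_add_one (s.2 * √(n : ℝ))
        have c1 := Int.floor_le ((n : ℝ) * drift p * (s.1 : ℝ))
        have c2 := Int.lt_floor_add_one ((n : ℝ) * drift p * (s.1 : ℝ))
        have d1 := Int.floor_le ((n : ℝ) * drift p * (t.1 : ℝ))
        have d2 := Int.lt_floor_add_one ((n : ℝ) * drift p * (t.1 : ℝ))
        push_cast
        rw [abs_le]
        constructor <;> linarith)
    refine h.congr fun n => ?_
    congr 1
    have hl : HasLaw (fun ω : Ω n × Ω n => (E n ω.2, D n ω.1))
        ((compoundPoisson p (n * t.1)).prod (compoundPoisson p (n * s.1)))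
        ((P n).prod (P n)) := by
      refine ⟨(((hE n).comp measurable_snd).prodMk ((hD n).comp measurable_fst)).aemeasurable, ?_⟩
      have e : (fun ω : Ω n × Ω n => (E n ω.2, D n ω.1))
          = Prod.map (E n) (D n) ∘ Prod.swap := rfl
      rw [e, ← Measure.map_map ((hE n).prodMap (hD n)) measurable_swap, Measure.prod_swap,
        ← Measure.map_prod_map _ _ (hE n) (hD n), (hEl n).map_eq, (hDl n).map_eq]
    exact (hl.integral_comp (f := fun z : ℤ × ℤ => |(z.1 : ℝ) - z.2
      + (⌊(n : ℝ) * drift p * (s.1 : ℝ)⌋ + ⌊s.2 * √(n : ℝ)⌋ - ⌊(n : ℝ) * drift p * (t.1 : ℝ)⌋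
        - ⌊t.2 * √(n : ℝ)⌋ : ℤ)|) .of_discrete).symm

end Asymptotics

/-! ### Currents as random sums -/

lemma ae_summable_of_summable_integral_abs {Ω ι : Type*} [MeasurableSpace Ω] {P : Measure Ω}
    [Countable ι] {S : ι → Ω → ℝ} (hS : ∀ m, Integrable (S m) P)
    (hs : Summable fun m => ∫ ω, |S m ω| ∂P) : ∀ᵐ ω ∂P, Summable fun m => S m ω := by
  have h := summable_norm_of_tsum_eLpNorm_ne_top (μ := P) le_rfl
    (fun m => (hS m).aestronglyMeasurable) (f := S) (p := 1) (by
      have e : ∀ m, eLpNorm (S m) 1 P = ENNReal.ofReal (∫ ω, |S m ω| ∂P) := fun m => by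
        rw [eLpNorm_one_eq_lintegral_enorm, ← ofReal_integral_norm_eq_lintegral_enorm (hS m)]
        rfl
      simp only [e]
      rw [← ENNReal.ofReal_tsum_of_nonneg (fun m => integral_nonneg fun _ => abs_nonneg _) hs]
      exact ENNReal.ofReal_ne_top)
  filter_upwards [h] with ω hω using hω.of_norm

section System

variable {Ω : Type*} [MeasurableSpace Ω] {P : Measure Ω} [IsProbabilityMeasure P]
  {η : ℤ → Ω → ℕ} {X : ℤ → ℕ → ℝ≥0 → Ω → ℤ} {ι : Type*} [Fintype ι]

/-- A linear combination of the crossings of a walk `Y` that starts at `m`. -/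
def crossingSum (v : ℝ) (n : ℕ+) (a : ι → ℝ≥0 × ℝ) (c : ι → ℝ) (m : ℤ) (Y : ℝ≥0 → Ω → ℤ)
    (ω : Ω) : ℝ :=
  ∑ i, c i * crossing v n (a i) (displacement Y (n * (a i).1) ω) m

lemma abs_crossingSum_le (v : ℝ) (n : ℕ+) (a : ι → ℝ≥0 × ℝ) (c : ι → ℝ) (m : ℤ)
    (Y : ℝ≥0 → Ω → ℤ) (ω : Ω) : |crossingSum v n a c m Y ω| ≤ ∑ i, |c i| := by
  refine (Finset.abs_sum_le_sum_abs _ _).trans (Finset.sum_le_sum fun i _ => ?_)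
  rw [abs_mul]
  exact mul_le_of_le_one_right (abs_nonneg _) (abs_crossing_le_one _ _ _ _ _)

lemma measurable_crossing_comp {v : ℝ} {n : ℕ+} {a : ℝ≥0 × ℝ} {m : ℤ} {α : Type*}
    [MeasurableSpace α] {D : α → ℤ} (hD : Measurable D) :
    Measurable fun x => crossing v n a (D x) m :=
  (measurable_of_countable fun d => crossing v n a d m).comp hD

lemma IsRandomWalk.measurable_crossing {m x : ℤ} {Y : ℝ≥0 → Ω → ℤ} (h : IsRandomWalk P p x Y)
    (v : ℝ) (n : ℕ+) (a : ℝ≥0 × ℝ) (t : ℝ≥0) :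
    Measurable fun ω => crossing v n a (displacement Y t ω) m :=
  measurable_crossing_comp (h.measurable_displacement t)

lemma IsRandomWalk.integrable_crossing {m x : ℤ} {Y : ℝ≥0 → Ω → ℤ} (h : IsRandomWalk P p x Y)
    (v : ℝ) (n : ℕ+) (a : ℝ≥0 × ℝ) (t : ℝ≥0) :
    Integrable (fun ω => crossing v n a (displacement Y t ω) m) P :=
  Integrable.of_bound (h.measurable_crossing v n a t).aestronglyMeasurable 1
    (ae_of_all _ fun _ => abs_crossing_le_one _ _ _ _ _)

lemma IsRandomWalk.integrable_crossing_mul {m x : ℤ} {Y : ℝ≥0 → Ω → ℤ} (h : IsRandomWalk P p x Y)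
    (v : ℝ) (n : ℕ+) (a b : ℝ≥0 × ℝ) (s t : ℝ≥0) :
    Integrable (fun ω => crossing v n a (displacement Y s ω) m
      * crossing v n b (displacement Y t ω) m) P :=
  (h.integrable_crossing v n b t).bdd_mul (h.measurable_crossing v n a s).aestronglyMeasurable
    (ae_of_all _ fun _ => abs_crossing_le_one _ _ _ _ _)

lemma IsRandomWalk.measurable_crossingSum {m x : ℤ} {Y : ℝ≥0 → Ω → ℤ} (h : IsRandomWalk P p x Y)
    (v : ℝ) (n : ℕ+) (a : ι → ℝ≥0 × ℝ) (c : ι → ℝ) : Measurable (crossingSum v n a c m Y) :=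
  Finset.measurable_sum _ fun _ _ => (h.measurable_crossing v n _ _).const_mul _

namespace IsWalkSystem

/-- The contribution of the particles starting at one site is a random sum. -/
lemma randomSumData (h : IsWalkSystem P p η X) {B : ℝ≥0}
    (hB : ∀ m, ∫⁻ ω, (η m ω : ℝ≥0∞) ^ 12 ∂P ≤ B) (v : ℝ) (n : ℕ+) (a : ι → ℝ≥0 × ℝ) (c : ι → ℝ)
    (m : ℤ) : RandomSumData P (η m) (fun j => crossingSum v n a c m (X m j)) B (∑ i, |c i|)
      (∑ i, c i * ∫ ω, crossing v n (a i) (displacement (X 0 0) (n * (a i).1) ω) m ∂P)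
      (∑ i, ∑ j, c i * c j * ∫ ω, crossing v n (a i) (displacement (X 0 0) (n * (a i).1) ω) m
        * crossing v n (a j) (displacement (X 0 0) (n * (a j).1) ω) m ∂P)
      (∑ i, |c i| * ∫ ω, |crossing v n (a i) (displacement (X 0 0) (n * (a i).1) ω) m| ∂P) where
  meas_num := h.measurable_occupation m
  meas_term j := (h.walk m j).measurable_crossingSum v n a c
  indep := by
    have hψ : Measurable fun (x : ℤ × ℕ → ℝ≥0 → ℤ) (j : ℕ) =>
        ∑ i, c i * crossing v n (a i) (x (m, j) (n * (a i).1)) m := by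
      refine measurable_pi_lambda _ fun j => Finset.measurable_sum _ fun i _ => ?_
      exact (measurable_crossing_comp
        ((measurable_pi_apply _).comp (measurable_pi_apply _))).const_mul _
    exact h.indep_occupation.comp (measurable_pi_apply m) hψ
  pairwise i j hij := by
    have hψ : ∀ k : ℕ, Measurable fun x : ℝ≥0 → ℤ =>
        ∑ i, c i * crossing v n (a i) (x (n * (a i).1)) m := fun k =>
      Finset.measurable_sum _ fun i _ =>
        (measurable_crossing_comp (measurable_pi_apply _)).const_mul _
    have := h.indep_walks.indepFun (i := (m, i)) (j := (m, j)) (by simpa using hij)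
    exact this.comp (hψ i) (hψ j)
  bound j ω := abs_crossingSum_le _ _ _ _ _ _ _
  moment := hB m
  mean j := by
    unfold crossingSum
    rw [integral_finsetSum _ fun i _ => ((h.walk m j).integrable_crossing v n _ _).const_mul _]
    refine Finset.sum_congr rfl fun i _ => ?_
    rw [integral_const_mul]
    congr 1
    -- All moments are expressed through the reference walk `X 0 0`, so that `m` enters only as the
    -- site. The second time `0` is a dummy.
    exact (h.walk m j).integral_displacement_eq (h.walk 0 0) (n * (a i).1) 0
      fun x _ => crossing v n (a i) x m
  sq j := by
    have e : ∀ ω, crossingSum v n a c m (X m j) ω ^ 2 = ∑ i, ∑ k, c i * c k *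
        (crossing v n (a i) (displacement (X m j) (n * (a i).1) ω) m
          * crossing v n (a k) (displacement (X m j) (n * (a k).1) ω) m) := fun ω => by
      rw [sq, crossingSum, Finset.sum_mul_sum]
      refine Finset.sum_congr rfl fun i _ => Finset.sum_congr rfl fun k _ => ?_
      ring
    have hi := fun i k => ((h.walk m j).integrable_crossing_mul (m := m) v n (a i) (a k)
      (n * (a i).1) (n * (a k).1)).const_mul (c i * c k)
    simp only [e]
    rw [integral_finsetSum _ fun i _ => integrable_finsetSum _ fun k _ => hi i k]
    refine Finset.sum_congr rfl fun i _ => ?_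
    rw [integral_finsetSum _ fun k _ => hi i k]
    refine Finset.sum_congr rfl fun k _ => ?_
    rw [integral_const_mul]
    congr 1
    exact (h.walk m j).integral_displacement_eq (h.walk 0 0) (n * (a i).1) (n * (a k).1)
      fun x y => crossing v n (a i) x m * crossing v n (a k) y m
  abs j := by
    have hi := fun i => ((h.walk m j).integrable_crossing (m := m) v n (a i)
      (n * (a i).1)).abs.const_mul |c i|
    calc _ ≤ ∫ ω, ∑ i, |c i| * |crossing v n (a i) (displacement (X m j) (n * (a i).1) ω) m| ∂P := by
          refine integral_mono_of_nonneg (ae_of_all _ fun ω => abs_nonneg _)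
            (integrable_finsetSum _ fun i _ => hi i) (ae_of_all _ fun ω => ?_)
          refine (Finset.abs_sum_le_sum_abs _ _).trans_eq (Finset.sum_congr rfl fun i _ => ?_)
          rw [abs_mul]
      _ = _ := by
          rw [integral_finsetSum _ fun i _ => hi i]
          refine Finset.sum_congr rfl fun i _ => ?_
          rw [integral_const_mul]
          congr 1
          exact (h.walk m j).integral_displacement_eq (h.walk 0 0) (n * (a i).1) 0
            fun x _ => |crossing v n (a i) x m|
      _ ≤ _ := le_rfl

lemma integral_prod_exp (h : IsWalkSystem P p η X) (hη : iIndepFun η P) (v : ℝ) (n : ℕ+)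
    (a : ι → ℝ≥0 × ℝ) (c : ι → ℝ) (s : Finset ℤ) :
    ∫ ω, ∏ m ∈ s, Complex.exp
        ((randomSum (η m) (fun j => crossingSum v n a c m (X m j)) ω : ℂ) * Complex.I) ∂P
      = ∏ m ∈ s, ∫ ω, Complex.exp
        ((randomSum (η m) (fun j => crossingSum v n a c m (X m j)) ω : ℂ) * Complex.I) ∂P := by
  have hψ : ∀ k : ℤ × ℕ, Measurable fun x : ℝ≥0 → ℤ =>
      ∑ i, c i * crossing v n (a i) (x (n * (a i).1)) k.1 := fun k =>
    Finset.measurable_sum _ fun i _ =>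
      (measurable_crossing_comp (measurable_pi_apply _)).const_mul _
  have hψ' : Measurable fun (x : ℤ × ℕ → ℝ≥0 → ℤ) (k : ℤ × ℕ) =>
      ∑ i, c i * crossing v n (a i) (x k (n * (a i).1)) k.1 :=
    measurable_pi_lambda _ fun k => (hψ k).comp (measurable_pi_apply k)
  refine integral_prod_exp_randomSum h.measurable_occupation
    (fun m j => (h.walk m j).measurable_crossingSum v n a c) hη ?_ ?_ s
  · exact h.indep_walks.comp _ hψ
  · exact h.indep_occupation.comp measurable_id hψ'

/-- With `f = 1{m ≤ x}` and `g = 1{m ≤ k}` the summand is `f(1 - g) - (1 - f)g = f - g`. The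
identity is almost sure because the walks start at `m` only almost surely. -/
lemma ae_siteCurrent_eq (h : IsWalkSystem P p η X) (v : ℝ) (n : ℕ+) (a : ℝ≥0 × ℝ) :
    ∀ᵐ ω ∂P, ∀ m, siteCurrent v n η X a.1 a.2 ω m
      = ∑ j ∈ Finset.range (η m ω), crossing v n a (displacement (X m j) (n * a.1) ω) m := by
  have h0 : ∀ᵐ ω ∂P, ∀ m j, X m j 0 ω = m :=
    ae_all_iff.2 fun m => ae_all_iff.2 fun j => (h.walk m j).start
  filter_upwards [h0] with ω hω m
  refine Finset.sum_congr rfl fun j _ => ?_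
  rw [crossing, displacement, hω m j]
  simp only [step]
  split_ifs <;> first | omega | simp

lemma summable_integral_abs_crossing (h : IsWalkSystem P p η X) (hp : HasExpMoments p) (n : ℕ+)
    (a : ℝ≥0 × ℝ) : Summable fun m =>
      ∫ ω, |crossing (drift p) n a (displacement (X 0 0) (n * a.1) ω) m| ∂P := by
  obtain ⟨δ, K, hδ, hK, hm⟩ := hp.exists_mgf_le
  exact (CompoundPoissonMgf.siteWeight_crossing hm hK (le_refl a.1)
    ((h.walk 0 0).measurable_displacement _) ((h.walk 0 0).hasLaw_displacement _)).summable_abs hδ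

lemma summable_abs_bound (h : IsWalkSystem P p η X) (hp : HasExpMoments p) (n : ℕ+)
    (a : ι → ℝ≥0 × ℝ) (c : ι → ℝ) : Summable fun m =>
      ∑ i, |c i| * ∫ ω, |crossing (drift p) n (a i)
        (displacement (X 0 0) (n * (a i).1) ω) m| ∂P :=
  summable_sum fun i _ => (h.summable_integral_abs_crossing hp n (a i)).mul_left _

lemma ae_summable_randomSum (h : IsWalkSystem P p η X) (hp : HasExpMoments p) {B : ℝ≥0}
    (hB : ∀ m, ∫⁻ ω, (η m ω : ℝ≥0∞) ^ 12 ∂P ≤ B) (n : ℕ+) (a : ι → ℝ≥0 × ℝ) (c : ι → ℝ) :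
    ∀ᵐ ω ∂P, Summable fun m =>
      randomSum (η m) (fun j => crossingSum (drift p) n a c m (X m j)) ω := by
  have hd := h.randomSumData hB (drift p) n a c
  refine ae_summable_of_summable_integral_abs (fun m => (hd m).integrable) ?_
  refine Summable.of_nonneg_of_le (fun m => integral_nonneg fun _ => abs_nonneg _) (fun m => ?_)
    ((h.summable_abs_bound hp n a c).mul_left (B : ℝ))
  simpa using (hd m).integral_abs_pow_succ_le (k := 0) (by norm_num)

lemma randomSum_single (v : ℝ) (n : ℕ+) (a : ℝ≥0 × ℝ) (m : ℤ) (ω : Ω) :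
    randomSum (η m) (fun j => crossingSum v n (fun _ : Unit => a) (fun _ => 1) m (X m j)) ω
      = ∑ j ∈ Finset.range (η m ω), crossing v n a (displacement (X m j) (n * a.1) ω) m := by
  simp [randomSum, crossingSum]

lemma ae_summable_siteCurrent (h : IsWalkSystem P p η X) (hp : HasExpMoments p) {B : ℝ≥0}
    (hB : ∀ m, ∫⁻ ω, (η m ω : ℝ≥0∞) ^ 12 ∂P ≤ B) (n : ℕ+) (a : ℝ≥0 × ℝ) :
    ∀ᵐ ω ∂P, Summable (siteCurrent (drift p) n η X a.1 a.2 ω) := by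
  filter_upwards [h.ae_summable_randomSum hp hB n (fun _ : Unit => a) (fun _ => 1),
    h.ae_siteCurrent_eq (drift p) n a] with ω h1 h2
  simp only [randomSum_single, ← h2] at h1
  exact h1

lemma aemeasurable_current (h : IsWalkSystem P p η X) (hp : HasExpMoments p) {B : ℝ≥0}
    (hB : ∀ m, ∫⁻ ω, (η m ω : ℝ≥0∞) ^ 12 ∂P ≤ B) (n : ℕ+) (a : ℝ≥0 × ℝ) :
    AEMeasurable (current (drift p) n η X a.1 a.2) P := by
  have hd := h.randomSumData hB (drift p) n (fun _ : Unit => a) (fun _ => 1)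
  refine aemeasurable_of_tendsto_metrizable_ae (atTop : Filter (Finset ℤ))
    (f := fun s ω => ∑ m ∈ s, randomSum (η m)
      (fun j => crossingSum (drift p) n (fun _ : Unit => a) (fun _ => 1) m (X m j)) ω)
    (fun s => (Finset.measurable_sum _ fun m _ => (hd m).measurable).aemeasurable) ?_
  filter_upwards [h.ae_summable_siteCurrent hp hB n a,
    h.ae_siteCurrent_eq (drift p) n a] with ω h1 h2
  simp only [randomSum_single, ← h2]
  exact h1.hasSum

lemma ae_tsum_randomSum_eq (h : IsWalkSystem P p η X) (hp : HasExpMoments p) {B : ℝ≥0}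
    (hB : ∀ m, ∫⁻ ω, (η m ω : ℝ≥0∞) ^ 12 ∂P ≤ B) (n : ℕ+) (a : ι → ℝ≥0 × ℝ) (c : ι → ℝ) :
    ∀ᵐ ω ∂P, ∑' m, randomSum (η m) (fun j => crossingSum (drift p) n a c m (X m j)) ω
      = ∑ i, c i * current (drift p) n η X (a i).1 (a i).2 ω := by
  filter_upwards [ae_all_iff.2 fun i => h.ae_summable_siteCurrent hp hB n (a i),
    ae_all_iff.2 fun i => h.ae_siteCurrent_eq (drift p) n (a i)] with ω h1 h2
  have e : ∀ m, randomSum (η m) (fun j => crossingSum (drift p) n a c m (X m j)) ω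
      = ∑ i, c i * siteCurrent (drift p) n η X (a i).1 (a i).2 ω m := fun m => by
    simp only [h2, randomSum, crossingSum, Finset.mul_sum]
    exact Finset.sum_comm
  simp only [e]
  rw [Summable.tsum_finsetSum fun i _ => (h1 i).mul_left (c i)]
  simp only [tsum_mul_left, current]

/-- A quantitative Gaussian approximation of linear combinations of currents. -/
lemma norm_integral_exp_current_sub_le (h : IsWalkSystem P p η X) (hη : iIndepFun η P)
    (hp : HasExpMoments p) {B : ℝ≥0} (hB : ∀ m, ∫⁻ ω, (η m ω : ℝ≥0∞) ^ 12 ∂P ≤ B) (n : ℕ+)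
    (a : ι → ℝ≥0 × ℝ) (c : ι → ℝ) :
    ‖∫ ω, Complex.exp (((∑ i, c i * current (drift p) n η X (a i).1 (a i).2 ω : ℝ) : ℂ)
        * Complex.I) ∂P
      - Complex.exp (((∑' m, ∫ ω, randomSum (η m)
          (fun j => crossingSum (drift p) n a c m (X m j)) ω ∂P : ℝ) : ℂ) * Complex.I
        - (((∑' m, variance (randomSum (η m)
          (fun j => crossingSum (drift p) n a c m (X m j))) P) / 2 : ℝ) : ℂ))‖
      ≤ (32 * (∑ i, |c i|) ^ 2 * B + (∑ i, |c i|) ^ 3 * B ^ 2) * ∑ i, |c i| * ∑' m,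
        ∫ ω, |crossing (drift p) n (a i) (displacement (X 0 0) (n * (a i).1) ω) m| ∂P := by
  set C := ∑ i, |c i|
  have hC : 0 ≤ C := Finset.sum_nonneg fun _ _ => abs_nonneg _
  have hd := h.randomSumData hB (drift p) n a c
  set e : ℤ → ℝ := fun m => ∑ i, |c i| * ∫ ω, |crossing (drift p) n (a i)
        (displacement (X 0 0) (n * (a i).1) ω) m| ∂P
  have he : Summable e := h.summable_abs_bound hp n a c
  have he0 : ∀ m, 0 ≤ e m := fun m => (hd m).nonneg_abs
  have heC : ∀ m, e m ≤ C := fun m => by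
    refine Finset.sum_le_sum fun i _ => mul_le_of_le_one_right (abs_nonneg _) ?_
    calc _ ≤ ∫ _, (1 : ℝ) ∂P :=
          integral_mono ((h.walk 0 0).integrable_crossing _ _ _ _).abs (integrable_const 1)
            fun ω => abs_crossing_le_one _ _ _ _ _
      _ = 1 := by simp
  have het : ∑' m, e m = ∑ i, |c i| * ∑' m,
      ∫ ω, |crossing (drift p) n (a i) (displacement (X 0 0) (n * (a i).1) ω) m| ∂P := by
    rw [Summable.tsum_finsetSum fun i _ =>
      (h.summable_integral_abs_crossing hp n (a i)).mul_left |c i|]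
    simp only [tsum_mul_left]
  have hL1 : ∀ m, ∫ ω, |randomSum (η m)
      (fun j => crossingSum (drift p) n a c m (X m j)) ω| ∂P ≤ B * e m := fun m => by
    simpa using (hd m).integral_abs_pow_succ_le (k := 0) (by norm_num)
  have hv0 : ∀ m, 0 ≤ variance (randomSum (η m)
      (fun j => crossingSum (drift p) n a c m (X m j))) P := fun m => variance_nonneg _ _
  have key := norm_integral_exp_tsum_sub_le (P := P)
    (S := fun m => randomSum (η m) (fun j => crossingSum (drift p) n a c m (X m j)))
    (ε := fun m => (32 * C ^ 2 * B + C ^ 3 * B ^ 2) * e m) (fun m => (hd m).measurable)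
    (fun m => (hd m).memLp_two) (fun m => (hd m).integrable_pow (by norm_num) (by norm_num))
    (h.integral_prod_exp hη (drift p) n a c) (h.ae_summable_randomSum hp hB n a c)
    (Summable.of_norm_bounded (he.mul_left (B : ℝ)) fun m =>
      (norm_integral_le_integral_norm _).trans (hL1 m))
    (Summable.of_nonneg_of_le hv0 (fun m => (hd m).variance_le) (he.mul_left (C * B)))
    (fun m => by
      have h3 := (hd m).integral_abs_pow_succ_le (k := 2) (by norm_num)
      have h2 := pow_le_pow_left₀ (hv0 m) (hd m).variance_le 2
      -- One factor `e m` is traded for its bound `C`, so that the squared variance, like the third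
      -- moment, is linear in the summable `e m`.
      have h4 : (C * B * e m) ^ 2 ≤ C ^ 3 * B ^ 2 * e m := by
        calc (C * B * e m) ^ 2 = C ^ 2 * B ^ 2 * e m * e m := by ring
          _ ≤ C ^ 2 * B ^ 2 * e m * C :=
            mul_le_mul_of_nonneg_left (heC m) (mul_nonneg (by positivity) (he0 m))
          _ = _ := by ring
      calc _ ≤ 32 * (C ^ 2 * B * e m) + C ^ 3 * B ^ 2 * e m :=
            add_le_add (mul_le_mul_of_nonneg_left h3 (by norm_num)) (h2.trans h4)
        _ = _ := by ring)
    (he.mul_left _)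
  rw [tsum_mul_left, het] at key
  rwa [integral_congr_ae ((h.ae_tsum_randomSum_eq hp hB n a c).mono fun ω hω => by
    rw [hω])] at key

end IsWalkSystem

end System

/-! ### Mean and variance of linear combinations of currents -/

section System

variable {Ω : Type*} [MeasurableSpace Ω] {P : Measure Ω} [IsProbabilityMeasure P]
  {η : ℤ → Ω → ℕ} {X : ℤ → ℕ → ℝ≥0 → Ω → ℤ} {ι : Type*} [Fintype ι] {B : ℝ≥0}

lemma abs_integral_le_of_moment {N : Ω → ℕ} (hN : Measurable N)
    (hB : ∫⁻ ω, (N ω : ℝ≥0∞) ^ 12 ∂P ≤ B) : |∫ ω, (N ω : ℝ) ∂P| ≤ B := by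
  rw [abs_of_nonneg (integral_nonneg fun _ => Nat.cast_nonneg _)]
  simpa using (integrable_pow_of_moment hN hB one_ne_zero (by norm_num)).2

lemma abs_variance_le_of_moment {N : Ω → ℕ} (hN : Measurable N)
    (hB : ∫⁻ ω, (N ω : ℝ≥0∞) ^ 12 ∂P ≤ B) : |variance (fun ω => (N ω : ℝ)) P| ≤ B := by
  rw [abs_of_nonneg (variance_nonneg _ _)]
  refine (variance_le_expectation_sq ?_).trans
    (integrable_pow_of_moment hN hB two_ne_zero (by norm_num)).2
  exact ((measurable_of_countable _).comp hN).aestronglyMeasurable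

namespace IsWalkSystem

lemma summable_mul_of_abs_le (h : IsWalkSystem P p η X) (hp : HasExpMoments p) (n : ℕ+)
    (a : ℝ≥0 × ℝ) {b w : ℤ → ℝ} {B : ℝ} (hb : ∀ m, |b m| ≤ B)
    (hw : ∀ m, |w m| ≤ ∫ ω, |crossing (drift p) n a (displacement (X 0 0) (n * a.1) ω) m| ∂P) :
    Summable fun m => b m * w m :=
  Summable.of_norm_bounded ((h.summable_integral_abs_crossing hp n a).mul_left B) fun m => by
    rw [norm_mul]
    exact mul_le_mul (hb m) (hw m) (norm_nonneg _) ((abs_nonneg _).trans (hb m))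

lemma abs_integral_crossing_mul_le (h : IsWalkSystem P p η X) (v : ℝ) (n : ℕ+)
    (a b : ℝ≥0 × ℝ) (m : ℤ) :
    |∫ ω, crossing v n a (displacement (X 0 0) (n * a.1) ω) m
      * crossing v n b (displacement (X 0 0) (n * b.1) ω) m ∂P|
      ≤ ∫ ω, |crossing v n a (displacement (X 0 0) (n * a.1) ω) m| ∂P := by
  refine abs_integral_le_integral_abs.trans (integral_mono
    ((h.walk 0 0).integrable_crossing_mul v n a b _ _).abs
    ((h.walk 0 0).integrable_crossing v n a _).abs fun ω => ?_)
  simp only [abs_mul]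
  exact mul_le_of_le_one_right (abs_nonneg _) (abs_crossing_le_one _ _ _ _ _)

lemma abs_integral_crossing_mul_integral_le (h : IsWalkSystem P p η X) (v : ℝ) (n : ℕ+)
    (a b : ℝ≥0 × ℝ) (m : ℤ) :
    |(∫ ω, crossing v n a (displacement (X 0 0) (n * a.1) ω) m ∂P)
      * ∫ ω, crossing v n b (displacement (X 0 0) (n * b.1) ω) m ∂P|
      ≤ ∫ ω, |crossing v n a (displacement (X 0 0) (n * a.1) ω) m| ∂P := by
  rw [abs_mul]
  have h1 : |∫ ω, crossing v n b (displacement (X 0 0) (n * b.1) ω) m ∂P| ≤ 1 := by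
    refine abs_integral_le_integral_abs.trans ?_
    calc _ ≤ ∫ _, (1 : ℝ) ∂P :=
          integral_mono ((h.walk 0 0).integrable_crossing _ _ _ _).abs (integrable_const 1)
            fun ω => abs_crossing_le_one _ _ _ _ _
      _ = 1 := by simp
  exact (mul_le_of_le_one_right (abs_nonneg _) h1).trans abs_integral_le_integral_abs

lemma tsum_integral_randomSum (h : IsWalkSystem P p η X) (hp : HasExpMoments p)
    (hB : ∀ m, ∫⁻ ω, (η m ω : ℝ≥0∞) ^ 12 ∂P ≤ B) (n : ℕ+) (a : ι → ℝ≥0 × ℝ) (c : ι → ℝ) :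
    ∑' m, ∫ ω, randomSum (η m) (fun j => crossingSum (drift p) n a c m (X m j)) ω ∂P
      = ∑ i, c i * ∑' m, (∫ ω, (η m ω : ℝ) ∂P)
        * ∫ ω, crossing (drift p) n (a i) (displacement (X 0 0) (n * (a i).1) ω) m ∂P := by
  have hs := fun i => h.summable_mul_of_abs_le hp n (a i)
    (fun m => abs_integral_le_of_moment (h.measurable_occupation m) (hB m))
    (fun _ => abs_integral_le_integral_abs)
  simp only [← tsum_mul_left]
  rw [← Summable.tsum_finsetSum fun i _ => (hs i).mul_left (c i)]
  refine tsum_congr fun m => ?_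
  rw [(h.randomSumData hB (drift p) n a c m).integral_eq, Finset.mul_sum]
  refine Finset.sum_congr rfl fun i _ => ?_
  ring

/-- Expands the variances of the sites into the three bilinear sums whose limits are known: second
moments and products of means, both weighted by `E[η]`, and products of means weighted by `Var[η]`.
-/
lemma tsum_variance_randomSum (h : IsWalkSystem P p η X) (hp : HasExpMoments p)
    (hB : ∀ m, ∫⁻ ω, (η m ω : ℝ≥0∞) ^ 12 ∂P ≤ B) (n : ℕ+) (a : ι → ℝ≥0 × ℝ) (c : ι → ℝ) :
    ∑' m, variance (randomSum (η m) (fun j => crossingSum (drift p) n a c m (X m j))) P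
      = ∑ i, ∑ j, c i * c j * ((∑' m, (∫ ω, (η m ω : ℝ) ∂P)
          * ∫ ω, crossing (drift p) n (a i) (displacement (X 0 0) (n * (a i).1) ω) m
            * crossing (drift p) n (a j) (displacement (X 0 0) (n * (a j).1) ω) m ∂P)
        - (∑' m, (∫ ω, (η m ω : ℝ) ∂P)
          * ((∫ ω, crossing (drift p) n (a i) (displacement (X 0 0) (n * (a i).1) ω) m ∂P)
            * ∫ ω, crossing (drift p) n (a j) (displacement (X 0 0) (n * (a j).1) ω) m ∂P))
        + ∑' m, variance (fun ω => (η m ω : ℝ)) P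
          * ((∫ ω, crossing (drift p) n (a i) (displacement (X 0 0) (n * (a i).1) ω) m ∂P)
            * ∫ ω, crossing (drift p) n (a j) (displacement (X 0 0) (n * (a j).1) ω) m ∂P)) := by
  have b1 := fun m => abs_integral_le_of_moment (h.measurable_occupation m) (hB m)
  have b2 := fun m => abs_variance_le_of_moment (h.measurable_occupation m) (hB m)
  have s1 := fun i j => h.summable_mul_of_abs_le hp n (a i) b1
    (h.abs_integral_crossing_mul_le (drift p) n (a i) (a j))
  have s2 := fun i j => h.summable_mul_of_abs_le hp n (a i) b1
    (h.abs_integral_crossing_mul_integral_le (drift p) n (a i) (a j))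
  have s3 := fun i j => h.summable_mul_of_abs_le hp n (a i) b2
    (h.abs_integral_crossing_mul_integral_le (drift p) n (a i) (a j))
  have hs := hasSum_sum (s := Finset.univ) fun i _ => hasSum_sum (s := Finset.univ) fun j _ =>
    (((s1 i j).hasSum.sub (s2 i j).hasSum).add (s3 i j).hasSum).mul_left (c i * c j)
  rw [← hs.tsum_eq]
  refine tsum_congr fun m => ?_
  rw [(h.randomSumData hB (drift p) n a c m).variance_eq, mul_sub, sq, Finset.sum_mul_sum]
  simp only [Finset.mul_sum, ← Finset.sum_sub_distrib, ← Finset.sum_add_distrib]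
  refine Finset.sum_congr rfl fun i _ => Finset.sum_congr rfl fun j _ => ?_
  ring

end IsWalkSystem

end System

/-! ### Convergence of characteristic functions -/

section Limit

variable {Ω : ℕ+ → Type*} [∀ n, MeasurableSpace (Ω n)] {P : ∀ n, Measure (Ω n)}
  [∀ n, IsProbabilityMeasure (P n)] {η : ∀ n, ℤ → Ω n → ℕ} {X : ∀ n, ℤ → ℕ → ℝ≥0 → Ω n → ℤ}
  {ρ₀ v₀ : ℝ} {ι : Type*} [Fintype ι]

/-- The covariance of the limiting Gaussian process. -/
def limitCov (p : PMF ℤ) (ρ₀ v₀ : ℝ) (a b : ℝ≥0 × ℝ) : ℝ :=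
  ρ₀ * Gammaq (kappa2 p) a b + v₀ * Gamma0 (kappa2 p) a b

lemma limitCov_comm (p : PMF ℤ) (ρ₀ v₀ : ℝ) (a b : ℝ≥0 × ℝ) :
    limitCov p ρ₀ v₀ a b = limitCov p ρ₀ v₀ b a := by
  simp only [limitCov, Gammaq, Gamma0]
  rw [abs_sub_comm a.2, abs_sub_comm (b.1 : ℝ), add_comm (b.1 : ℝ)]
  ring

lemma tendsto_rpow_neg_quarter :
    Tendsto (fun n : ℕ+ => (n : ℝ) ^ (-(1 / 4) : ℝ)) atTop (𝓝 0) :=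
  (tendsto_rpow_neg_atTop (by norm_num)).comp tendsto_pnat_cast

lemma rpow_neg_quarter_pos (n : ℕ+) : 0 < (n : ℝ) ^ (-(1 / 4) : ℝ) :=
  Real.rpow_pos_of_pos (by exact_mod_cast n.pos) _

lemma rpow_neg_quarter_mul_self (n : ℕ+) :
    (n : ℝ) ^ (-(1 / 4) : ℝ) * (n : ℝ) ^ (-(1 / 4) : ℝ) = (n : ℝ) ^ (-(1 / 2) : ℝ) := by
  rw [← Real.rpow_add (by exact_mod_cast n.pos)]
  norm_num

/-- The sum is at most the mean distance between the endpoint and the line, hence `O(√n)`. Three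
powers of `n^{-1/4}` beat it; this is the Lyapunov condition. -/
lemma HasExpMoments.tendsto_tsum_integral_abs_crossing (hp : HasExpMoments p)
    (hX : ∀ n, IsWalkSystem (P n) p (η n) (X n)) (a : ℝ≥0 × ℝ) :
    Tendsto (fun n : ℕ+ => ((n : ℝ) ^ (-(1 / 4) : ℝ)) ^ 3 * ∑' m,
      ∫ ω, |crossing (drift p) n a (displacement (X n 0 0) (n * a.1) ω) m| ∂(P n))
      atTop (𝓝 0) := by
  obtain ⟨δ, K, hδ, hK, hm⟩ := hp.exists_mgf_le
  have hw := fun n : ℕ+ => CompoundPoissonMgf.siteWeight_crossing hm hK (le_refl a.1)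
    (((hX n).walk 0 0).measurable_displacement (n * a.1))
    (((hX n).walk 0 0).hasLaw_displacement (n * a.1))
  have hlim := tendsto_rpow_neg_quarter.const_mul (2 * Real.exp (K * a.1 + 1))
  rw [mul_zero] at hlim
  refine squeeze_zero' (Eventually.of_forall fun n => ?_) ?_ hlim
  · exact mul_nonneg (pow_nonneg (rpow_neg_quarter_pos n).le _)
      (tsum_nonneg fun m => integral_nonneg fun _ => abs_nonneg _)
  · filter_upwards [eventually_log_pnat hδ] with n hn
    have hn1 : (1 : ℝ) ≤ (n : ℝ) := by exact_mod_cast one_le (a := n)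
    have h1 := ((hw n).tsum_abs_le hδ).trans ((hw n).integral_abs_sub_le hn1 hn.2.2)
    have hn0 : (0 : ℝ) < (n : ℝ) := by linarith
    have e : ((n : ℝ) ^ (-(1 / 4) : ℝ)) ^ 2 * √(n : ℝ) = 1 := by
      rw [sq, rpow_neg_quarter_mul_self, Real.sqrt_eq_rpow, ← Real.rpow_add hn0]
      norm_num
    set y := (n : ℝ) ^ (-(1 / 4) : ℝ)
    have hy : 0 < y := rpow_neg_quarter_pos n
    calc _ ≤ y ^ 3 * (2 * Real.exp (K * a.1 + 1) * √(n : ℝ)) :=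
          mul_le_mul_of_nonneg_left h1 (by positivity)
      _ = 2 * Real.exp (K * a.1 + 1) * y * (y ^ 2 * √(n : ℝ)) := by ring
      _ = _ := by rw [e, mul_one]

lemma InitialAssumption.tendsto_mean (hη : InitialAssumption P η ρ₀ v₀) (hp : HasExpMoments p)
    (hX : ∀ n, IsWalkSystem (P n) p (η n) (X n)) (a : ι → ℝ≥0 × ℝ) (c : ι → ℝ) :
    Tendsto (fun n : ℕ+ => ∑' m, ∫ ω, randomSum (η n m) (fun j => crossingSum (drift p) n a
      (fun i => (n : ℝ) ^ (-(1 / 4) : ℝ) * c i) m (X n m j)) ω ∂(P n)) atTop (𝓝 0) := by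
  obtain ⟨B, hB⟩ := hη.moment
  have h1 := fun i => (hp.tendsto_tsum_mul_integral_crossing hη.mean (s := a i) (B := B)
    (fun n m => abs_integral_le_of_moment ((hX n).measurable_occupation m) (hB n m))
    (fun n => ((hX n).walk 0 0).measurable_displacement _)
    (fun n => ((hX n).walk 0 0).hasLaw_displacement _)).const_mul (c i)
  have h2 := tendsto_finsetSum Finset.univ fun i _ => h1 i
  simp only [mul_zero, Finset.sum_const_zero] at h2
  refine h2.congr fun n => ?_
  rw [(hX n).tsum_integral_randomSum hp (hB n)]
  refine Finset.sum_congr rfl fun i _ => ?_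
  ring

lemma InitialAssumption.tendsto_variance (hη : InitialAssumption P η ρ₀ v₀)
    (hp : HasExpMoments p) (hX : ∀ n, IsWalkSystem (P n) p (η n) (X n)) (a : ι → ℝ≥0 × ℝ)
    (c : ι → ℝ) :
    Tendsto (fun n : ℕ+ => ∑' m, variance (randomSum (η n m) (fun j => crossingSum (drift p) n a
      (fun i => (n : ℝ) ^ (-(1 / 4) : ℝ) * c i) m (X n m j))) (P n)) atTop
      (𝓝 (∑ i, ∑ j, c i * c j * limitCov p ρ₀ v₀ (a i) (a j))) := by
  obtain ⟨B, hB⟩ := hη.moment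
  have b1 : ∀ n m, |∫ ω, (η n m ω : ℝ) ∂(P n)| ≤ B := fun n m =>
    abs_integral_le_of_moment ((hX n).measurable_occupation m) (hB n m)
  have b2 : ∀ n m, |variance (fun ω => (η n m ω : ℝ)) (P n)| ≤ B := fun n m =>
    abs_variance_le_of_moment ((hX n).measurable_occupation m) (hB n m)
  have l1 := fun i j => hp.tendsto_tsum_mul_integral_crossing_walk hη.mean b1
    (fun n => (hX n).walk 0 0) (a i) (a j)
  have l2 := fun i j => hp.tendsto_tsum_mul_integral_crossing_mul_integral hη.mean b1
    (s := a i) (t := a j) (fun n => ((hX n).walk 0 0).measurable_displacement _)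
    (fun n => ((hX n).walk 0 0).measurable_displacement _)
    (fun n => ((hX n).walk 0 0).hasLaw_displacement _)
    (fun n => ((hX n).walk 0 0).hasLaw_displacement _)
  have l3 := fun i j => hp.tendsto_tsum_mul_integral_crossing_mul_integral hη.var b2
    (s := a i) (t := a j) (fun n => ((hX n).walk 0 0).measurable_displacement _)
    (fun n => ((hX n).walk 0 0).measurable_displacement _)
    (fun n => ((hX n).walk 0 0).hasLaw_displacement _)
    (fun n => ((hX n).walk 0 0).hasLaw_displacement _)
  have h := tendsto_finsetSum Finset.univ fun i _ => tendsto_finsetSum Finset.univ fun j _ =>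
    (((l1 i j).sub (l2 i j)).add (l3 i j)).const_mul (c i * c j)
  -- `Γ_q` is written as the one-walk limit minus the two-walk limit, in which `Ψ_{κ₂s} + Ψ_{κ₂t}`
  -- occurs twice and cancels.
  have e : ∑ i, ∑ j, c i * c j * limitCov p ρ₀ v₀ (a i) (a j) = _ :=
    Finset.sum_congr rfl fun i _ => Finset.sum_congr rfl fun j _ => by
      rw [limitCov, Gammaq, Gamma0, mul_sub ρ₀ (Psi _ _), ← sub_sub_sub_cancel_left _ _
        (ρ₀ * (Psi (kappa2 p * (a i).1) |(a i).2 - (a j).2|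
          + Psi (kappa2 p * (a j).1) |(a i).2 - (a j).2|)), ← mul_sub, ← mul_sub]
  rw [e]
  refine h.congr fun n => ?_
  rw [(hX n).tsum_variance_randomSum hp (hB n)]
  refine Finset.sum_congr rfl fun i _ => Finset.sum_congr rfl fun j _ => ?_
  rw [← rpow_neg_quarter_mul_self]
  ring

/-- Positive semidefiniteness needs no study of `Ψ`: the quadratic forms are limits of sums of
variances. -/
lemma InitialAssumption.limitCov_nonneg (hη : InitialAssumption P η ρ₀ v₀)
    (hp : HasExpMoments p) (hX : ∀ n, IsWalkSystem (P n) p (η n) (X n)) (a : ι → ℝ≥0 × ℝ)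
    (c : ι → ℝ) : 0 ≤ ∑ i, ∑ j, c i * c j * limitCov p ρ₀ v₀ (a i) (a j) :=
  ge_of_tendsto' (hη.tendsto_variance hp hX a c) fun n => tsum_nonneg fun m => variance_nonneg _ _

/-- Convergence of the characteristic functions of the rescaled currents. -/
lemma InitialAssumption.tendsto_integral_exp_current (hη : InitialAssumption P η ρ₀ v₀)
    (hp : HasExpMoments p) (hX : ∀ n, IsWalkSystem (P n) p (η n) (X n)) (a : ι → ℝ≥0 × ℝ)
    (c : ι → ℝ) :
    Tendsto (fun n : ℕ+ => ∫ ω, Complex.exp (((∑ i, c i * ((n : ℝ) ^ (-(1 / 4) : ℝ)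
      * current (drift p) n (η n) (X n) (a i).1 (a i).2 ω) : ℝ) : ℂ) * Complex.I) ∂(P n)) atTop
      (𝓝 (Complex.exp (-(∑ i, ∑ j, c i * c j * limitCov p ρ₀ v₀ (a i) (a j) : ℝ) / 2))) := by
  obtain ⟨B, hB⟩ := hη.moment
  have hM := hη.tendsto_mean hp hX a c
  have hV := hη.tendsto_variance hp hX a c
  have h1 := (Complex.continuous_exp.tendsto _).comp
    ((((Complex.continuous_ofReal.tendsto _).comp hM).mul_const Complex.I).sub
      ((Complex.continuous_ofReal.tendsto _).comp (hV.div_const 2)))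
  have e1 : ((0 : ℝ) : ℂ) * Complex.I
      - ((∑ i, ∑ j, c i * c j * limitCov p ρ₀ v₀ (a i) (a j)) / 2 : ℝ)
      = -(∑ i, ∑ j, c i * c j * limitCov p ρ₀ v₀ (a i) (a j) : ℝ) / 2 := by
    rw [Complex.ofReal_zero, zero_mul, zero_sub, Complex.ofReal_div, neg_div]
    norm_num
  rw [e1] at h1
  set Θ := ∑ i, |c i|
  -- With the factor `n^{-1/4}` in the coefficients, the third-moment error carries three such
  -- factors and the squared variances carry four.
  have hU : Tendsto (fun n : ℕ+ => (32 * Θ ^ 2 * B + (n : ℝ) ^ (-(1 / 4) : ℝ) * (Θ ^ 3 * B ^ 2))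
      * ∑ i, |c i| * (((n : ℝ) ^ (-(1 / 4) : ℝ)) ^ 3 * ∑' m, ∫ ω, |crossing (drift p) n (a i)
        (displacement (X n 0 0) (n * (a i).1) ω) m| ∂(P n))) atTop (𝓝 0) := by
    have h2 := ((tendsto_rpow_neg_quarter.mul_const (Θ ^ 3 * B ^ 2)).const_add
      (32 * Θ ^ 2 * B)).mul (tendsto_finsetSum Finset.univ fun i _ =>
        (hp.tendsto_tsum_integral_abs_crossing hX (a i)).const_mul |c i|)
    simpa only [mul_zero, Finset.sum_const_zero] using h2
  have hd := squeeze_zero_norm (fun n : ℕ+ => ?_) hU (f := fun n : ℕ+ =>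
    ∫ ω, Complex.exp (((∑ i, c i * ((n : ℝ) ^ (-(1 / 4) : ℝ)
      * current (drift p) n (η n) (X n) (a i).1 (a i).2 ω) : ℝ) : ℂ) * Complex.I) ∂(P n)
    - Complex.exp (((∑' m, ∫ ω, randomSum (η n m) (fun j => crossingSum (drift p) n a
      (fun i => (n : ℝ) ^ (-(1 / 4) : ℝ) * c i) m (X n m j)) ω ∂(P n) : ℝ) : ℂ) * Complex.I
      - (((∑' m, variance (randomSum (η n m) (fun j => crossingSum (drift p) n a
      (fun i => (n : ℝ) ^ (-(1 / 4) : ℝ) * c i) m (X n m j))) (P n)) / 2 : ℝ) : ℂ)))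
  · have h2 := hd.add h1
    rw [zero_add] at h2
    refine h2.congr fun n => ?_
    exact sub_add_cancel _ _
  · have h2 := (hX n).norm_integral_exp_current_sub_le (hη.indep n) hp (hB n) n a
      fun i => (n : ℝ) ^ (-(1 / 4) : ℝ) * c i
    have e2 : ∀ ω, ∑ i, c i * ((n : ℝ) ^ (-(1 / 4) : ℝ)
        * current (drift p) n (η n) (X n) (a i).1 (a i).2 ω) = ∑ i, (n : ℝ) ^ (-(1 / 4) : ℝ) * c i
        * current (drift p) n (η n) (X n) (a i).1 (a i).2 ω := fun ω =>
      Finset.sum_congr rfl fun i _ => by ring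
    simp only [e2]
    refine h2.trans_eq ?_
    simp only [abs_mul, abs_of_pos (rpow_neg_quarter_pos n), ← Finset.mul_sum]
    rw [show ∑ i, |c i| = Θ from rfl]
    simp only [Finset.mul_sum]
    refine Finset.sum_congr rfl fun i _ => ?_
    ring

end Limit

/-! ### From characteristic functions to convergence in distribution -/

lemma charFun_map_toLp {α ι : Type*} [Fintype ι] [MeasurableSpace α] {μ : Measure α}
    {W : α → ι → ℝ} (hW : AEMeasurable W μ) (t : EuclideanSpace ℝ ι) :
    charFun (μ.map fun x => (WithLp.toLp 2 (W x) : EuclideanSpace ℝ ι)) t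
      = ∫ x, Complex.exp (((∑ i, t i * W x i : ℝ) : ℂ) * Complex.I) ∂μ := by
  have hm : Measurable (WithLp.toLp 2 : (ι → ℝ) → EuclideanSpace ℝ ι) := by fun_prop
  rw [charFun_apply]
  refine (integral_map (hm.comp_aemeasurable hW) (f := fun x : EuclideanSpace ℝ ι =>
    Complex.exp ((inner ℝ x t : ℝ) * Complex.I)) (by fun_prop)).trans ?_
  simp [PiLp.inner_apply]

/-- Convergence in distribution of random vectors from convergence of characteristic functions. -/
lemma tendstoInDistribution_of_integral_exp {Ω : ℕ+ → Type*} [∀ n, MeasurableSpace (Ω n)]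
    {P : ∀ n, Measure (Ω n)} [∀ n, IsProbabilityMeasure (P n)] {Ω' : Type*} [MeasurableSpace Ω']
    {P' : Measure Ω'} [IsProbabilityMeasure P'] {N : ℕ} {Y : ∀ n, Ω n → Fin N → ℝ}
    {Z : Ω' → Fin N → ℝ} (hY : ∀ n, AEMeasurable (Y n) (P n)) (hZ : AEMeasurable Z P')
    (h : ∀ c : Fin N → ℝ, Tendsto (fun n : ℕ+ => ∫ ω, Complex.exp
      (((∑ i, c i * Y n ω i : ℝ) : ℂ) * Complex.I) ∂(P n)) atTop
      (𝓝 (∫ ω, Complex.exp (((∑ i, c i * Z ω i : ℝ) : ℂ) * Complex.I) ∂P'))) :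
    TendstoInDistribution Y atTop Z P P' := by
  have hm : Measurable (WithLp.toLp 2 : (Fin N → ℝ) → EuclideanSpace ℝ (Fin N)) := by fun_prop
  -- Lévy's theorem is applied in the Euclidean space, where characteristic functions are defined by
  -- the inner product. The continuous map `WithLp.ofLp` carries the result back to `Fin N → ℝ`.
  have key : TendstoInDistribution
      (fun n ω => (WithLp.toLp 2 (Y n ω) : EuclideanSpace ℝ (Fin N))) atTop
      (fun ω => (WithLp.toLp 2 (Z ω) : EuclideanSpace ℝ (Fin N))) P P' := by
    refine ⟨fun n => hm.comp_aemeasurable (hY n), hm.comp_aemeasurable hZ, ?_⟩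
    refine tendsto_probabilityMeasure_of_charFun fun t => ?_
    simp only [ProbabilityMeasure.coe_mk]
    rw [charFun_map_toLp hZ t]
    refine (h t).congr fun n => ?_
    rw [charFun_map_toLp (hY n) t]
  exact key.continuous_comp (g := WithLp.ofLp) (by fun_prop)

end RWCurrent

end

/-! ### Convergence of the finite-dimensional distributions -/

theorem proposition3p1
    (p : PMF ℤ) (hp : RWCurrent.HasExpMoments p)
    {Ω : ℕ+ → Type*} [∀ n, MeasurableSpace (Ω n)]
    (P : ∀ n, Measure (Ω n)) [∀ n, IsProbabilityMeasure (P n)]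
    (η : ∀ n, ℤ → Ω n → ℕ) (X : ∀ n, ℤ → ℕ → ℝ≥0 → Ω n → ℤ)
    (hX : ∀ n, RWCurrent.IsWalkSystem (P n) p (η n) (X n))
    (ρ₀ v₀ : ℝ) (hρ₀ : 0 ≤ ρ₀) (hv₀ : 0 ≤ v₀)
    (hη : RWCurrent.InitialAssumption P η ρ₀ v₀)
    (T : ℝ≥0) (hT : 0 < T) (S : ℝ) (hS : 0 < S) :
    (∀ n : ℕ+, ∀ t ∈ Icc 0 T, ∀ r ∈ Icc (-S) S, ∀ᵐ ω ∂(P n),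
      Summable (RWCurrent.siteCurrent (RWCurrent.drift p) n (η n) (X n) t r ω)) ∧
    ∃ (Ω' : Type) (_ : MeasurableSpace Ω') (P' : Measure Ω') (_ : IsProbabilityMeasure P')
      (Z : ↥(Icc (0 : ℝ≥0) T ×ˢ Icc (-S) S) → Ω' → ℝ),
      IsGaussianProcess Z P' ∧
      (∀ a, ∫ ω, Z a ω ∂P' = 0) ∧
      (∀ a b, ∫ ω, Z a ω * Z b ω ∂P' =
        ρ₀ * RWCurrent.Gammaq (RWCurrent.kappa2 p) a b +
          v₀ * RWCurrent.Gamma0 (RWCurrent.kappa2 p) a b) ∧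
      ∀ (N : ℕ) (a : Fin N → ↥(Icc (0 : ℝ≥0) T ×ˢ Icc (-S) S)),
        TendstoInDistribution
          (fun (n : ℕ+) (ω : Ω n) (i : Fin N) =>
            (n : ℝ) ^ (-(1 / 4) : ℝ) *
              RWCurrent.current (RWCurrent.drift p) n (η n) (X n) (a i).1.1 (a i).1.2 ω)
          atTop (fun (ω : Ω') (i : Fin N) => Z (a i) ω) P P' := by
  obtain ⟨B, hB⟩ := hη.moment
  refine ⟨fun n t _ r _ => (hX n).ae_summable_siteCurrent hp (hB n) n (t, r), ?_⟩
  obtain ⟨Ω', mΩ', P', hP', Z, hZm, hZg, hZ0, hZc, hZe⟩ := RWCurrent.exists_gaussianProcess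
    (fun a b : ↥(Icc (0 : ℝ≥0) T ×ˢ Icc (-S) S) => RWCurrent.limitCov p ρ₀ v₀ a b)
    (fun a b => RWCurrent.limitCov_comm p ρ₀ v₀ a b) fun c => by
      -- The given particle systems themselves witness positive semidefiniteness, with the support
      -- of `c` as the finite family of space-time points.
      have h := hη.limitCov_nonneg hp hX (fun i : c.support => (i : ℝ≥0 × ℝ)) fun i => c i
      simp only [Finsupp.sum]
      rw [← Finset.sum_coe_sort]
      simpa only [← Finset.sum_coe_sort c.support] using h
  refine ⟨Ω', mΩ', P', hP', Z, hZg, hZ0, hZc, ?_⟩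
  intro N a
  refine RWCurrent.tendstoInDistribution_of_integral_exp
    (fun n => aemeasurable_pi_lambda _ fun i =>
      ((hX n).aemeasurable_current hp (hB n) n (a i)).const_mul _)
    (measurable_pi_lambda _ fun i => hZm (a i)).aemeasurable fun c => ?_
  rw [hZe (Fin N) a c]
  exact hη.tendsto_integral_exp_current hp hX (fun i => (a i : ℝ≥0 × ℝ)) c
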